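/- Let $n \ge 0$, let $R_n=\mathbb Z[x_1,\dots,x_n]$ with the permutation action of $S_n$, and let $s_i=(i,i+1)$, $1\le i\le n-1$. Let $\mathcal H=\mathcal H(S_n)$ be the diagrammatic Hecke category: the strict monoidal $\mathbb Z$-linear category whose objects are finite words in the colors $1,\dots,n-1$, with $\otimes$ given by concatenation, and whose morphisms are $\mathbb Z$-linear combinations of diagrams (read from bottom to top) generated by * $x_j:\varnothing\to\varnothing$ (degree $2$), the dots $\epsilon_i: i\to\varnothing$ and $\eta_i:\varnothing\to i$ (degree $1$), the trivalent vertices $\mu_i: ii\to i$ and $\delta_i:i\to ii$ (degree $-1$), the $4$-valent vertices $X_{ij}: ij\to ji$ for $|i-j|>1$ and the $6$-valent vertices $S_{ij}: iji\to jij$ for $|i-j|=1$ (degree $0$), modulo the following relations, where $1_w$ is the identity of the word $w$, $\mathrm{cap}_i=\epsilon_i\mu_i$, $\mathrm{cup}_i=\delta_i\eta_i$, $b_i=\eta_i\epsilon_i$ (the broken strand): * one color: $(\mu_i,\eta_i,\delta_i,\epsilon_i)$ makes $i$ a Frobenius algebra object; $\mu_i\delta_i=0$; $\epsilon_i\eta_i=x_i-x_{i+1}$;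 $1_i\otimes x_j=s_i(x_j)\otimes 1_i+\partial_i(x_j)\,b_i$ for all $j$, where $\partial_i(f)=(f-s_i f)/(x_i-x_{i+1})$; * colors $i,j$ with $|i-j|>1$: the rotation $(1_{ij}\otimes\mathrm{cap}_i)(1_i\otimes X_{ij}\otimes 1_i)(\mathrm{cup}_i\otimes 1_{ji})$ equals $X_{ji}$; $X_{ji}X_{ij}=1_{ij}$; $(1_j\otimes\epsilon_i)X_{ij}=\epsilon_i\otimes1_j$; $(1_j\otimes\mu_i)(X_{ij}\otimes1_i)(1_i\otimes X_{ij})=X_{ij}(\mu_i\otimes1_j)$; * colors $i,j$ with $|i-j|=1$: the rotation $(1_{iji}\otimes\mathrm{cap}_j)(1_i\otimes S_{ij}\otimes1_j)(\mathrm{cup}_i\otimes1_{jij})$ equals $S_{ji}$; $(1_{ji}\otimes\epsilon_j)S_{ij}=\epsilon_i\otimes1_{ji}+\eta_j\otimes\mu_i(1_i\otimes\epsilon_j\otimes1_i)$; $S_{ji}S_{ij}=1_{iji}+(1_i\otimes\eta_j\otimes1_i)\delta_i\mu_i(1_i\otimes\epsilon_j\otimes1_i)$; $S_{ij}(\mu_i\otimes1_{ji})=(1_{ji}\otimes\mu_j)(S_{ij}\otimes1_j)(1_i\otimes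 S_{ij})$; * three colors: for pairwise distant $i,j,k$, the two composites of $4$-valent vertices $ijk\to kji$ agree; for $|i-j|=1$ and $k$ distant from both, sliding a $k$-strand across $S_{ij}$ gives the same map $ijik\to kjij$; for $(i,j,k)=(i,i+1,i+2)$, the two maps $ijikji\to kjkijk$ given by the two sequences of braid moves (braid moves realised by $4$- and $6$-valent vertices) $ijikji\to jijkji\to jikjki\to jikjik\to jkijik\to jkjijk\to kjkijk$ and $ijikji\to ijkiji\to ijkjij\to ikjkij\to kijkij\to kijikj\to kjijkj\to kjikjk\to kjkijk$ agree. A derivation of $\mathcal H$ is a family of additive endomorphisms of all Hom groups satisfying the Leibniz rule for composition and for $\otimes$. **Theorem.** (1) There is a unique derivation $\mathbf d$ of $\mathcal H$ with $\mathbf d(x_j)=x_j^2$, $\mathbf d(\epsilon_i)=x_i\otimes\epsilon_i$, $\mathbf d(\eta_i)=x_{i+1}\otimes\eta_i$, $\mathbf d(\delta_i)=-(1_i\otimes x_i\otimes 1_i)\delta_i$, $\mathbf d(\mu_i)=-\mu_i(1_i\otimes x_{i+1}\otimes1_i)$, $\mathbf d(X_{ij})=0$, $\mathbf d(S_{i,i+1})=(1_{i+1}\otimes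 b_i\otimes1_{i+1})S_{i,i+1}-S_{i,i+1}(1_i\otimes b_{i+1}\otimes1_i)$, $\mathbf d(S_{i+1,i})=0$; there is a unique derivation $\mathbf z$ with $\mathbf z(x_j)=1$ killing all other generators; and there is a unique derivation $\mathbf h$ that multiplies each homogeneous morphism by its degree. Moreover $\mathbf d(\mathrm{cap}_i)=\epsilon_i\otimes\epsilon_i$, $\mathbf d(\mathrm{cup}_i)=-\eta_i\otimes\eta_i$, and $\mathbf z$ kills every diagram without polynomials. (2) $(\mathbf d,\mathbf h,-\mathbf z)$ is an $\mathfrak{sl}_2$ triple of operators: $[\mathbf d,-\mathbf z]=\mathbf h$, $[\mathbf h,\mathbf d]=2\mathbf d$, $[\mathbf h,-\mathbf z]=-2(-\mathbf z)$. (3) The divided powers are defined integrally for all $k\ge0$ and make $\mathcal H$ into a divided powers $\mathfrak{sl}_2$-algebra: there are operators $\mathbf d^{(k)},\mathbf z^{(k)}$ $(k\ge 0)$ on the integral Hom groups with $k!\,\mathbf d^{(k)}=\mathbf d^k$ and $k!\,\mathbf z^{(k)}=\mathbf z^k$, such that, for $D=\mathbf d$ and $D=\mathbf z$, $D^{(0)}=1$,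 $D^{(k)}D^{(l)}=\binom{k+l}{k}D^{(k+l)}$, $D^{(k)}(g f)=\sum_{i+j=k}D^{(i)}(g)D^{(j)}(f)$ and $D^{(k)}(f\otimes g)=\sum_{i+j=k}D^{(i)}(f)\otimes D^{(j)}(g)$; $\mathbf d^{(k)}$ and $\mathbf z^{(k)}$ change degrees by $2k$ and $-2k$; and for $f$ homogeneous of degree $m$ and all $r,s\ge0$, $$\mathbf d^{(r)}\mathbf z^{(s)}(f)=\sum_{t=0}^{\min(r,s)}(-1)^t\binom{m+r-s}{t}\,\mathbf z^{(s-t)}\mathbf d^{(r-t)}(f).$$ That is, Kostant's integral form of $U(\mathfrak{sl}_2)$, with $e^{(k)}=\mathbf d^{(k)}$ and $f^{(k)}=(-1)^k\mathbf z^{(k)}$, acts on $\mathcal H$ compatibly with composition and $\otimes$. -/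

import Mathlib

namespace HeckeDiag

/-! ### Colors and words

The simple reflections of the symmetric group `S_n` are indexed by `Fin (n - 1)`;
the color `i` stands for the transposition of the variables `lo i` and `hi i`. An object of the
diagrammatic Hecke category is a finite word in the colors; the monoidal product is concatenation
of words and the monoidal unit is the empty word. -/

/-- The set of simple reflections of `S_n`. -/
abbrev Color (n : ℕ) : Type := Fin (n - 1)

/-- The objects: words in the simple reflections. -/
abbrev Word (n : ℕ) : Type := List (Color n)

/-- The index of the first variable moved by the simple reflection `i`. -/
def lo {n : ℕ} (i : Color n) : Fin n := ⟨i.val, by omega⟩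

/-- The index of the second variable moved by the simple reflection `i`. -/
def hi {n : ℕ} (i : Color n) : Fin n := ⟨i.val + 1, by omega⟩

/-- The colors `i` and `j` are distinct and their simple reflections commute. -/
def Distant {n : ℕ} (i j : Color n) : Prop := i.val + 1 < j.val ∨ j.val + 1 < i.val

/-- The colors `i` and `j` are adjacent in the Coxeter graph. -/
def Adjacent {n : ℕ} (i j : Color n) : Prop := i.val + 1 = j.val ∨ j.val + 1 = i.val

theorem Distant.symm {n : ℕ} {i j : Color n} (h : Distant i j) : Distant j i := Or.symm h

theorem Adjacent.symm {n : ℕ} {i j : Color n} (h : Adjacent i j) : Adjacent j i := Or.symm h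

/-! ### Generators and formal linear combinations of diagrams -/

/-- The generating diagrams. Diagrams are read from bottom (source) to top (target). -/
inductive Gen (n : ℕ) : Word n → Word n → Type
  /-- the polynomial generator `x_j`, floating in a region -/
  | box (j : Fin n) : Gen n [] []
  /-- a strand coming from the bottom and ending in a dot -/
  | enddot (i : Color n) : Gen n [i] []
  /-- a strand starting in a dot and going to the top -/
  | startdot (i : Color n) : Gen n [] [i]
  /-- trivalent vertex with two bottom strands -/
  | merge (i : Color n) : Gen n [i, i] [i]
  /-- trivalent vertex with two top strands -/
  | split (i : Color n) : Gen n [i] [i, i]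
  /-- 4-valent vertex -/
  | cross (i j : Color n) (h : Distant i j) : Gen n [i, j] [j, i]
  /-- 6-valent vertex -/
  | six (i j : Color n) (h : Adjacent i j) : Gen n [i, j, i] [j, i, j]

/-- The degree of a generating diagram. -/
def Gen.degree {n : ℕ} {a b : Word n} : Gen n a b → ℤ
  | .box _ => 2
  | .enddot _ => 1
  | .startdot _ => 1
  | .merge _ => -1
  | .split _ => -1
  | .cross _ _ _ => 0
  | .six _ _ _ => 0

/-- The generating diagram is a polynomial generator. -/
def Gen.IsBox {n : ℕ} {a b : Word n} : Gen n a b → Prop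
  | .box _ => True
  | _ => False

/-- Formal expressions built from the generators by vertical composition, horizontal
juxtaposition and integral linear combination. The source and target of a juxtaposition are given
up to an equality of words, so that no casts are needed to express strict associativity. -/
inductive Term (n : ℕ) : Word n → Word n → Type
  | of {a b : Word n} (g : Gen n a b) : Term n a b
  | id (a : Word n) : Term n a a
  | comp {a b c : Word n} (f : Term n a b) (g : Term n b c) : Term n a c
  | tensor {a b c d s t : Word n} (f : Term n a b) (g : Term n c d)
      (hs : s = a ++ c) (ht : t = b ++ d) : Term n s t
  | zero {a b : Word n} : Term n a b
  | add {a b : Word n} (f g : Term n a b) : Term n a b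
  | neg {a b : Word n} (f : Term n a b) : Term n a b

/-- Juxtaposition, `f` on the left of `g`. -/
abbrev Term.tens {n : ℕ} {a b c d : Word n} (f : Term n a b) (g : Term n c d) :
    Term n (a ++ c) (b ++ d) := Term.tensor f g rfl rfl

local infixl:70 " ⬝ " => Term.comp
local notation:80 f:81 " ⊠ " g:80 => Term.tensor f g rfl rfl

namespace Term

variable {n : ℕ}

abbrev box (j : Fin n) : Term n [] [] := .of (.box j)
abbrev enddot (i : Color n) : Term n [i] [] := .of (.enddot i)
abbrev startdot (i : Color n) : Term n [] [i] := .of (.startdot i)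
abbrev merge (i : Color n) : Term n [i, i] [i] := .of (.merge i)
abbrev split (i : Color n) : Term n [i] [i, i] := .of (.split i)
abbrev cross (i j : Color n) (h : Distant i j) : Term n [i, j] [j, i] := .of (.cross i j h)
abbrev six (i j : Color n) (h : Adjacent i j) : Term n [i, j, i] [j, i, j] := .of (.six i j h)

/-- The identity of a word: vertical strands. -/
abbrev str (a : Word n) : Term n a a := .id a

/-- The cap: two trivalently merged strands, ended by a dot. -/
abbrev cap (i : Color n) : Term n [i, i] [] := merge i ⬝ enddot i

/-- The cup: a strand started by a dot, trivalently split. -/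
abbrev cup (i : Color n) : Term n [] [i, i] := startdot i ⬝ split i

/-- The broken vertical strand. -/
abbrev broken (i : Color n) : Term n [i] [i] := enddot i ⬝ startdot i

end Term

/-! ### The relations -/

open Term in
/-- The local relations of the diagrammatic Hecke category. -/
inductive LocalRel (n : ℕ) : {a b : Word n} → Term n a b → Term n a b → Prop
  -- One color: isotopy invariance of univalent and trivalent vertices (a Frobenius algebra).
  | merge_assoc (i : Color n) :
      LocalRel n ((merge i ⊠ str [i]) ⬝ merge i) ((str [i] ⊠ merge i) ⬝ merge i)
  | split_coassoc (i : Color n) :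
      LocalRel n (split i ⬝ (split i ⊠ str [i])) (split i ⬝ (str [i] ⊠ split i))
  | frobenius_left (i : Color n) :
      LocalRel n ((str [i] ⊠ split i) ⬝ (merge i ⊠ str [i])) (merge i ⬝ split i)
  | frobenius_right (i : Color n) :
      LocalRel n ((split i ⊠ str [i]) ⬝ (str [i] ⊠ merge i)) (merge i ⬝ split i)
  | unit_left (i : Color n) : LocalRel n ((startdot i ⊠ str [i]) ⬝ merge i) (str [i])
  | unit_right (i : Color n) : LocalRel n ((str [i] ⊠ startdot i) ⬝ merge i) (str [i])
  | counit_left (i : Color n) : LocalRel n (split i ⬝ (enddot i ⊠ str [i])) (str [i])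
  | counit_right (i : Color n) : LocalRel n (split i ⬝ (str [i] ⊠ enddot i)) (str [i])
  -- One color: needle, barbell, polynomial forcing.
  | needle (i : Color n) : LocalRel n (split i ⬝ merge i) zero
  | barbell (i : Color n) :
      LocalRel n (startdot i ⬝ enddot i) (add (box (lo i)) (neg (box (hi i))))
  | force_lo (i : Color n) :
      LocalRel n (str [i] ⊠ box (lo i)) (add (box (hi i) ⊠ str [i]) (broken i))
  | force_hi (i : Color n) :
      LocalRel n (str [i] ⊠ box (hi i)) (add (box (lo i) ⊠ str [i]) (neg (broken i)))
  | force_other (i : Color n) (j : Fin n) (hlo : j ≠ lo i) (hhi : j ≠ hi i) :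
      LocalRel n (str [i] ⊠ box j) (box j ⊠ str [i])
  -- Two distant colors.
  | cross_rotate (i j : Color n) (h : Distant i j) :
      LocalRel n
        ((cup i ⊠ str [j, i]) ⬝ (str [i] ⊠ cross i j h ⊠ str [i]) ⬝ (str [i, j] ⊠ cap i))
        (cross j i h.symm)
  | cross_cross (i j : Color n) (h : Distant i j) :
      LocalRel n (cross i j h ⬝ cross j i h.symm) (str [i, j])
  | cross_dot (i j : Color n) (h : Distant i j) :
      LocalRel n (cross i j h ⬝ (str [j] ⊠ enddot i)) (enddot i ⊠ str [j])
  | cross_merge (i j : Color n) (h : Distant i j) :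
      LocalRel n
        ((str [i] ⊠ cross i j h) ⬝ (cross i j h ⊠ str [i]) ⬝ (str [j] ⊠ merge i))
        ((merge i ⊠ str [j]) ⬝ cross i j h)
  -- Two adjacent colors.
  | six_rotate (i j : Color n) (h : Adjacent i j) :
      LocalRel n
        ((cup i ⊠ str [j, i, j]) ⬝ (str [i] ⊠ six i j h ⊠ str [j]) ⬝ (str [i, j, i] ⊠ cap j))
        (six j i h.symm)
  | six_dot (i j : Color n) (h : Adjacent i j) :
      LocalRel n
        (six i j h ⬝ (str [j, i] ⊠ enddot j))
        (add (enddot i ⊠ str [j, i])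
          ((str [i] ⊠ enddot j ⊠ str [i]) ⬝ merge i ⬝ (startdot j ⊠ str [i])))
  | six_six (i j : Color n) (h : Adjacent i j) :
      LocalRel n
        (six i j h ⬝ six j i h.symm)
        (add (str [i, j, i])
          ((str [i] ⊠ enddot j ⊠ str [i]) ⬝ merge i ⬝ split i ⬝ (str [i] ⊠ startdot j ⊠ str [i])))
  | six_merge (i j : Color n) (h : Adjacent i j) :
      LocalRel n
        ((merge i ⊠ str [j, i]) ⬝ six i j h)
        ((str [i] ⊠ six i j h) ⬝ (six i j h ⊠ str [j]) ⬝ (str [j, i] ⊠ merge j))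
  -- Three colors, of type `A1 x A1 x A1`.
  | three_distant (i j k : Color n) (hij : Distant i j) (hik : Distant i k) (hjk : Distant j k) :
      LocalRel n
        ((cross i j hij ⊠ str [k]) ⬝ (str [j] ⊠ cross i k hik) ⬝ (cross j k hjk ⊠ str [i]))
        ((str [i] ⊠ cross j k hjk) ⬝ (cross i k hik ⊠ str [j]) ⬝ (str [k] ⊠ cross i j hij))
  -- Three colors, of type `A2 x A1`.
  | six_distant (i j k : Color n) (hij : Adjacent i j) (hik : Distant i k) (hjk : Distant j k) :
      LocalRel n
        ((str [i, j] ⊠ cross i k hik) ⬝ (str [i] ⊠ cross j k hjk ⊠ str [i])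
          ⬝ (cross i k hik ⊠ str [j, i]) ⬝ (str [k] ⊠ six i j hij))
        ((six i j hij ⊠ str [k]) ⬝ (str [j, i] ⊠ cross j k hjk)
          ⬝ (str [j] ⊠ cross i k hik ⊠ str [j]) ⬝ (cross j k hjk ⊠ str [i, j]))
  -- Three colors, of type `A3` (the Zamolodchikov relation).
  | zamolodchikov (i j k : Color n) (hij : Adjacent i j) (hjk : Adjacent j k)
      (hik : Distant i k) (h1 : i.val + 1 = j.val) (h2 : j.val + 1 = k.val) :
      LocalRel n
        ((six i j hij ⊠ str [k, j, i])
          ⬝ (str [j, i] ⊠ six j k hjk ⊠ str [i])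
          ⬝ (str [j, i, k, j] ⊠ cross k i hik.symm)
          ⬝ (str [j] ⊠ cross i k hik ⊠ str [j, i, k])
          ⬝ (str [j, k] ⊠ six i j hij ⊠ str [k])
          ⬝ (six j k hjk ⊠ str [i, j, k]))
        ((str [i, j] ⊠ cross i k hik ⊠ str [j, i])
          ⬝ (str [i, j, k] ⊠ six i j hij)
          ⬝ (str [i] ⊠ six j k hjk ⊠ str [i, j])
          ⬝ (cross i k hik ⊠ str [j, k, i, j])
          ⬝ (str [k, i, j] ⊠ cross k i hik.symm ⊠ str [j])
          ⬝ (str [k] ⊠ six i j hij ⊠ str [k, j])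
          ⬝ (str [k, j, i] ⊠ six j k hjk)
          ⬝ (str [k, j] ⊠ cross i k hik ⊠ str [j, k]))

/-- The congruence on formal expressions generated by the axioms of a strict monoidal category
enriched in abelian groups and by the local relations. -/
inductive Rel (n : ℕ) : {a b : Word n} → Term n a b → Term n a b → Prop
  | refl {a b : Word n} (f : Term n a b) : Rel n f f
  | symm {a b : Word n} {f g : Term n a b} (h : Rel n f g) : Rel n g f
  | trans {a b : Word n} {f g k : Term n a b} (h : Rel n f g) (h' : Rel n g k) : Rel n f k
  | comp_congr {a b c : Word n} {f f' : Term n a b} {g g' : Term n b c}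
      (h : Rel n f f') (h' : Rel n g g') : Rel n (f.comp g) (f'.comp g')
  | tensor_congr {a b c d s t : Word n} {f f' : Term n a b} {g g' : Term n c d}
      (hs : s = a ++ c) (ht : t = b ++ d) (h : Rel n f f') (h' : Rel n g g') :
      Rel n (f.tensor g hs ht) (f'.tensor g' hs ht)
  | add_congr {a b : Word n} {f f' g g' : Term n a b}
      (h : Rel n f f') (h' : Rel n g g') : Rel n (f.add g) (f'.add g')
  | neg_congr {a b : Word n} {f f' : Term n a b} (h : Rel n f f') : Rel n f.neg f'.neg
  -- abelian groups
  | add_assoc {a b : Word n} (f g k : Term n a b) :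
      Rel n ((f.add g).add k) (f.add (g.add k))
  | add_comm {a b : Word n} (f g : Term n a b) : Rel n (f.add g) (g.add f)
  | zero_add {a b : Word n} (f : Term n a b) : Rel n (Term.zero.add f) f
  | neg_add {a b : Word n} (f : Term n a b) : Rel n (f.neg.add f) Term.zero
  -- bilinearity
  | add_comp {a b c : Word n} (f f' : Term n a b) (g : Term n b c) :
      Rel n ((f.add f').comp g) ((f.comp g).add (f'.comp g))
  | comp_add {a b c : Word n} (f : Term n a b) (g g' : Term n b c) :
      Rel n (f.comp (g.add g')) ((f.comp g).add (f.comp g'))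
  | add_tensor {a b c d s t : Word n} (f f' : Term n a b) (g : Term n c d)
      (hs : s = a ++ c) (ht : t = b ++ d) :
      Rel n ((f.add f').tensor g hs ht) ((f.tensor g hs ht).add (f'.tensor g hs ht))
  | tensor_add {a b c d s t : Word n} (f : Term n a b) (g g' : Term n c d)
      (hs : s = a ++ c) (ht : t = b ++ d) :
      Rel n (f.tensor (g.add g') hs ht) ((f.tensor g hs ht).add (f.tensor g' hs ht))
  -- category
  | id_comp {a b : Word n} (f : Term n a b) : Rel n ((Term.id a).comp f) f
  | comp_id {a b : Word n} (f : Term n a b) : Rel n (f.comp (Term.id b)) f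
  | comp_assoc {a b c d : Word n} (f : Term n a b) (g : Term n b c) (k : Term n c d) :
      Rel n ((f.comp g).comp k) (f.comp (g.comp k))
  -- strict monoidal structure
  | tensor_id (a c : Word n) : Rel n ((Term.id a).tens (Term.id c)) (Term.id (a ++ c))
  | interchange {a a' a'' c c' c'' s t : Word n} (f : Term n a a') (f' : Term n a' a'')
      (g : Term n c c') (g' : Term n c' c'') (hs : s = a ++ c) (ht : t = a'' ++ c'') :
      Rel n ((f.comp f').tensor (g.comp g') hs ht)
        ((f.tensor g hs rfl).comp (f'.tensor g' rfl ht))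
  | unit_tensor {a b : Word n} (f : Term n a b) : Rel n ((Term.id []).tensor f rfl rfl) f
  | tensor_unit {a b : Word n} (f : Term n a b) (hs : a = a ++ []) (ht : b = b ++ []) :
      Rel n (f.tensor (Term.id []) hs ht) f
  | tensor_assoc {a a' b b' c c' s t : Word n} (f : Term n a a') (g : Term n b b')
      (k : Term n c c') (hs : s = (a ++ b) ++ c) (ht : t = (a' ++ b') ++ c')
      (hs' : s = a ++ (b ++ c)) (ht' : t = a' ++ (b' ++ c')) :
      Rel n ((f.tens g).tensor k hs ht) (f.tensor (g.tens k) hs' ht')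
  -- the local relations
  | of_local {a b : Word n} {f g : Term n a b} (h : LocalRel n f g) : Rel n f g

/-! ### The morphism groups of the diagrammatic Hecke category -/

instance termSetoid (n : ℕ) (a b : Word n) : Setoid (Term n a b) where
  r := Rel n
  iseqv := ⟨Rel.refl, Rel.symm, Rel.trans⟩

/-- The morphisms `a ⟶ b` of the diagrammatic Hecke category of `S_n`. -/
def Hom {n : ℕ} (a b : Word n) : Type := Quotient (termSetoid n a b)

namespace Hom

variable {n : ℕ}

/-- The morphism represented by a formal expression. -/
def mk {a b : Word n} (f : Term n a b) : Hom a b := Quotient.mk _ f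

/-- The morphism represented by a generating diagram. -/
def of {a b : Word n} (g : Gen n a b) : Hom a b := mk (.of g)

/-- The identity morphism. -/
def id (a : Word n) : Hom a a := mk (.id a)

/-- Vertical composition: first `f` (at the bottom), then `g` (on top). -/
def comp {a b c : Word n} (f : Hom a b) (g : Hom b c) : Hom a c :=
  Quotient.map₂ Term.comp (fun _ _ h _ _ h' => Rel.comp_congr h h') f g

/-- The monoidal product: `f` on the left of `g`. -/
def tens {a b c d : Word n} (f : Hom a b) (g : Hom c d) : Hom (a ++ c) (b ++ d) :=
  Quotient.map₂ Term.tens (fun _ _ h _ _ h' => Rel.tensor_congr rfl rfl h h') f g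

instance instAdd (a b : Word n) : Add (Hom a b) where
  add := Quotient.map₂ Term.add (fun _ _ h _ _ h' => Rel.add_congr h h')

instance instZero (a b : Word n) : Zero (Hom a b) where
  zero := mk Term.zero

instance instNeg (a b : Word n) : Neg (Hom a b) where
  neg := Quotient.map Term.neg (fun _ _ h => Rel.neg_congr h)

instance instAddCommGroup (a b : Word n) : AddCommGroup (Hom a b) where
  add_assoc := by
    rintro ⟨f⟩ ⟨g⟩ ⟨k⟩
    exact Quotient.sound (Rel.add_assoc f g k)
  zero_add := by
    rintro ⟨f⟩
    exact Quotient.sound (Rel.zero_add f)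
  add_zero := by
    rintro ⟨f⟩
    exact Quotient.sound ((Rel.add_comm f _).trans (Rel.zero_add f))
  neg_add_cancel := by
    rintro ⟨f⟩
    exact Quotient.sound (Rel.neg_add f)
  add_comm := by
    rintro ⟨f⟩ ⟨g⟩
    exact Quotient.sound (Rel.add_comm f g)
  nsmul := nsmulRec
  zsmul := zsmulRec

/-- The polynomial `x_j`, an endomorphism of the monoidal unit. -/
def x (j : Fin n) : Hom (n := n) [] [] := of (.box j)

def enddot (i : Color n) : Hom [i] [] := of (.enddot i)
def startdot (i : Color n) : Hom [] [i] := of (.startdot i)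
def merge (i : Color n) : Hom [i, i] [i] := of (.merge i)
def split (i : Color n) : Hom [i] [i, i] := of (.split i)
def cross (i j : Color n) (h : Distant i j) : Hom [i, j] [j, i] := of (.cross i j h)
def six (i j : Color n) (h : Adjacent i j) : Hom [i, j, i] [j, i, j] := of (.six i j h)
def cap (i : Color n) : Hom [i, i] [] := (merge i).comp (enddot i)
def cup (i : Color n) : Hom [] [i, i] := (startdot i).comp (split i)

/-- The broken vertical strand. -/
def broken (i : Color n) : Hom [i] [i] := (enddot i).comp (startdot i)

/-- The 6-valent vertex with its middle top strand broken. -/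
def sixBrokenTop (i j : Color n) (h : Adjacent i j) : Hom [i, j, i] [j, i, j] :=
  (six i j h).comp ((id [j]).tens ((broken i).tens (id [j])))

/-- The 6-valent vertex with its middle bottom strand broken. -/
def sixBrokenBottom (i j : Color n) (h : Adjacent i j) : Hom [i, j, i] [j, i, j] :=
  ((id [i]).tens ((broken j).tens (id [i]))).comp (six i j h)

end Hom

/-- `IsHomogeneous f m`: the morphism `f` is an integral combination of diagrams of degree `m`,
the degree of a diagram being the sum of the degrees of its generators. -/
inductive IsHomogeneous {n : ℕ} : {a b : Word n} → Hom a b → ℤ → Prop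
  | of {a b : Word n} (g : Gen n a b) : IsHomogeneous (Hom.of g) g.degree
  | id (a : Word n) : IsHomogeneous (Hom.id a) 0
  | comp {a b c : Word n} {f : Hom a b} {g : Hom b c} {m m' : ℤ}
      (hf : IsHomogeneous f m) (hg : IsHomogeneous g m') : IsHomogeneous (f.comp g) (m + m')
  | tens {a b c d : Word n} {f : Hom a b} {g : Hom c d} {m m' : ℤ}
      (hf : IsHomogeneous f m) (hg : IsHomogeneous g m') : IsHomogeneous (f.tens g) (m + m')
  | zero (a b : Word n) (m : ℤ) : IsHomogeneous (0 : Hom a b) m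
  | add {a b : Word n} {f g : Hom a b} {m : ℤ}
      (hf : IsHomogeneous f m) (hg : IsHomogeneous g m) : IsHomogeneous (f + g) m
  | neg {a b : Word n} {f : Hom a b} {m : ℤ} (hf : IsHomogeneous f m) : IsHomogeneous (-f) m

/-- The morphism `f` is represented by a single diagram without polynomials. -/
inductive IsPolynomialFree {n : ℕ} : {a b : Word n} → Hom a b → Prop
  | of {a b : Word n} (g : Gen n a b) (hg : ¬ g.IsBox) : IsPolynomialFree (Hom.of g)
  | id (a : Word n) : IsPolynomialFree (Hom.id a)
  | comp {a b c : Word n} {f : Hom a b} {g : Hom b c}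
      (hf : IsPolynomialFree f) (hg : IsPolynomialFree g) : IsPolynomialFree (f.comp g)
  | tens {a b c d : Word n} {f : Hom a b} {g : Hom c d}
      (hf : IsPolynomialFree f) (hg : IsPolynomialFree g) : IsPolynomialFree (f.tens g)

/-! ### Operators, derivations and the `sl_2` action -/

/-- Operators on the category: a family of additive endomorphisms of all morphism groups.
They form a ring under composition. -/
abbrev Operator (n : ℕ) : Type := (a b : Word n) → AddMonoid.End (Hom a b)

/-- Derivations of the monoidal category. -/
structure IsDerivation {n : ℕ} (D : Operator n) : Prop where
  map_comp : ∀ {a b c : Word n} (f : Hom a b) (g : Hom b c),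
    D a c (f.comp g) = (D a b f).comp g + f.comp (D b c g)
  map_tens : ∀ {a b c d : Word n} (f : Hom a b) (g : Hom c d),
    D (a ++ c) (b ++ d) (f.tens g) = (D a b f).tens g + f.tens (D c d g)

/-- The raising operator `d`: the derivation with the following values on the generators. -/
structure IsRaising {n : ℕ} (d : Operator n) : Prop extends IsDerivation d where
  map_x : ∀ j : Fin n, d [] [] (Hom.x j) = (Hom.x j).comp (Hom.x j)
  map_enddot : ∀ i : Color n,
    d [i] [] (Hom.enddot i) = (Hom.x (lo i)).tens (Hom.enddot i)
  map_startdot : ∀ i : Color n,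
    d [] [i] (Hom.startdot i) = (Hom.x (hi i)).tens (Hom.startdot i)
  map_split : ∀ i : Color n,
    d [i] [i, i] (Hom.split i)
      = -((Hom.split i).comp ((Hom.id [i]).tens ((Hom.x (lo i)).tens (Hom.id [i]))))
  map_merge : ∀ i : Color n,
    d [i, i] [i] (Hom.merge i)
      = -(((Hom.id [i]).tens ((Hom.x (hi i)).tens (Hom.id [i]))).comp (Hom.merge i))
  map_cross : ∀ (i j : Color n) (h : Distant i j),
    d [i, j] [j, i] (Hom.cross i j h) = 0
  /-- the 6-valent vertex with source `(i, i+1, i)` -/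
  map_six : ∀ (i j : Color n) (h : Adjacent i j), i.val + 1 = j.val →
    d [i, j, i] [j, i, j] (Hom.six i j h)
      = Hom.sixBrokenTop i j h - Hom.sixBrokenBottom i j h
  /-- the 6-valent vertex with source `(i+1, i, i+1)` -/
  map_six' : ∀ (i j : Color n) (h : Adjacent i j), j.val + 1 = i.val →
    d [i, j, i] [j, i, j] (Hom.six i j h) = 0

/-- The lowering operator `z`: the derivation that sends every `x_j` to `1` and kills the
generators other than the `x_j`. -/
structure IsLowering {n : ℕ} (z : Operator n) : Prop extends IsDerivation z where
  map_x : ∀ j : Fin n, z [] [] (Hom.x j) = Hom.id []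
  map_gen : ∀ {a b : Word n} (g : Gen n a b), ¬ g.IsBox → z a b (Hom.of g) = 0

/-- The degree operator: the derivation that multiplies homogeneous morphisms by their degree. -/
structure IsDegreeOperator {n : ℕ} (h : Operator n) : Prop extends IsDerivation h where
  map_homogeneous : ∀ {a b : Word n} (f : Hom a b) (m : ℤ),
    IsHomogeneous f m → h a b f = m • f

/-- A sequence of divided powers of a derivation: `D^{(0)} = 1`,
`D^{(k)} D^{(l)} = binom(k+l,k) D^{(k+l)}`, and the higher Leibniz rules hold. -/
structure IsDividedPowerSystem {n : ℕ} (D : ℕ → Operator n) : Prop where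
  zero : D 0 = 1
  mul : ∀ k l : ℕ, D k * D l = (k + l).choose k • D (k + l)
  map_comp : ∀ (k : ℕ) {a b c : Word n} (f : Hom a b) (g : Hom b c),
    D k a c (f.comp g)
      = ∑ p ∈ Finset.HasAntidiagonal.antidiagonal k, (D p.1 a b f).comp (D p.2 b c g)
  map_tens : ∀ (k : ℕ) {a b c d : Word n} (f : Hom a b) (g : Hom c d),
    D k (a ++ c) (b ++ d) (f.tens g)
      = ∑ p ∈ Finset.HasAntidiagonal.antidiagonal k, (D p.1 a b f).tens (D p.2 c d g)

/-- The operators `dd k = d^{(k)}` and `zz k = z^{(k)}` make the category into a divided powers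
`sl_2`-algebra: with `e = d`, `f = -z` and `h` the degree, the divided power (Kostant)
`ℤ`-form of the enveloping algebra of `sl_2`, generated by `e^{(k)} = d^{(k)}` and
`f^{(k)} = (-1)^k z^{(k)}`, acts compatibly with composition and monoidal product. The
field `dd_zz` is Kostant's relation
`e^{(r)} f^{(s)} = ∑ t, f^{(s-t)} binom(h - r - s + 2t, t) e^{(r-t)}`
applied to a vector of weight `m`. -/
structure IsDividedPowersSl2Algebra {n : ℕ} (dd zz : ℕ → Operator n) : Prop where
  dd_system : IsDividedPowerSystem dd
  zz_system : IsDividedPowerSystem zz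
  dd_degree : ∀ (k : ℕ) {a b : Word n} (f : Hom a b) (m : ℤ),
    IsHomogeneous f m → IsHomogeneous (dd k a b f) (m + 2 * k)
  zz_degree : ∀ (k : ℕ) {a b : Word n} (f : Hom a b) (m : ℤ),
    IsHomogeneous f m → IsHomogeneous (zz k a b f) (m - 2 * k)
  dd_zz : ∀ (r s : ℕ) {a b : Word n} (f : Hom a b) (m : ℤ), IsHomogeneous f m →
    dd r a b (zz s a b f)
      = ∑ t ∈ Finset.range (min r s + 1),
          ((-1) ^ t * Ring.choose (m + r - s) t : ℤ) • zz (s - t) a b (dd (r - t) a b f)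

end HeckeDiag

set_option linter.unusedSectionVars false

/-! The derivations and all their divided powers are built at once, as the coefficients of the
exponentials exp(t d) and exp(t z). Such an exponential is a monoidal functor from the category to
its version with morphisms in formal power series in a central variable t. It is given by values on
the generators, and it exists as soon as these values satisfy the local relations. The coefficient
of t^k is then an integral operator, and multiplicativity of the functor is the higher Leibniz rule.

For z the functor is the translation of every x_j to x_j + t. For d, put u_j = 1/(1 - t x_j). The
equation d x = x^2 gives x_j ↦ x_j u_j. A generator multiplied by x under d acquires the factor u,
and one multiplied by -x acquires 1 - t x. So the dots are scaled by u_i and u_{i+1}, and the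
trivalent vertices acquire 1 - t x_{i+1} or 1 - t x_i between their legs. The vertex S_{i,i+1}
acquires u_i u_{i+2} on the left and 1 - t x_{i+1} in one bottom and one top region, while 4-valent
vertices and S_{i+1,i} are fixed.

The relations are checked for an abstract action of the diagrams on a linear category. A color is an
endofunctor, a generator is a natural transformation, and scalars are polynomials in the leftmost
region. The endofunctors are additive but not linear, and polynomial forcing measures the failure.
Symmetric expressions in x_i, x_{i+1} do slide through the strand i, and most verifications consist
in isolating a symmetric factor. In the relation between the 6-valent and trivalent vertices, the
remaining error contains a needle and vanishes (`six_br_six_merge`).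

The Zamolodchikov relation is not computed with the deformed vertices. Its half turn involves only
the vertices S_{i+1,i}, which are not deformed. Uniqueness of mates under nested caps transports the
relation to its half turn and back (`rotatedZamolodchikov`, `zamolodchikov_of_rotated`).

The product law for divided powers and Kostant's relation pass through composition and tensor
product by Vandermonde convolution (`sum_choose_convolution`, `sum_commutation_convolution`), so
generators suffice. The vertices S_{i,i+1} can be omitted there, being rotations of S_{i+1,i}. On
the rest the laws are binomial identities for powers of a single variable. Kostant's relation with r
= s = 1 says that [d, -z] multiplies by the degree, which also produces h. -/

namespace HeckeDiag

/-! ### The morphism groups form a strict monoidal category -/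

namespace Hom

variable {n : ℕ}

/-- The monoidal product, with source and target given up to an equality of words. -/
def tensor {a b c d s t : Word n} (f : Hom a b) (g : Hom c d) (hs : s = a ++ c)
    (ht : t = b ++ d) : Hom s t :=
  Quotient.map₂ (fun f g => Term.tensor f g hs ht)
    (fun _ _ h _ _ h' => Rel.tensor_congr hs ht h h') f g

@[elab_as_elim]
theorem ind {a b : Word n} {P : Hom a b → Prop} (h : ∀ T : Term n a b, P (mk T)) (f : Hom a b) :
    P f := Quotient.ind h f

theorem mk_eq {a b : Word n} {f g : Term n a b} (h : Rel n f g) : mk f = mk g := Quotient.sound h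

theorem mk_comp {a b c : Word n} (f : Term n a b) (g : Term n b c) :
    mk (f.comp g) = (mk f).comp (mk g) := rfl

theorem mk_tensor {a b c d s t : Word n} (f : Term n a b) (g : Term n c d) (hs : s = a ++ c)
    (ht : t = b ++ d) : mk (f.tensor g hs ht) = (mk f).tensor (mk g) hs ht := rfl

theorem mk_add {a b : Word n} (f g : Term n a b) : mk (f.add g) = mk f + mk g := rfl

theorem mk_neg {a b : Word n} (f : Term n a b) : mk f.neg = -mk f := rfl

theorem add_comp {a b c : Word n} (f f' : Hom a b) (g : Hom b c) :
    (f + f').comp g = f.comp g + f'.comp g := by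
  induction f using ind; induction f' using ind; induction g using ind
  exact mk_eq (Rel.add_comp _ _ _)

theorem comp_add {a b c : Word n} (f : Hom a b) (g g' : Hom b c) :
    f.comp (g + g') = f.comp g + f.comp g' := by
  induction f using ind; induction g using ind; induction g' using ind
  exact mk_eq (Rel.comp_add _ _ _)

theorem add_tensor {a b c d s t : Word n} (f f' : Hom a b) (g : Hom c d) (hs : s = a ++ c)
    (ht : t = b ++ d) :
    (f + f').tensor g hs ht = f.tensor g hs ht + f'.tensor g hs ht := by
  induction f using ind; induction f' using ind; induction g using ind
  exact mk_eq (Rel.add_tensor _ _ _ _ _)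

theorem tensor_add {a b c d s t : Word n} (f : Hom a b) (g g' : Hom c d) (hs : s = a ++ c)
    (ht : t = b ++ d) :
    f.tensor (g + g') hs ht = f.tensor g hs ht + f.tensor g' hs ht := by
  induction f using ind; induction g using ind; induction g' using ind
  exact mk_eq (Rel.tensor_add _ _ _ _ _)

theorem id_comp {a b : Word n} (f : Hom a b) : (id a).comp f = f := by
  induction f using ind
  exact mk_eq (Rel.id_comp _)

theorem comp_id {a b : Word n} (f : Hom a b) : f.comp (id b) = f := by
  induction f using ind
  exact mk_eq (Rel.comp_id _)

theorem comp_assoc {a b c d : Word n} (f : Hom a b) (g : Hom b c) (k : Hom c d) :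
    (f.comp g).comp k = f.comp (g.comp k) := by
  induction f using ind; induction g using ind; induction k using ind
  exact mk_eq (Rel.comp_assoc _ _ _)

theorem tensor_id {a c s : Word n} (hs : s = a ++ c) : (id a).tensor (id c) hs hs = id s := by
  subst hs
  exact mk_eq (Rel.tensor_id _ _)

theorem interchange {a a' a'' c c' c'' s m t : Word n} (f : Hom a a') (f' : Hom a' a'')
    (g : Hom c c') (g' : Hom c' c'') (hs : s = a ++ c) (hm : m = a' ++ c') (ht : t = a'' ++ c'') :
    (f.comp f').tensor (g.comp g') hs ht = (f.tensor g hs hm).comp (f'.tensor g' hm ht) := by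
  subst hm
  induction f using ind; induction f' using ind; induction g using ind; induction g' using ind
  exact mk_eq (Rel.interchange _ _ _ _ _ _)

theorem unit_tensor {a b : Word n} (f : Hom a b) (hs : a = [] ++ a) (ht : b = [] ++ b) :
    (id []).tensor f hs ht = f := by
  induction f using ind
  exact mk_eq (Rel.unit_tensor _)

theorem tensor_unit {a b : Word n} (f : Hom a b) (hs : a = a ++ []) (ht : b = b ++ []) :
    f.tensor (id []) hs ht = f := by
  induction f using ind
  exact mk_eq (Rel.tensor_unit _ _ _)

theorem tensor_assoc {a a' b b' c c' ab ab' bc bc' s t : Word n} (f : Hom a a') (g : Hom b b')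
    (k : Hom c c') (h1 : ab = a ++ b) (h2 : ab' = a' ++ b') (h3 : s = ab ++ c) (h4 : t = ab' ++ c')
    (h5 : bc = b ++ c) (h6 : bc' = b' ++ c') (h7 : s = a ++ bc) (h8 : t = a' ++ bc') :
    (f.tensor g h1 h2).tensor k h3 h4 = f.tensor (g.tensor k h5 h6) h7 h8 := by
  subst h1 h2 h5 h6
  induction f using ind; induction g using ind; induction k using ind
  exact mk_eq (Rel.tensor_assoc _ _ _ _ _ _ _)

/-- Composition as a biadditive map. -/
def compHom (a b c : Word n) : Hom a b →+ Hom b c →+ Hom a c :=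
  AddMonoidHom.mk' (fun f => AddMonoidHom.mk' (fun g => f.comp g) (comp_add f))
    (fun f f' => AddMonoidHom.ext fun g => add_comp f f' g)

/-- The monoidal product as a biadditive map. -/
def tensorHom {a b c d s t : Word n} (hs : s = a ++ c) (ht : t = b ++ d) :
    Hom a b →+ Hom c d →+ Hom s t :=
  AddMonoidHom.mk' (fun f => AddMonoidHom.mk' (fun g => f.tensor g hs ht)
    (fun g g' => tensor_add f g g' hs ht))
    (fun f f' => AddMonoidHom.ext fun g => add_tensor f f' g hs ht)

theorem compHom_apply {a b c : Word n} (f : Hom a b) (g : Hom b c) :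
    compHom a b c f g = f.comp g := rfl

theorem tensorHom_apply {a b c d s t : Word n} (hs : s = a ++ c) (ht : t = b ++ d) (f : Hom a b)
    (g : Hom c d) : tensorHom hs ht f g = f.tensor g hs ht := rfl

end Hom

end HeckeDiag

namespace HeckeDiag

/-! ### Cauchy products of sequences -/

section CauchyProduct

open Finset

variable {A B C D E F G : Type*} [AddCommGroup A] [AddCommGroup B] [AddCommGroup C]
  [AddCommGroup D] [AddCommGroup E] [AddCommGroup F] [AddCommGroup G]

/-- The Cauchy product of two sequences with respect to a biadditive map. -/
def cauchy (φ : A →+ B →+ C) (f : ℕ → A) (g : ℕ → B) : ℕ → C :=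
  fun k => ∑ p ∈ antidiagonal k, φ (f p.1) (g p.2)

theorem cauchy_add_left (φ : A →+ B →+ C) (f f' : ℕ → A) (g : ℕ → B) :
    cauchy φ (f + f') g = cauchy φ f g + cauchy φ f' g := by
  funext k
  simp [cauchy, sum_add_distrib]

theorem cauchy_add_right (φ : A →+ B →+ C) (f : ℕ → A) (g g' : ℕ → B) :
    cauchy φ f (g + g') = cauchy φ f g + cauchy φ f g' := by
  funext k
  simp [cauchy, sum_add_distrib]

/-- A series concentrated in degree i acts as a shift by i. The case i = 0 describes constants, and
i = 1 describes multiplication by the formal variable. -/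
theorem cauchy_single_left (φ : A →+ B →+ C) (i : ℕ) (a : A) (g : ℕ → B) (k : ℕ) :
    cauchy φ (Pi.single i a) g (i + k) = φ a (g k) := by
  rw [cauchy, sum_eq_single (i, k)]
  · simp
  · rintro ⟨x, y⟩ hxy hne
    have : x ≠ i := by
      rintro rfl
      simp only [HasAntidiagonal.mem_antidiagonal] at hxy
      exact hne (by rw [show y = k by omega])
    simp [Pi.single_eq_of_ne this]
  · simp

theorem cauchy_single_right (φ : A →+ B →+ C) (i : ℕ) (f : ℕ → A) (b : B) (k : ℕ) :
    cauchy φ f (Pi.single i b) (k + i) = φ (f k) b := by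
  rw [cauchy, sum_eq_single (k, i)]
  · simp
  · rintro ⟨x, y⟩ hxy hne
    have : y ≠ i := by
      rintro rfl
      simp only [HasAntidiagonal.mem_antidiagonal] at hxy
      exact hne (by rw [show x = k by omega])
    simp [Pi.single_eq_of_ne this]
  · simp

theorem cauchy_const_left (φ : A →+ B →+ C) (a : A) (g : ℕ → B) :
    cauchy φ (Pi.single 0 a) g = fun k => φ a (g k) := by
  funext k
  simpa using cauchy_single_left φ 0 a g k

theorem cauchy_const_right (φ : A →+ B →+ C) (f : ℕ → A) (b : B) :
    cauchy φ f (Pi.single 0 b) = fun k => φ (f k) b :=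
  funext fun k => cauchy_single_right φ 0 f b k

theorem cauchy_const_const (φ : A →+ B →+ C) (a : A) (b : B) :
    cauchy φ (Pi.single 0 a) (Pi.single 0 b) = Pi.single 0 (φ a b) := by
  rw [cauchy_const_left]
  funext k
  cases k <;> simp

theorem cauchy_assoc (φ : D →+ C →+ G) (ψ : A →+ B →+ D) (φ' : A →+ E →+ G) (ψ' : B →+ C →+ E)
    (h : ∀ a b c, φ (ψ a b) c = φ' a (ψ' b c)) (f : ℕ → A) (g : ℕ → B) (k : ℕ → C) :
    cauchy φ (cauchy ψ f g) k = cauchy φ' f (cauchy ψ' g k) := by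
  funext m
  simp only [cauchy, map_sum, AddMonoidHom.finsetSum_apply, h]
  rw [sum_sigma', sum_sigma']
  refine sum_nbij' (fun x => ⟨(x.2.1, x.2.2 + x.1.2), (x.2.2, x.1.2)⟩)
    (fun x => ⟨(x.1.1 + x.2.1, x.2.2), (x.1.1, x.2.1)⟩) ?_ ?_ ?_ ?_ ?_
  all_goals
    rintro ⟨⟨a, b⟩, ⟨c, d⟩⟩ hx
    simp only [mem_sigma, HasAntidiagonal.mem_antidiagonal] at hx
    obtain ⟨h1, h2⟩ := hx
    subst h2
    simp
  all_goals omega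

theorem cauchy_interchange {A' B' : Type*} [AddCommGroup A'] [AddCommGroup B']
    (α : C →+ D →+ G) (β : A →+ B →+ C) (γ : A' →+ B' →+ D)
    (α' : E →+ F →+ G) (β' : A →+ A' →+ E) (γ' : B →+ B' →+ F)
    (h : ∀ a b a' b', α (β a b) (γ a' b') = α' (β' a a') (γ' b b'))
    (f : ℕ → A) (g : ℕ → B) (f' : ℕ → A') (g' : ℕ → B') :
    cauchy α (cauchy β f g) (cauchy γ f' g') = cauchy α' (cauchy β' f f') (cauchy γ' g g') := by
  funext m
  simp only [cauchy, map_sum, AddMonoidHom.finsetSum_apply, h]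
  simp only [sum_sigma']
  -- Both sides distribute m over four factors, arranged in a 2×2 array of degrees. The map
  -- transposes this array along its antidiagonal, because the expansion lists the rows in reverse,
  -- and is therefore its own inverse.
  refine sum_nbij'
    (fun x => ⟨(x.2.2.1 + x.2.1.1, x.2.2.2 + x.2.1.2), ⟨(x.2.2.2, x.2.1.2), (x.2.2.1, x.2.1.1)⟩⟩)
    (fun x => ⟨(x.2.2.1 + x.2.1.1, x.2.2.2 + x.2.1.2), ⟨(x.2.2.2, x.2.1.2), (x.2.2.1, x.2.1.1)⟩⟩)
    ?_ ?_ ?_ ?_ ?_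
  all_goals
    rintro ⟨⟨a, b⟩, ⟨⟨c, d⟩, ⟨e, f⟩⟩⟩ hx
    simp only [mem_sigma, HasAntidiagonal.mem_antidiagonal] at hx
    obtain ⟨h1, h2, h3⟩ := hx
    substs h2 h3
    simp
  all_goals omega

end CauchyProduct

/-! ### Formal power series of morphisms -/

/-- Formal power series in a central variable, with coefficients morphisms `a ⟶ b`. -/
def HomSeries {n : ℕ} (a b : Word n) : Type := ℕ → Hom a b

namespace HomSeries

variable {n : ℕ}

instance instAddCommGroup (a b : Word n) : AddCommGroup (HomSeries a b) :=
  inferInstanceAs (AddCommGroup (ℕ → Hom a b))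

/-- The constant series. -/
def const {a b : Word n} (f : Hom a b) : HomSeries a b := Pi.single (M := fun _ => Hom a b) 0 f

/-- The identity of a word. -/
def id (a : Word n) : HomSeries a a := const (Hom.id a)

/-- Composition of series. -/
def comp {a b c : Word n} (f : HomSeries a b) (g : HomSeries b c) : HomSeries a c :=
  cauchy (Hom.compHom a b c) f g

/-- The monoidal product of series. -/
def tensor {a b c d s t : Word n} (f : HomSeries a b) (g : HomSeries c d) (hs : s = a ++ c)
    (ht : t = b ++ d) : HomSeries s t :=
  cauchy (Hom.tensorHom hs ht) f g

theorem add_apply {a b : Word n} (f g : HomSeries a b) (k : ℕ) : (f + g) k = f k + g k := rfl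

theorem neg_apply {a b : Word n} (f : HomSeries a b) (k : ℕ) : (-f) k = -f k := rfl

theorem const_zero {a b : Word n} : const (0 : Hom a b) = 0 :=
  Pi.single_zero (M := fun _ => Hom a b) 0

theorem const_add {a b : Word n} (f g : Hom a b) : const (f + g) = const f + const g :=
  Pi.single_add (f := fun _ => Hom a b) 0 f g

theorem const_neg {a b : Word n} (f : Hom a b) : const (-f) = -const f :=
  Pi.single_neg (f := fun _ => Hom a b) 0 f

theorem const_comp {a b c : Word n} (f : Hom a b) (g : Hom b c) :
    const (f.comp g) = (const f).comp (const g) :=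
  (cauchy_const_const (Hom.compHom a b c) f g).symm

theorem const_tensor {a b c d s t : Word n} (f : Hom a b) (g : Hom c d) (hs : s = a ++ c)
    (ht : t = b ++ d) : const (f.tensor g hs ht) = (const f).tensor (const g) hs ht :=
  (cauchy_const_const (Hom.tensorHom hs ht) f g).symm

theorem add_comp {a b c : Word n} (f f' : HomSeries a b) (g : HomSeries b c) :
    (f + f').comp g = f.comp g + f'.comp g := cauchy_add_left _ _ _ _

theorem comp_add {a b c : Word n} (f : HomSeries a b) (g g' : HomSeries b c) :
    f.comp (g + g') = f.comp g + f.comp g' := cauchy_add_right _ _ _ _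

theorem add_tensor {a b c d s t : Word n} (f f' : HomSeries a b) (g : HomSeries c d)
    (hs : s = a ++ c) (ht : t = b ++ d) :
    (f + f').tensor g hs ht = f.tensor g hs ht + f'.tensor g hs ht := cauchy_add_left _ _ _ _

theorem tensor_add {a b c d s t : Word n} (f : HomSeries a b) (g g' : HomSeries c d)
    (hs : s = a ++ c) (ht : t = b ++ d) :
    f.tensor (g + g') hs ht = f.tensor g hs ht + f.tensor g' hs ht := cauchy_add_right _ _ _ _

theorem id_comp {a b : Word n} (f : HomSeries a b) : (id a).comp f = f :=
  (cauchy_const_left _ _ _).trans (funext fun k => Hom.id_comp (f k))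

theorem comp_id {a b : Word n} (f : HomSeries a b) : f.comp (id b) = f :=
  (cauchy_const_right _ _ _).trans (funext fun k => Hom.comp_id (f k))

theorem comp_assoc {a b c d : Word n} (f : HomSeries a b) (g : HomSeries b c)
    (k : HomSeries c d) : (f.comp g).comp k = f.comp (g.comp k) :=
  cauchy_assoc _ _ _ _ Hom.comp_assoc f g k

theorem tensor_id {a c s : Word n} (hs : s = a ++ c) : (id a).tensor (id c) hs hs = id s := by
  rw [id, id, ← const_tensor, Hom.tensor_id]
  rfl

theorem interchange {a a' a'' c c' c'' s m t : Word n} (f : HomSeries a a')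
    (f' : HomSeries a' a'') (g : HomSeries c c') (g' : HomSeries c' c'') (hs : s = a ++ c)
    (hm : m = a' ++ c') (ht : t = a'' ++ c'') :
    (f.comp f').tensor (g.comp g') hs ht = (f.tensor g hs hm).comp (f'.tensor g' hm ht) :=
  cauchy_interchange _ _ _ _ _ _
    (fun a b a' b' => Hom.interchange a b a' b' hs hm ht) f f' g g'

theorem unit_tensor {a b : Word n} (f : HomSeries a b) (hs : a = [] ++ a) (ht : b = [] ++ b) :
    (id []).tensor f hs ht = f :=
  (cauchy_const_left _ _ _).trans (funext fun k => Hom.unit_tensor (f k) hs ht)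

theorem tensor_unit {a b : Word n} (f : HomSeries a b) (hs : a = a ++ []) (ht : b = b ++ []) :
    f.tensor (id []) hs ht = f :=
  (cauchy_const_right _ _ _).trans (funext fun k => Hom.tensor_unit (f k) hs ht)

theorem tensor_assoc {a a' b b' c c' ab ab' bc bc' s t : Word n} (f : HomSeries a a')
    (g : HomSeries b b') (k : HomSeries c c') (h1 : ab = a ++ b) (h2 : ab' = a' ++ b')
    (h3 : s = ab ++ c) (h4 : t = ab' ++ c')
    (h5 : bc = b ++ c) (h6 : bc' = b' ++ c') (h7 : s = a ++ bc) (h8 : t = a' ++ bc') :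
    (f.tensor g h1 h2).tensor k h3 h4 = f.tensor (g.tensor k h5 h6) h7 h8 :=
  cauchy_assoc _ _ _ _ (fun a b c => Hom.tensor_assoc a b c h1 h2 h3 h4 h5 h6 h7 h8) f g k

theorem zero_tensor {a b c d s t : Word n} (g : HomSeries c d)
    (hs : s = a ++ c) (ht : t = b ++ d) : (0 : HomSeries a b).tensor g hs ht = 0 := by
  have := add_tensor (0 : HomSeries a b) 0 g hs ht
  simpa using this

theorem neg_tensor {a b c d s t : Word n} (f : HomSeries a b) (g : HomSeries c d)
    (hs : s = a ++ c) (ht : t = b ++ d) : (-f).tensor g hs ht = -f.tensor g hs ht := by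
  rw [eq_neg_iff_add_eq_zero, ← add_tensor, neg_add_cancel, zero_tensor]

theorem tensor_zero {a b c d s t : Word n} (f : HomSeries a b)
    (hs : s = a ++ c) (ht : t = b ++ d) : f.tensor (0 : HomSeries c d) hs ht = 0 := by
  have := tensor_add f (0 : HomSeries c d) 0 hs ht
  simpa using this

end HomSeries

open CategoryTheory

/-- The category with objects the words and morphisms the power series of morphisms. -/
def SeriesCat (n : ℕ) : Type := Word n

namespace SeriesCat

variable {n : ℕ}

instance : Category (SeriesCat n) where
  Hom a b := HomSeries (n := n) a b
  id a := HomSeries.id a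
  comp f g := HomSeries.comp f g
  id_comp := HomSeries.id_comp
  comp_id := HomSeries.comp_id
  assoc := HomSeries.comp_assoc

instance : Preadditive (SeriesCat n) where
  homGroup a b := HomSeries.instAddCommGroup (n := n) a b
  add_comp _ _ _ f f' g := HomSeries.add_comp f f' g
  comp_add _ _ _ f g g' := HomSeries.comp_add f g g'

end SeriesCat

/-- The ring of power series of endomorphisms of the monoidal unit. -/
def PolySeries (n : ℕ) : Type := HomSeries (n := n) [] []

namespace PolySeries

variable {n : ℕ}

/-- The Eckmann–Hilton argument: together with `tensor_eq_comp'` it shows that endomorphisms of the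
unit commute, so that they can serve as a commutative ring of scalars. -/
theorem tensor_eq_comp (p q : HomSeries (n := n) [] []) : p.tensor q rfl rfl = p.comp q := by
  have h := HomSeries.interchange p (HomSeries.id []) (HomSeries.id []) q (s := []) (m := [])
    (t := []) rfl rfl rfl
  rwa [HomSeries.comp_id, HomSeries.id_comp, HomSeries.tensor_unit, HomSeries.unit_tensor] at h

theorem tensor_eq_comp' (p q : HomSeries (n := n) [] []) : p.tensor q rfl rfl = q.comp p := by
  have h := HomSeries.interchange (HomSeries.id []) p q (HomSeries.id []) (s := []) (m := [])
    (t := []) rfl rfl rfl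
  rwa [HomSeries.comp_id, HomSeries.id_comp, HomSeries.tensor_unit, HomSeries.unit_tensor] at h

instance : AddCommGroup (PolySeries n) := HomSeries.instAddCommGroup (n := n) [] []

instance : CommRing (PolySeries n) where
  mul p q := HomSeries.tensor p q rfl rfl
  one := HomSeries.id []
  mul_assoc p q r := HomSeries.tensor_assoc p q r rfl rfl rfl rfl rfl rfl rfl rfl
  one_mul p := HomSeries.unit_tensor p rfl rfl
  mul_one p := HomSeries.tensor_unit p rfl rfl
  left_distrib p q r := HomSeries.tensor_add p q r rfl rfl
  right_distrib p q r := HomSeries.add_tensor p q r rfl rfl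
  zero_mul p := HomSeries.zero_tensor p rfl rfl
  mul_zero p := HomSeries.tensor_zero p rfl rfl
  mul_comm p q := (tensor_eq_comp p q).trans (tensor_eq_comp' q p).symm
  zsmul := fun k p => k • p
  neg_add_cancel := neg_add_cancel

/-- A scalar is placed in the region to the left of the whole diagram. Polynomials in any other
region are scalars transported by strand functors. -/
instance (a b : Word n) : Module (PolySeries n) (HomSeries a b) where
  smul p f := HomSeries.tensor p f rfl rfl
  one_smul f := HomSeries.unit_tensor f rfl rfl
  mul_smul p q f := HomSeries.tensor_assoc p q f rfl rfl rfl rfl rfl rfl rfl rfl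
  smul_zero p := HomSeries.tensor_zero p rfl rfl
  smul_add p f g := HomSeries.tensor_add p f g rfl rfl
  add_smul p q f := HomSeries.add_tensor p q f rfl rfl
  zero_smul f := HomSeries.zero_tensor f rfl rfl

theorem smul_def {a b : Word n} (p : PolySeries n) (f : HomSeries a b) :
    p • f = HomSeries.tensor p f rfl rfl := rfl

theorem smul_comp' {a b c : Word n} (p : PolySeries n) (f : HomSeries a b) (g : HomSeries b c) :
    (p • f).comp g = p • f.comp g := by
  have h := HomSeries.interchange p (HomSeries.id []) f g (s := a) (m := b) (t := c) rfl rfl rfl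
  erw [HomSeries.comp_id, HomSeries.unit_tensor] at h
  exact h.symm

theorem comp_smul' {a b c : Word n} (p : PolySeries n) (f : HomSeries a b) (g : HomSeries b c) :
    f.comp (p • g) = p • f.comp g := by
  have h := HomSeries.interchange (HomSeries.id []) p f g (s := a) (m := b) (t := c) rfl rfl rfl
  erw [HomSeries.id_comp, HomSeries.unit_tensor] at h
  exact h.symm

end PolySeries

namespace SeriesCat

variable {n : ℕ}

instance : Linear (PolySeries n) (SeriesCat n) where
  homModule a b := PolySeries.instModuleHomSeries (n := n) a b
  smul_comp _ _ _ p f g := PolySeries.smul_comp' p f g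
  comp_smul _ _ _ f p g := PolySeries.comp_smul' p f g

/-- Adding a strand of color `i` on the left. -/
def strand (i : Color n) : SeriesCat n ⥤ SeriesCat n where
  obj a := List.cons i a
  map {a b} f := (HomSeries.id [i]).tensor (a := [i]) (b := [i]) (c := a) (d := b) f rfl rfl
  map_id a := HomSeries.tensor_id (a := [i]) (c := a) rfl
  map_comp {a b c} f g := by
    have h := HomSeries.interchange (HomSeries.id [i]) (HomSeries.id [i]) f g (s := i :: a)
      (m := i :: b) (t := i :: c) rfl rfl rfl
    rwa [HomSeries.id_comp] at h

/-- Additivity is the most that can be asked: a scalar on the right of the new strand differs from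
one on its left by the forcing relations. -/
instance (i : Color n) : (strand i).Additive where
  map_add {_ _ f g} := HomSeries.tensor_add (HomSeries.id [i]) f g rfl rfl

end SeriesCat

end HeckeDiag


namespace HeckeDiag

open CategoryTheory

/-! ### Actions of the generating diagrams on a linear category -/

section DiagAction

variable {n : ℕ} {R : Type*} [CommRing R] {C : Type*} [Category C] [Preadditive C] [Linear R C]
  {F : Color n → C ⥤ C}

local notation:91 i:92 " ◃ " X:91 => CategoryTheory.Functor.obj (F i) X
local notation:91 i:92 " ◂ " f:91 => CategoryTheory.Functor.map (F i) f

variable (R F) in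
/-- An assignment of a scalar to every variable and of a natural transformation to every
generating diagram, where the color `i` acts by the endofunctor `F i`. -/
structure DiagAction where
  x : Fin n → R
  en (i : Color n) (X : C) : i ◃ X ⟶ X
  st (i : Color n) (X : C) : X ⟶ i ◃ X
  me (i : Color n) (X : C) : i ◃ i ◃ X ⟶ i ◃ X
  sp (i : Color n) (X : C) : i ◃ X ⟶ i ◃ i ◃ X
  cr (i j : Color n) (h : Distant i j) (X : C) : i ◃ j ◃ X ⟶ j ◃ i ◃ X
  si (i j : Color n) (h : Adjacent i j) (X : C) : i ◃ j ◃ i ◃ X ⟶ j ◃ i ◃ j ◃ X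
  en_nat (i : Color n) {X Y : C} (f : X ⟶ Y) : i ◂ f ≫ en i Y = en i X ≫ f
  st_nat (i : Color n) {X Y : C} (f : X ⟶ Y) : f ≫ st i Y = st i X ≫ i ◂ f
  me_nat (i : Color n) {X Y : C} (f : X ⟶ Y) : i ◂ i ◂ f ≫ me i Y = me i X ≫ i ◂ f
  sp_nat (i : Color n) {X Y : C} (f : X ⟶ Y) : i ◂ f ≫ sp i Y = sp i X ≫ i ◂ i ◂ f
  cr_nat (i j : Color n) (h : Distant i j) {X Y : C} (f : X ⟶ Y) :
    i ◂ j ◂ f ≫ cr i j h Y = cr i j h X ≫ j ◂ i ◂ f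
  si_nat (i j : Color n) (h : Adjacent i j) {X Y : C} (f : X ⟶ Y) :
    i ◂ j ◂ i ◂ f ≫ si i j h Y = si i j h X ≫ j ◂ i ◂ j ◂ f

namespace DiagAction

variable (D : DiagAction R F)

/-- The natural transformation attached to the cap. -/
def cap (i : Color n) (X : C) : i ◃ i ◃ X ⟶ X := D.me i X ≫ D.en i X

/-- The natural transformation attached to the cup. -/
def cup (i : Color n) (X : C) : X ⟶ i ◃ i ◃ X := D.st i X ≫ D.sp i X

/-- The natural transformation attached to the broken strand. -/
def br (i : Color n) (X : C) : i ◃ X ⟶ i ◃ X := D.en i X ≫ D.st i X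

theorem cap_nat (i : Color n) {X Y : C} (f : X ⟶ Y) : i ◂ i ◂ f ≫ D.cap i Y = D.cap i X ≫ f := by
  rw [cap, cap, reassoc_of% (D.me_nat i f), D.en_nat, Category.assoc]

theorem cup_nat (i : Color n) {X Y : C} (f : X ⟶ Y) : f ≫ D.cup i Y = D.cup i X ≫ i ◂ i ◂ f := by
  rw [cup, cup, reassoc_of% (D.st_nat i f), D.sp_nat, Category.assoc]

/-- The local relations other than the Zamolodchikov relation hold for the action. -/
structure IsModel : Prop where
  merge_assoc (i : Color n) (X : C) : D.me i (i ◃ X) ≫ D.me i X = i ◂ D.me i X ≫ D.me i X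
  split_coassoc (i : Color n) (X : C) : D.sp i X ≫ D.sp i (i ◃ X) = D.sp i X ≫ i ◂ D.sp i X
  frobenius_left (i : Color n) (X : C) : i ◂ D.sp i X ≫ D.me i (i ◃ X) = D.me i X ≫ D.sp i X
  frobenius_right (i : Color n) (X : C) : D.sp i (i ◃ X) ≫ i ◂ D.me i X = D.me i X ≫ D.sp i X
  unit_left (i : Color n) (X : C) : D.st i (i ◃ X) ≫ D.me i X = 𝟙 _
  unit_right (i : Color n) (X : C) : i ◂ D.st i X ≫ D.me i X = 𝟙 _
  counit_left (i : Color n) (X : C) : D.sp i X ≫ D.en i (i ◃ X) = 𝟙 _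
  counit_right (i : Color n) (X : C) : D.sp i X ≫ i ◂ D.en i X = 𝟙 _
  needle (i : Color n) (X : C) : D.sp i X ≫ D.me i X = 0
  barbell (i : Color n) (X : C) : D.st i X ≫ D.en i X = (D.x (lo i) - D.x (hi i)) • 𝟙 X
  force_lo (i : Color n) (X : C) : i ◂ (D.x (lo i) • 𝟙 X) = D.x (hi i) • 𝟙 _ + D.br i X
  force_hi (i : Color n) (X : C) : i ◂ (D.x (hi i) • 𝟙 X) = D.x (lo i) • 𝟙 _ - D.br i X
  force_other (i : Color n) (j : Fin n) (X : C) (hlo : j ≠ lo i) (hhi : j ≠ hi i) :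
    i ◂ (D.x j • 𝟙 X) = D.x j • 𝟙 _
  cross_rotate (i j : Color n) (h : Distant i j) (X : C) :
    D.cup i (j ◃ i ◃ X) ≫ i ◂ D.cr i j h (i ◃ X) ≫ i ◂ j ◂ D.cap i X = D.cr j i h.symm X
  cross_cross (i j : Color n) (h : Distant i j) (X : C) : D.cr i j h X ≫ D.cr j i h.symm X = 𝟙 _
  cross_dot (i j : Color n) (h : Distant i j) (X : C) :
    D.cr i j h X ≫ j ◂ D.en i X = D.en i (j ◃ X)
  cross_merge (i j : Color n) (h : Distant i j) (X : C) :
    i ◂ D.cr i j h X ≫ D.cr i j h (i ◃ X) ≫ j ◂ D.me i X = D.me i (j ◃ X) ≫ D.cr i j h X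
  six_rotate (i j : Color n) (h : Adjacent i j) (X : C) :
    D.cup i (j ◃ i ◃ j ◃ X) ≫ i ◂ D.si i j h (j ◃ X) ≫ i ◂ j ◂ i ◂ D.cap j X = D.si j i h.symm X
  six_dot (i j : Color n) (h : Adjacent i j) (X : C) :
    D.si i j h X ≫ j ◂ i ◂ D.en j X
      = D.en i (j ◃ i ◃ X) + i ◂ D.en j (i ◃ X) ≫ D.me i X ≫ D.st j (i ◃ X)
  six_six (i j : Color n) (h : Adjacent i j) (X : C) :
    D.si i j h X ≫ D.si j i h.symm X
      = 𝟙 _ + i ◂ D.en j (i ◃ X) ≫ D.me i X ≫ D.sp i X ≫ i ◂ D.st j (i ◃ X)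
  six_merge (i j : Color n) (h : Adjacent i j) (X : C) :
    D.me i (j ◃ i ◃ X) ≫ D.si i j h X
      = i ◂ D.si i j h X ≫ D.si i j h (j ◃ X) ≫ j ◂ i ◂ D.me j X
  three_distant (i j k : Color n) (hij : Distant i j) (hik : Distant i k) (hjk : Distant j k)
    (X : C) :
    D.cr i j hij (k ◃ X) ≫ j ◂ D.cr i k hik X ≫ D.cr j k hjk (i ◃ X)
      = i ◂ D.cr j k hjk X ≫ D.cr i k hik (j ◃ X) ≫ k ◂ D.cr i j hij X
  six_distant (i j k : Color n) (hij : Adjacent i j) (hik : Distant i k) (hjk : Distant j k)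
    (X : C) :
    i ◂ j ◂ D.cr i k hik X ≫ i ◂ D.cr j k hjk (i ◃ X) ≫ D.cr i k hik (j ◃ i ◃ X)
        ≫ k ◂ D.si i j hij X
      = D.si i j hij (k ◃ X) ≫ j ◂ i ◂ D.cr j k hjk X ≫ j ◂ D.cr i k hik (j ◃ X)
        ≫ D.cr j k hjk (i ◃ j ◃ X)

/-- The Zamolodchikov relation holds for the action. -/
def Zamolodchikov : Prop :=
  ∀ (i j k : Color n) (hij : Adjacent i j) (hjk : Adjacent j k) (hik : Distant i k),
    i.val + 1 = j.val → j.val + 1 = k.val → ∀ X : C,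
    D.si i j hij (k ◃ j ◃ i ◃ X) ≫ j ◂ i ◂ D.si j k hjk (i ◃ X)
        ≫ j ◂ i ◂ k ◂ j ◂ D.cr k i hik.symm X ≫ j ◂ D.cr i k hik (j ◃ i ◃ k ◃ X)
        ≫ j ◂ k ◂ D.si i j hij (k ◃ X) ≫ D.si j k hjk (i ◃ j ◃ k ◃ X)
      = i ◂ j ◂ D.cr i k hik (j ◃ i ◃ X) ≫ i ◂ j ◂ k ◂ D.si i j hij X
        ≫ i ◂ D.si j k hjk (i ◃ j ◃ X) ≫ D.cr i k hik (j ◃ k ◃ i ◃ j ◃ X)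
        ≫ k ◂ i ◂ j ◂ D.cr k i hik.symm (j ◃ X) ≫ k ◂ D.si i j hij (k ◃ j ◃ X)
        ≫ k ◂ j ◂ i ◂ D.si j k hjk X ≫ k ◂ j ◂ D.cr i k hik (j ◃ k ◃ X)

variable (F) in
/-- The scalar `p` passes through the strand `i`. -/
def Slides (i : Color n) (p : R) : Prop :=
  ∀ X : C, i ◂ (p • 𝟙 X) = p • 𝟙 (i ◃ X)

section Slides

variable {i : Color n} {p q : R}

theorem Slides.map_smul (h : Slides F i p) {X Y : C} (f : X ⟶ Y) : i ◂ (p • f) = p • i ◂ f := by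
  have h2 := congrArg (· ≫ i ◂ f) (h X)
  simpa [← Functor.map_comp] using h2

theorem Slides.one : Slides F i (1 : R) := fun X => by simp

theorem Slides.mul (hp : Slides F i p) (hq : Slides F i q) : Slides F i (p * q) := fun X => by
  rw [mul_smul, hp.map_smul, hq, mul_smul]

variable [∀ i, (F i).Additive]

theorem Slides.add (hp : Slides F i p) (hq : Slides F i q) : Slides F i (p + q) := fun X => by
  rw [add_smul, Functor.map_add, hp, hq, add_smul]

theorem Slides.neg (hp : Slides F i p) : Slides F i (-p) := fun X => by
  rw [neg_smul, Functor.map_neg, hp, neg_smul]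

theorem Slides.sub (hp : Slides F i p) (hq : Slides F i q) : Slides F i (p - q) := by
  rw [sub_eq_add_neg]
  exact hp.add hq.neg

/-- Applying the functor to p q = 1, pulling p out and multiplying by q leaves the statement for q.
This is how the series u, known only as inverses, are moved. -/
theorem Slides.inv (hp : Slides F i p) (h : p * q = 1) : Slides F i q := fun X => by
  have h1 : q • i ◂ (p • q • 𝟙 X) = q • 𝟙 (i ◃ X) := by
    rw [smul_smul, h, one_smul, CategoryTheory.Functor.map_id]
  rwa [hp.map_smul, smul_smul, mul_comm, h, one_smul] at h1

end Slides

namespace IsModel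

variable [∀ i, (F i).Additive] {D} (hD : D.IsModel)
include hD

theorem slides_other (i : Color n) (j : Fin n) (hlo : j ≠ lo i) (hhi : j ≠ hi i) :
    Slides F i (D.x j) := fun X => hD.force_other i j X hlo hhi

/-- Symmetric functions of the two variables of a color slide through its strand. For the sum, the
two broken strands produced by forcing cancel; for the product, see `slides_mul`. -/
theorem slides_add (i : Color n) : Slides F i (D.x (lo i) + D.x (hi i)) := fun X => by
  rw [add_smul, Functor.map_add, hD.force_lo, hD.force_hi]
  module

theorem br_br (i : Color n) (X : C) :
    D.br i X ≫ D.br i X = (D.x (lo i) - D.x (hi i)) • D.br i X := by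
  simp only [br, Category.assoc, reassoc_of% (hD.barbell i X), Linear.smul_comp,
    Linear.comp_smul, Category.id_comp]

/-- With b the broken strand, forcing gives (x_hi + b)(x_lo - b), and the barbell relation b² =
(x_lo - x_hi) b removes every term except x_hi x_lo. -/
theorem slides_mul (i : Color n) : Slides F i (D.x (lo i) * D.x (hi i)) := fun X => by
  have h : i ◂ ((D.x (lo i) * D.x (hi i)) • 𝟙 X)
      = i ◂ (D.x (lo i) • 𝟙 X) ≫ i ◂ (D.x (hi i) • 𝟙 X) := by
    rw [← Functor.map_comp]
    simp [smul_smul, mul_comm]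
  have h2 := hD.br_br i X
  rw [h, hD.force_lo, hD.force_hi]
  simp only [Preadditive.add_comp, Preadditive.comp_sub, Linear.smul_comp, Linear.comp_smul,
    Category.id_comp, Category.comp_id, h2]
  module

/-- The zigzag identities follow from the Frobenius relation together with unit and counit. They
make every color self-dual and justify all rotations below. -/
theorem cap_snake_left (i : Color n) (X : C) : i ◂ D.cup i X ≫ D.cap i (i ◃ X) = 𝟙 _ := by
  simp only [cap, cup, Functor.map_comp, Category.assoc, reassoc_of% (hD.frobenius_left i X),
    reassoc_of% (hD.unit_right i X), hD.counit_left]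

theorem cap_snake_right (i : Color n) (X : C) : D.cup i (i ◃ X) ≫ i ◂ D.cap i X = 𝟙 _ := by
  simp only [cap, cup, Functor.map_comp, Category.assoc, reassoc_of% (hD.frobenius_right i X),
    reassoc_of% (hD.unit_left i X), hD.counit_right]

theorem st_cap_right (i : Color n) (X : C) : i ◂ D.st i X ≫ D.cap i X = D.en i X := by
  rw [cap, reassoc_of% (hD.unit_right i X)]

theorem cup_en_right (i : Color n) (X : C) : D.cup i X ≫ i ◂ D.en i X = D.st i X := by
  rw [cup, Category.assoc, hD.counit_right, Category.comp_id]

theorem cup_me_left (i : Color n) (X : C) :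
    D.cup i (i ◃ X) ≫ i ◂ D.me i X = D.sp i X := by
  simp only [cup, Category.assoc, hD.frobenius_right, reassoc_of% (hD.unit_left i X)]

theorem cup_me_right (i : Color n) (X : C) :
    i ◂ D.cup i X ≫ D.me i (i ◃ X) = D.sp i X := by
  simp only [cup, Functor.map_comp, Category.assoc, hD.frobenius_left,
    reassoc_of% (hD.unit_right i X)]

theorem cup_me (i : Color n) (X : C) : D.cup i X ≫ D.me i X = 0 := by
  rw [cup, Category.assoc, hD.needle, Limits.comp_zero]

/-! The 6-valent vertex and dots. -/

/-- A dot at the bottom right of the 6-valent vertex. -/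
theorem st_six_right (i j : Color n) (h : Adjacent i j) (X : C) :
    i ◂ j ◂ D.st i X ≫ D.si i j h X
      = D.st j (i ◃ j ◃ X) + D.en i (j ◃ X) ≫ D.sp j X ≫ j ◂ D.st i (j ◃ X) := by
  have h1 : j ◂ (D.me j X ≫ D.st i (j ◃ X))
      = j ◂ D.me j X ≫ j ◂ D.st i (j ◃ X) := Functor.map_comp ..
  -- With the vertex written as a rotation of `six j i`, the dot travels along the cap and becomes a
  -- dot at the top right, where `six_dot` applies.
  rw [← hD.six_rotate j i h.symm, reassoc_of% (D.cup_nat j (i ◂ j ◂ D.st i X)),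
    ← Functor.map_comp_assoc, D.si_nat, ← Functor.map_comp, Category.assoc, ← Functor.map_comp,
    ← Functor.map_comp, hD.st_cap_right, hD.six_dot, Functor.map_add, Preadditive.comp_add,
    hD.cup_en_right, Functor.map_comp, ← reassoc_of% (D.cup_nat j (D.en i (j ◃ X))), h1,
    reassoc_of% (hD.cup_me_left j X)]

/-- The other one-click rotation of the 6-valent vertex. -/
theorem six_rotate' (i j : Color n) (h : Adjacent i j) (X : C) :
    i ◂ j ◂ i ◂ D.cup j X ≫ i ◂ D.si j i h.symm (j ◃ X) ≫ D.cap i (j ◃ i ◃ j ◃ X)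
      = D.si i j h X := by
  -- The inner vertex is replaced by the opposite rotation of `six i j`. What is left of the cups
  -- and caps is one zigzag of color i and one of color j.
  rw [← hD.six_rotate i j h]
  simp only [Functor.map_comp, Category.assoc]
  rw [D.cap_nat, reassoc_of% (D.cap_nat i (D.si i j h (j ◃ j ◃ X)))]
  rw [reassoc_of% (show i ◂ j ◂ i ◂ D.cup j X ≫ i ◂ D.cup i (j ◃ i ◃ j ◃ j ◃ X)
    = i ◂ D.cup i (j ◃ i ◃ X) ≫ i ◂ i ◂ i ◂ j ◂ i ◂ D.cup j X by
      rw [← Functor.map_comp, D.cup_nat, Functor.map_comp])]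
  rw [reassoc_of% (D.cap_nat i (i ◂ j ◂ i ◂ D.cup j X)),
    reassoc_of% (hD.cap_snake_left i (j ◃ i ◃ X)), reassoc_of% (D.si_nat i j h (D.cup j X)),
    ← Functor.map_comp, ← Functor.map_comp, hD.cap_snake_left]
  simp

/-- A dot at the top middle of the 6-valent vertex. -/
theorem six_en_middle (i j : Color n) (h : Adjacent i j) (X : C) :
    D.si i j h X ≫ j ◂ D.en i (j ◃ X)
      = i ◂ D.en j (i ◃ X) ≫ D.cap i X ≫ D.cup j X
        + D.en i (j ◃ i ◃ X) ≫ j ◂ D.en i X ≫ D.sp j X := by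
  have h1 : i ◂ D.si j i h.symm (j ◃ X) ≫ i ◂ i ◂ j ◂ D.en i (j ◃ X)
      = i ◂ D.en j (i ◃ j ◃ j ◃ X)
        + i ◂ (j ◂ D.en i (j ◃ j ◃ X) ≫ D.me j (j ◃ X)) ≫ i ◂ D.st i (j ◃ j ◃ X) := by
    rw [← Functor.map_comp, hD.six_dot, Functor.map_add, ← Functor.map_comp, Category.assoc]
  have h2 : i ◂ j ◂ i ◂ D.cup j X ≫ i ◂ D.en j (i ◃ j ◃ j ◃ X)
      = i ◂ D.en j (i ◃ X) ≫ i ◂ i ◂ D.cup j X := by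
    rw [← Functor.map_comp, D.en_nat, Functor.map_comp]
  have h3 : i ◂ j ◂ i ◂ D.cup j X ≫ i ◂ (j ◂ D.en i (j ◃ j ◃ X) ≫ D.me j (j ◃ X))
      = i ◂ (j ◂ D.en i X ≫ D.sp j X) := by
    rw [← Functor.map_comp, ← Functor.map_comp_assoc, D.en_nat, Functor.map_comp (F j), Category.assoc,
      hD.cup_me_right]
  -- The middle top strand of `six i j` is the rightmost top strand of the rotated `six j i`, so
  -- `six_dot` applies again.
  rw [← hD.six_rotate' i j h]
  simp only [Category.assoc]
  rw [← D.cap_nat i (j ◂ D.en i (j ◃ X)), reassoc_of% h1, Preadditive.add_comp,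
    Preadditive.comp_add, reassoc_of% h2, D.cap_nat, Category.assoc, reassoc_of% h3,
    hD.st_cap_right, D.en_nat]

/-- After the middle dot is resolved, one term ends in a cup followed by a merge and the other in a
split followed by a merge, and both contain a needle. -/
theorem six_merge_middle (i j : Color n) (h : Adjacent i j) (X : C) :
    D.si i j h X ≫ j ◂ D.en i (j ◃ X) ≫ D.me j X = 0 := by
  rw [← Category.assoc, hD.six_en_middle, Preadditive.add_comp]
  simp only [Category.assoc, hD.cup_me, hD.needle, Limits.comp_zero, add_zero]

end IsModel

end DiagAction

end DiagAction

end HeckeDiag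


/-! ### The exponential deformation: definition, one color, distant colors. -/

namespace HeckeDiag

open CategoryTheory

section DiagAction

variable {n : ℕ} {R : Type*} [CommRing R] {C : Type*} [Category C] [Preadditive C] [Linear R C]
  {F : Color n → C ⥤ C}

local notation:91 i:92 " ◃ " X:91 => CategoryTheory.Functor.obj (F i) X
local notation:91 i:92 " ◂ " f:91 => CategoryTheory.Functor.map (F i) f

namespace DiagAction

variable (D : DiagAction R F)

theorem map_smul_id_comp (i : Color n) (p : R) {X Y : C} (f : X ⟶ Y) :
    i ◂ (p • 𝟙 X) ≫ i ◂ f = i ◂ (p • f) := by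
  rw [← Functor.map_comp, Linear.smul_comp, Category.id_comp]

theorem comp_map_smul_id (i : Color n) (p : R) {X Y : C} (f : X ⟶ Y) :
    i ◂ f ≫ i ◂ (p • 𝟙 Y) = i ◂ (p • f) := by
  rw [← Functor.map_comp, Linear.comp_smul, Category.comp_id]

/-- The deformation of an action along the exponential of the raising operator. -/
def deform (t : R) (u : Fin n → R) : DiagAction R F where
  x j := D.x j * u j
  en i X := u (lo i) • D.en i X
  st i X := u (hi i) • D.st i X
  -- If d f = -x f and d x = x², then d² f = 0, so the exponential is the polynomial 1 - t x. If
  -- instead d f = x f, as for the dots, the exponential is the full series u.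
  me i X := i ◂ ((1 - t * D.x (hi i)) • 𝟙 _) ≫ D.me i X
  sp i X := D.sp i X ≫ i ◂ ((1 - t * D.x (lo i)) • 𝟙 _)
  cr i j h X := D.cr i j h X
  si i j h X :=
    -- For source (i, i+1, i) the derivative is the sum of x_i and x_{i+2} on the left, minus
    -- x_{i+1} in the region before the last strand at the bottom and at the top (`six_variation`).
    -- The formula is the exponential of these four contributions.
    if i.val + 1 = j.val then
      (u (lo i) * u (hi j)) • (i ◂ j ◂ ((1 - t * D.x (hi i)) • 𝟙 _) ≫ D.si i j h X
        ≫ j ◂ i ◂ ((1 - t * D.x (hi i)) • 𝟙 _))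
    else D.si i j h X
  en_nat i X Y f := by simp [D.en_nat]
  st_nat i X Y f := by simp [D.st_nat]
  me_nat i X Y f := by
    rw [← Functor.map_comp_assoc, Linear.comp_smul, Category.comp_id, Category.assoc, ← D.me_nat,
      ← Functor.map_comp_assoc, Linear.smul_comp, Category.id_comp]
  sp_nat i X Y f := by
    rw [Category.assoc, ← Functor.map_comp, Linear.smul_comp, Category.id_comp,
      ← Category.assoc, D.sp_nat, Category.assoc, ← Functor.map_comp, Linear.comp_smul,
      Category.comp_id]
  cr_nat i j h X Y f := D.cr_nat i j h f
  si_nat i j h X Y f := by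
    split_ifs
    · have e1 : i ◂ j ◂ i ◂ f ≫ i ◂ j ◂ ((1 - t * D.x (hi i)) • 𝟙 _)
          = i ◂ j ◂ ((1 - t * D.x (hi i)) • 𝟙 _) ≫ i ◂ j ◂ i ◂ f := by
        simp only [← Functor.map_comp, Linear.smul_comp, Linear.comp_smul, Category.id_comp,
          Category.comp_id]
      have e2 : j ◂ i ◂ j ◂ f ≫ j ◂ i ◂ ((1 - t * D.x (hi i)) • 𝟙 _)
          = j ◂ i ◂ ((1 - t * D.x (hi i)) • 𝟙 _) ≫ j ◂ i ◂ j ◂ f := by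
        simp only [← Functor.map_comp, Linear.smul_comp, Linear.comp_smul, Category.id_comp,
          Category.comp_id]
      simp only [Linear.smul_comp, Linear.comp_smul, Category.assoc]
      rw [reassoc_of% e1, reassoc_of% (D.si_nat i j h f), e2]
    · exact D.si_nat i j h f

/-- The deformation parameters are admissible: `u j` is the inverse of `1 - t x_j`, and `t`
passes through all strands. -/
structure IsAdmissible (t : R) (u : Fin n → R) : Prop where
  inv (j : Fin n) : (1 - t * D.x j) * u j = 1
  slides (i : Color n) : Slides F i t

namespace IsModel

variable [∀ i, (F i).Additive] {D} (hD : D.IsModel) {t : R} {u : Fin n → R}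
  (ht : D.IsAdmissible t u)

section
include hD ht

theorem slides_v (i : Color n) (j : Fin n) (hlo : j ≠ lo i) (hhi : j ≠ hi i) :
    Slides F i (1 - t * D.x j) :=
  Slides.one.sub ((ht.slides i).mul (hD.slides_other i j hlo hhi))

theorem slides_u (i : Color n) (j : Fin n) (hlo : j ≠ lo i) (hhi : j ≠ hi i) :
    Slides F i (u j) :=
  (hD.slides_v ht i j hlo hhi).inv (ht.inv j)

/-- Expanding gives 1 - t (x_lo + x_hi) + t² x_lo x_hi, which is symmetric in the two variables. -/
theorem slides_vv (i : Color n) :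
    Slides F i ((1 - t * D.x (lo i)) * (1 - t * D.x (hi i))) := by
  have h := (Slides.one.sub ((ht.slides i).mul (hD.slides_add i))).add
    (((ht.slides i).mul (ht.slides i)).mul (hD.slides_mul i))
  convert h using 1
  ring

theorem slides_uu (i : Color n) : Slides F i (u (lo i) * u (hi i)) :=
  (hD.slides_vv ht i).inv (by
    linear_combination (1 - t * D.x (hi i)) * u (hi i) * ht.inv (lo i) + ht.inv (hi i))

theorem force_v_lo (i : Color n) (X : C) :
    i ◂ ((1 - t * D.x (lo i)) • 𝟙 X) = (1 - t * D.x (hi i)) • 𝟙 _ - t • D.br i X := by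
  rw [sub_smul, Functor.map_sub, mul_smul, (ht.slides i).map_smul, hD.force_lo, one_smul,
    CategoryTheory.Functor.map_id]
  module

theorem force_v_hi (i : Color n) (X : C) :
    i ◂ ((1 - t * D.x (hi i)) • 𝟙 X) = (1 - t * D.x (lo i)) • 𝟙 _ + t • D.br i X := by
  rw [sub_smul, Functor.map_sub, mul_smul, (ht.slides i).map_smul, hD.force_hi, one_smul,
    CategoryTheory.Functor.map_id]
  module

theorem force_u_lo (i : Color n) (X : C) :
    i ◂ (u (lo i) • 𝟙 X) = u (hi i) • 𝟙 _ + (t * u (lo i) * u (hi i)) • D.br i X := by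
  -- The symmetric factor slides through the strand, so that forcing is only needed for the
  -- polynomial 1 - t x_hi.
  have h : u (lo i) = (u (lo i) * u (hi i)) * (1 - t * D.x (hi i)) := by
    linear_combination -u (lo i) * ht.inv (hi i)
  rw [h, mul_smul, (hD.slides_uu ht i).map_smul, hD.force_v_hi ht, smul_add, smul_smul, smul_smul,
    ← h]
  congr 2
  · linear_combination u (hi i) * ht.inv (lo i)
  · ring

/-! One color. -/

theorem deform_merge_assoc (i : Color n) (X : C) :
    (D.deform t u).me i (i ◃ X) ≫ (D.deform t u).me i X
      = i ◂ (D.deform t u).me i X ≫ (D.deform t u).me i X := by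
  simp only [deform, Category.assoc]
  rw [← reassoc_of% (D.me_nat i ((1 - t * D.x (hi i)) • 𝟙 (i ◃ X))), hD.merge_assoc]
  simp only [← Functor.map_comp_assoc, Linear.smul_comp, Linear.comp_smul, Category.id_comp,
    Category.comp_id]

theorem deform_split_coassoc (i : Color n) (X : C) :
    (D.deform t u).sp i X ≫ (D.deform t u).sp i (i ◃ X)
      = (D.deform t u).sp i X ≫ i ◂ (D.deform t u).sp i X := by
  simp only [deform, Category.assoc]
  rw [reassoc_of% (D.sp_nat i ((1 - t * D.x (lo i)) • 𝟙 (i ◃ X))),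
    reassoc_of% (hD.split_coassoc i X)]
  simp only [← Functor.map_comp, Linear.smul_comp, Linear.comp_smul, Category.id_comp,
    Category.comp_id]

theorem deform_frobenius_left (i : Color n) (X : C) :
    i ◂ (D.deform t u).sp i X ≫ (D.deform t u).me i (i ◃ X)
      = (D.deform t u).me i X ≫ (D.deform t u).sp i X := by
  simp only [deform, Category.assoc]
  rw [← reassoc_of% (hD.frobenius_left i X), ← D.me_nat]
  simp only [← Functor.map_comp_assoc, Linear.smul_comp, Linear.comp_smul, Category.id_comp,
    Category.comp_id]

theorem deform_frobenius_right (i : Color n) (X : C) :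
    (D.deform t u).sp i (i ◃ X) ≫ i ◂ (D.deform t u).me i X
      = (D.deform t u).me i X ≫ (D.deform t u).sp i X := by
  simp only [deform, Category.assoc]
  rw [← reassoc_of% (hD.frobenius_right i X),
    reassoc_of% (D.sp_nat i ((1 - t * D.x (hi i)) • 𝟙 (i ◃ X)))]
  simp only [← Functor.map_comp, Linear.smul_comp, Linear.comp_smul, Category.id_comp,
    Category.comp_id]

/-- The factor of the start dot is inverse to that of the merge, both in x_hi. The counit uses the
same cancellation between split and end dot, in x_lo. -/
theorem deform_unit_left (i : Color n) (X : C) :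
    (D.deform t u).st i (i ◃ X) ≫ (D.deform t u).me i X = 𝟙 _ := by
  simp only [deform, Linear.smul_comp]
  rw [← reassoc_of% (D.st_nat i ((1 - t * D.x (hi i)) • 𝟙 (i ◃ X))), Linear.smul_comp,
    Category.id_comp, hD.unit_left, smul_smul, mul_comm, ht.inv, one_smul]

theorem deform_unit_right (i : Color n) (X : C) :
    i ◂ (D.deform t u).st i X ≫ (D.deform t u).me i X = 𝟙 _ := by
  simp only [deform]
  rw [← Functor.map_comp_assoc, Linear.comp_smul, Category.comp_id, smul_smul, ht.inv, one_smul,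
    hD.unit_right]

theorem deform_counit_left (i : Color n) (X : C) :
    (D.deform t u).sp i X ≫ (D.deform t u).en i (i ◃ X) = 𝟙 _ := by
  simp only [deform, Linear.comp_smul, Category.assoc]
  rw [D.en_nat, reassoc_of% (hD.counit_left i X), smul_smul, mul_comm, ht.inv, one_smul]

theorem deform_counit_right (i : Color n) (X : C) :
    (D.deform t u).sp i X ≫ i ◂ (D.deform t u).en i X = 𝟙 _ := by
  simp only [deform, Category.assoc]
  rw [← Functor.map_comp, Linear.smul_comp, Category.id_comp, smul_smul, ht.inv, one_smul,
    hD.counit_right]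

/-- The two factors enclosed by the needle form the symmetric product (1 - t x_lo)(1 - t x_hi),
which slides out and leaves an undeformed needle. -/
theorem deform_needle (i : Color n) (X : C) :
    (D.deform t u).sp i X ≫ (D.deform t u).me i X = 0 := by
  simp only [deform, Category.assoc]
  rw [← Functor.map_comp_assoc, Linear.comp_smul, Category.comp_id, smul_smul, mul_comm,
    hD.slides_vv ht, Linear.smul_comp, Category.id_comp, Linear.comp_smul, hD.needle, smul_zero]

/-- x_lo u_lo - x_hi u_hi = u_lo u_hi (x_lo - x_hi), since the terms in t x_lo x_hi cancel. -/
theorem deform_barbell (i : Color n) (X : C) :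
    (D.deform t u).st i X ≫ (D.deform t u).en i X
      = ((D.deform t u).x (lo i) - (D.deform t u).x (hi i)) • 𝟙 X := by
  simp only [deform, Linear.smul_comp, Linear.comp_smul, hD.barbell, smul_smul]
  congr 1
  linear_combination u (lo i) * D.x (lo i) * ht.inv (hi i) - u (hi i) * D.x (hi i) * ht.inv (lo i)

theorem deform_br (i : Color n) (X : C) :
    (D.deform t u).br i X = (u (lo i) * u (hi i)) • D.br i X := by
  simp only [br, deform, Linear.smul_comp, Linear.comp_smul, smul_smul, mul_comm]

theorem deform_force_lo (i : Color n) (X : C) :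
    i ◂ ((D.deform t u).x (lo i) • 𝟙 X)
      = (D.deform t u).x (hi i) • 𝟙 _ + (D.deform t u).br i X := by
  rw [hD.deform_br ht]
  -- The symmetric factor u_lo u_hi is split off. What remains is x_lo minus t times a symmetric
  -- product, so the original forcing relation suffices.
  have h : D.x (lo i) * u (lo i)
      = (u (lo i) * u (hi i)) * (D.x (lo i) - t * (D.x (lo i) * D.x (hi i))) := by
    linear_combination -u (lo i) * D.x (lo i) * ht.inv (hi i)
  simp only [deform]
  rw [h, mul_smul, (hD.slides_uu ht i).map_smul, sub_smul, Functor.map_sub, hD.force_lo,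
    ((ht.slides i).mul (hD.slides_mul i)) X]
  have h2 : D.x (hi i) * u (hi i)
      = (u (lo i) * u (hi i)) * (D.x (hi i) - t * (D.x (lo i) * D.x (hi i))) := by
    linear_combination -u (hi i) * D.x (hi i) * ht.inv (lo i)
  rw [h2]
  module

theorem deform_force_hi (i : Color n) (X : C) :
    i ◂ ((D.deform t u).x (hi i) • 𝟙 X)
      = (D.deform t u).x (lo i) • 𝟙 _ - (D.deform t u).br i X := by
  rw [hD.deform_br ht]
  have h : D.x (lo i) * u (lo i)
      = (u (lo i) * u (hi i)) * (D.x (lo i) - t * (D.x (lo i) * D.x (hi i))) := by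
    linear_combination -u (lo i) * D.x (lo i) * ht.inv (hi i)
  have h2 : D.x (hi i) * u (hi i)
      = (u (lo i) * u (hi i)) * (D.x (hi i) - t * (D.x (lo i) * D.x (hi i))) := by
    linear_combination -u (hi i) * D.x (hi i) * ht.inv (lo i)
  simp only [deform]
  rw [h2, mul_smul, (hD.slides_uu ht i).map_smul, sub_smul, Functor.map_sub, hD.force_hi,
    ((ht.slides i).mul (hD.slides_mul i)) X, h]
  module

theorem deform_force_other (i : Color n) (j : Fin n) (X : C) (hlo : j ≠ lo i) (hhi : j ≠ hi i) :
    i ◂ ((D.deform t u).x j • 𝟙 X) = (D.deform t u).x j • 𝟙 _ :=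
  (hD.slides_other i j hlo hhi).mul (hD.slides_u ht i j hlo hhi) X

/-! Caps and cups. -/

theorem deform_cap (i : Color n) (X : C) :
    (D.deform t u).cap i X
      = u (lo i) • (i ◂ ((1 - t * D.x (hi i)) • 𝟙 _) ≫ D.cap i X) := by
  simp only [cap, deform, Linear.comp_smul, Category.assoc]

theorem deform_cup (i : Color n) (X : C) :
    (D.deform t u).cup i X
      = u (hi i) • (D.cup i X ≫ i ◂ ((1 - t * D.x (lo i)) • 𝟙 _)) := by
  simp only [cup, deform, Linear.smul_comp, Category.assoc]

/-! Distant colors. -/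

end

theorem lo_ne_lo {i j : Color n} (h : Distant i j) : lo i ≠ lo j := by
  simp only [lo, ne_eq, Fin.mk.injEq]
  rcases h with h | h <;> omega

theorem hi_ne_hi {i j : Color n} (h : Distant i j) : hi i ≠ hi j := by
  simp only [hi, ne_eq, Fin.mk.injEq]
  rcases h with h | h <;> omega

theorem lo_ne_hi {i j : Color n} (h : Distant i j) : lo i ≠ hi j := by
  simp only [lo, hi, ne_eq, Fin.mk.injEq]
  rcases h with h | h <;> omega

theorem hi_ne_lo {i j : Color n} (h : Distant i j) : hi i ≠ lo j := by
  simp only [lo, hi, ne_eq, Fin.mk.injEq]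
  rcases h with h | h <;> omega

section
include hD ht

/-- The variables of i are not variables of a distant j, so every factor attached to i slides
through the strand j. The other relations for distant colors hold for the same reason. -/
theorem deform_cross_dot (i j : Color n) (h : Distant i j) (X : C) :
    (D.deform t u).cr i j h X ≫ j ◂ (D.deform t u).en i X = (D.deform t u).en i (j ◃ X) := by
  simp only [deform]
  rw [(hD.slides_u ht j (lo i) (lo_ne_lo h) (lo_ne_hi h)).map_smul, Linear.comp_smul,
    hD.cross_dot]

theorem deform_cross_merge (i j : Color n) (h : Distant i j) (X : C) :
    i ◂ (D.deform t u).cr i j h X ≫ (D.deform t u).cr i j h (i ◃ X) ≫ j ◂ (D.deform t u).me i X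
      = (D.deform t u).me i (j ◃ X) ≫ (D.deform t u).cr i j h X := by
  simp only [deform, Functor.map_comp, Category.assoc]
  rw [← reassoc_of% (D.cr_nat i j h ((1 - t * D.x (hi i)) • 𝟙 (i ◃ X))), ← hD.cross_merge,
    (hD.slides_v ht j (hi i) (hi_ne_lo h) (hi_ne_hi h))]
  simp only [← Functor.map_comp_assoc, Linear.smul_comp, Linear.comp_smul, Category.id_comp,
    Category.comp_id]

theorem deform_cross_rotate (i j : Color n) (h : Distant i j) (X : C) :
    (D.deform t u).cup i (j ◃ i ◃ X) ≫ i ◂ (D.deform t u).cr i j h (i ◃ X)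
        ≫ i ◂ j ◂ (D.deform t u).cap i X
      = (D.deform t u).cr j i h.symm X := by
  rw [hD.deform_cap ht, hD.deform_cup ht]
  simp only [deform, Category.assoc, Linear.smul_comp]
  rw [(hD.slides_u ht j (lo i) (lo_ne_lo h) (lo_ne_hi h)).map_smul, ← Functor.map_comp,
    ← Functor.map_comp, Functor.map_comp (F j), Linear.comp_smul, Linear.smul_comp,
    Category.id_comp, smul_smul, ht.inv, one_smul,
    ← reassoc_of% (D.cr_nat i j h ((1 - t * D.x (hi i)) • 𝟙 (i ◃ X))),
    (hD.slides_v ht j (hi i) (hi_ne_lo h) (hi_ne_hi h)), Functor.map_comp,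
    ← reassoc_of% (D.cup_nat i ((1 - t * D.x (hi i)) • 𝟙 (j ◃ i ◃ X))), Linear.smul_comp,
    Category.id_comp, smul_smul, mul_comm, ht.inv, one_smul, Functor.map_comp, hD.cross_rotate]

end

end IsModel

end DiagAction

end DiagAction

end HeckeDiag


/-! ### Adjacent colors: rotation and dot relations for the deformed 6-valent vertex. -/

namespace HeckeDiag

open CategoryTheory

section DiagAction

variable {n : ℕ} {R : Type*} [CommRing R] {C : Type*} [Category C] [Preadditive C] [Linear R C]
  {F : Color n → C ⥤ C}

local notation:91 i:92 " ◃ " X:91 => CategoryTheory.Functor.obj (F i) X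
local notation:91 i:92 " ◂ " f:91 => CategoryTheory.Functor.map (F i) f

namespace DiagAction

theorem lo_eq_hi {i j : Color n} (h : i.val + 1 = j.val) : lo j = hi i := by
  simp only [lo, hi, h]

theorem lo_ne_lo_of_succ {i j : Color n} (h : i.val + 1 = j.val) : lo i ≠ lo j := by
  simp only [lo, ne_eq, Fin.mk.injEq]
  omega

theorem lo_ne_hi_of_succ {i j : Color n} (h : i.val + 1 = j.val) : lo i ≠ hi j := by
  simp only [lo, hi, ne_eq, Fin.mk.injEq]
  omega

theorem hi_ne_hi_of_succ {i j : Color n} (h : i.val + 1 = j.val) : hi j ≠ hi i := by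
  simp only [hi, ne_eq, Fin.mk.injEq]
  omega

theorem deform_six_up (D : DiagAction R F) (t : R) (u : Fin n → R) {i j : Color n}
    (h : Adjacent i j) (hij : i.val + 1 = j.val) (X : C) :
    (D.deform t u).si i j h X
      = (u (lo i) * u (hi j)) • (i ◂ j ◂ ((1 - t * D.x (hi i)) • 𝟙 _) ≫ D.si i j h X
        ≫ j ◂ i ◂ ((1 - t * D.x (hi i)) • 𝟙 _)) := if_pos hij

theorem deform_six_down (D : DiagAction R F) (t : R) (u : Fin n → R) {i j : Color n}
    (h : Adjacent j i) (hij : i.val + 1 = j.val) (X : C) :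
    (D.deform t u).si j i h X = D.si j i h X := if_neg (by omega)

namespace IsModel

variable [∀ i, (F i).Additive] {D : DiagAction R F} (hD : D.IsModel) {t : R} {u : Fin n → R}
  (ht : D.IsAdmissible t u)

section
include hD

theorem br_me (i : Color n) (X : C) : D.br i (i ◃ X) ≫ D.me i X = D.en i (i ◃ X) := by
  rw [br, Category.assoc, hD.unit_left, Category.comp_id]

/-- Two stacked 6-valent vertices with a broken strand in between, followed by a trivalent vertex,
vanish. -/
theorem six_br_six_merge (i j : Color n) (h : Adjacent i j) (X : C) :
    i ◂ D.si i j h X ≫ i ◂ j ◂ D.br i (j ◃ X) ≫ D.si i j h (j ◃ X) ≫ j ◂ i ◂ D.me j X = 0 := by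
  have h1 : i ◂ j ◂ D.st i (j ◃ X) ≫ D.si i j h (j ◃ X) ≫ j ◂ i ◂ D.me j X
      = i ◂ D.me j X ≫ (D.st j (i ◃ j ◃ X) + D.en i (j ◃ X) ≫ D.sp j X ≫ j ◂ D.st i (j ◃ X)) := by
    rw [reassoc_of% (hD.st_six_right i j h (j ◃ X)), Preadditive.add_comp, Preadditive.comp_add,
      D.st_nat, reassoc_of% (D.en_nat i (D.me j X)), ← reassoc_of% (hD.frobenius_right j X)]
    simp only [Category.assoc, ← Functor.map_comp, D.st_nat]
  -- Both terms of `h1` start by merging the two j strands, which on the dotted lower vertex gives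
  -- the needle of `six_merge_middle`.
  have h2 : i ◂ D.si i j h X ≫ i ◂ j ◂ D.en i (j ◃ X) ≫ i ◂ D.me j X = 0 := by
    rw [← Functor.map_comp, ← Functor.map_comp, hD.six_merge_middle, Functor.map_zero]
  simp only [br, Functor.map_comp, Category.assoc]
  rw [h1, reassoc_of% h2, Limits.zero_comp]

end

section
include hD ht

theorem u_lo_v_hi (i : Color n) (X : C) :
    u (lo i) • i ◂ ((1 - t * D.x (hi i)) • 𝟙 X) = 𝟙 _ + (t * u (lo i)) • D.br i X := by
  rw [hD.force_v_hi ht]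
  linear_combination (norm := module) ht.inv (lo i) • 𝟙 (i ◃ X)

variable {i j : Color n} (hij : i.val + 1 = j.val)
include hij

theorem slides_six_mid_vv :
    Slides F j ((1 - t * D.x (hi i)) * (1 - t * D.x (hi j))) := by
  have h := hD.slides_vv ht j
  rwa [lo_eq_hi hij] at h

theorem slides_six_u_lo : Slides F j (u (lo i)) :=
  hD.slides_u ht j _ (lo_ne_lo_of_succ hij) (lo_ne_hi_of_succ hij)

theorem slides_six_v_lo : Slides F j (1 - t * D.x (lo i)) :=
  hD.slides_v ht j _ (lo_ne_lo_of_succ hij) (lo_ne_hi_of_succ hij)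

theorem slides_six_u_hi : Slides F i (u (hi j)) :=
  hD.slides_u ht i _ (lo_ne_hi_of_succ hij).symm (hi_ne_hi_of_succ hij)

theorem slides_six_v_hi : Slides F i (1 - t * D.x (hi j)) :=
  hD.slides_v ht i _ (lo_ne_hi_of_succ hij).symm (hi_ne_hi_of_succ hij)

/-- The cap cancels the top factor 1 - t x_{i+1} and contributes 1 - t x_{i+2}, which slides below
the vertex. There it completes a product symmetric in the variables of j. That product and the
scalars of cup and vertex multiply to 1, which matches the undeformed S_{i+1,i}. -/
theorem deform_six_rotate_up (h : Adjacent i j) (X : C) :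
    (D.deform t u).cup i (j ◃ i ◃ j ◃ X) ≫ i ◂ (D.deform t u).si i j h (j ◃ X)
        ≫ i ◂ j ◂ i ◂ (D.deform t u).cap j X = (D.deform t u).si j i h.symm X := by
  have e1 : i ◂ j ◂ i ◂ ((1 - t * D.x (hi j)) • 𝟙 (j ◃ X))
      = i ◂ j ◂ ((1 - t * D.x (hi j)) • 𝟙 (i ◃ j ◃ X)) := by
    rw [hD.slides_six_v_hi ht hij]
  have e2 : (D.deform t u).si i j h (j ◃ X) ≫ j ◂ i ◂ (D.deform t u).cap j X
      = (u (lo i) * u (hi j)) •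
        (i ◂ (((1 - t * D.x (hi i)) * (1 - t * D.x (hi j))) • 𝟙 (j ◃ i ◃ j ◃ X))
          ≫ D.si i j h (j ◃ X) ≫ j ◂ i ◂ D.cap j X) := by
    rw [deform_six_up D t u h hij, hD.deform_cap ht, lo_eq_hi hij, Linear.smul_comp,
      Category.assoc, Category.assoc, ← Functor.map_comp, ← Functor.map_comp, Linear.smul_comp,
      Category.id_comp, smul_smul, ht.inv, one_smul, Functor.map_comp, Functor.map_comp,
      ← reassoc_of% (D.si_nat i j h ((1 - t * D.x (hi j)) • 𝟙 (j ◃ X))), e1,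
      ← Functor.map_comp_assoc, ← Functor.map_comp, Linear.smul_comp, Category.id_comp,
      smul_smul, hD.slides_six_mid_vv ht hij]
  rw [deform_six_down D t u h.symm hij, hD.deform_cup ht, Linear.smul_comp, Category.assoc,
    ← Functor.map_comp, e2, ← Functor.map_comp, Linear.smul_comp, Category.id_comp, smul_smul,
    ← mul_assoc, ht.inv, one_mul, (hD.slides_six_u_hi ht hij).map_smul, Functor.map_comp,
    Linear.comp_smul, ← reassoc_of% (D.cup_nat i _), Linear.smul_comp, Category.id_comp,
    smul_smul, smul_smul, Functor.map_comp, hD.six_rotate]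
  have e3 : u (hi i) * u (hi j) * ((1 - t * D.x (hi i)) * (1 - t * D.x (hi j))) = 1 := by
    linear_combination (1 - t * D.x (hi j)) * u (hi j) * ht.inv (hi i) + ht.inv (hi j)
  rw [e3, one_smul]

theorem deform_six_rotate_down (h : Adjacent j i) (X : C) :
    (D.deform t u).cup j (i ◃ j ◃ i ◃ X) ≫ j ◂ (D.deform t u).si j i h (i ◃ X)
        ≫ j ◂ i ◂ j ◂ (D.deform t u).cap i X = (D.deform t u).si i j h.symm X := by
  have e1 : i ◂ j ◂ (D.deform t u).cap i X
      = i ◂ j ◂ i ◂ ((1 - t * D.x (hi i)) • 𝟙 (i ◃ X)) ≫ i ◂ j ◂ D.cap i X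
        ≫ i ◂ (u (lo i) • 𝟙 _) := by
    rw [hD.deform_cap ht, (hD.slides_six_u_lo ht hij).map_smul]
    simp only [← Functor.map_comp, Linear.comp_smul, Category.comp_id]
  -- Since u_lo equals the sliding scalar u_lo u_hi times 1 - t x_hi, either side of this equality
  -- can be rewritten as the other. It lets u_lo and 1 - t x_hi exchange sides of the strand i.
  have e2 : u (lo i) • i ◂ ((1 - t * D.x (hi i)) • 𝟙 (j ◃ X))
      = (1 - t * D.x (hi i)) • i ◂ (u (lo i) • 𝟙 (j ◃ X)) := by
    rw [hD.force_u_lo ht, hD.u_lo_v_hi ht]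
    linear_combination (norm := module) (-ht.inv (hi i)) • 𝟙 (i ◃ j ◃ X)
      - (t * u (lo i) * ht.inv (hi i)) • D.br i (j ◃ X)
  have e3 (f : j ◃ i ◃ j ◃ i ◃ X ⟶ _) :
      (1 - t * D.x (hi i)) • f ≫ D.si j i h (i ◃ X) ≫ i ◂ j ◂ D.cap i X
          ≫ i ◂ (u (lo i) • 𝟙 (j ◃ X))
        = f ≫ D.si j i h (i ◃ X) ≫ i ◂ j ◂ D.cap i X
          ≫ (u (lo i) • i ◂ ((1 - t * D.x (hi i)) • 𝟙 (j ◃ X))) := by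
    rw [e2]
    simp only [Linear.comp_smul]
  rw [deform_six_up D t u h.symm hij, deform_six_down D t u h hij, hD.deform_cup ht,
    Linear.smul_comp, ← Functor.map_comp, e1, ← reassoc_of% (D.si_nat j i h _), lo_eq_hi hij,
    Category.assoc, ← Functor.map_comp, Linear.smul_comp, Category.id_comp, e3,
    Functor.map_comp, ← reassoc_of% (D.cup_nat j _), Functor.map_comp, Functor.map_comp,
    reassoc_of% (hD.six_rotate j i h X), (hD.slides_six_u_lo ht hij).map_smul,
    Linear.comp_smul, Linear.comp_smul, smul_smul, mul_comm]

theorem deform_six_dot_up (h : Adjacent i j) (X : C) :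
    (D.deform t u).si i j h X ≫ j ◂ i ◂ (D.deform t u).en j X
      = (D.deform t u).en i (j ◃ i ◃ X)
        + i ◂ (D.deform t u).en j (i ◃ X) ≫ (D.deform t u).me i X
          ≫ (D.deform t u).st j (i ◃ X) := by
  rw [deform_six_up D t u h hij]
  simp only [deform, lo_eq_hi hij]
  have e1 : i ◂ j ◂ ((1 - t * D.x (hi i)) • 𝟙 (i ◃ X)) ≫ D.en i (j ◃ i ◃ X)
      = (1 - t * D.x (hi j)) • D.en i (j ◃ i ◃ X)
        - t • D.en i (j ◃ i ◃ X) ≫ D.br j (i ◃ X) := by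
    rw [D.en_nat, ← lo_eq_hi hij, hD.force_v_lo ht, Preadditive.comp_sub, Linear.comp_smul,
      Linear.comp_smul, Category.comp_id]
  have e2 : i ◂ j ◂ ((1 - t * D.x (hi i)) • 𝟙 (i ◃ X)) ≫ i ◂ D.en j (i ◃ X) ≫ D.me i X
      = (1 - t * D.x (lo i)) • i ◂ D.en j (i ◃ X) ≫ D.me i X
        + t • D.en i (j ◃ i ◃ X) ≫ D.en j (i ◃ X) := by
    rw [← Functor.map_comp_assoc, D.en_nat, Functor.map_comp, Category.assoc,
      hD.force_v_hi ht, Preadditive.add_comp, Linear.smul_comp, Linear.smul_comp,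
      Category.id_comp, hD.br_me, ← D.en_nat, Preadditive.comp_add, Linear.comp_smul,
      Linear.comp_smul]
  have e3 : i ◂ (u (hi i) • D.en j (i ◃ X)) ≫ (i ◂ ((1 - t * D.x (hi i)) • 𝟙 (i ◃ X)) ≫ D.me i X)
      = i ◂ D.en j (i ◃ X) ≫ D.me i X := by
    rw [← Functor.map_comp_assoc, Linear.comp_smul, Category.comp_id, smul_smul, ht.inv,
      one_smul]
  rw [← Category.assoc _ _ (u (hi j) • D.st j (i ◃ X)), e3, Linear.smul_comp, Category.assoc,
    Category.assoc, ← Functor.map_comp, ← Functor.map_comp, Linear.smul_comp, Category.id_comp, smul_smul, ht.inv, one_smul,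
    hD.six_dot, Preadditive.comp_add, e1, reassoc_of% e2]
  simp only [Preadditive.add_comp, Linear.smul_comp, Linear.comp_smul, Category.assoc, br]
  -- Forcing in the two terms of `six_dot` produces the same diagram, made of two end dots and a
  -- start dot, with coefficients -t and t. These corrections cancel.
  linear_combination (norm := module) (u (lo i) * ht.inv (hi j)) • D.en i (j ◃ i ◃ X)
    + (u (hi j) * ht.inv (lo i)) • i ◂ D.en j (i ◃ X) ≫ D.me i X ≫ D.st j (i ◃ X)

theorem deform_six_dot_down (h : Adjacent j i) (X : C) :
    (D.deform t u).si j i h X ≫ i ◂ j ◂ (D.deform t u).en i X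
      = (D.deform t u).en j (i ◃ j ◃ X)
        + j ◂ (D.deform t u).en i (j ◃ X) ≫ (D.deform t u).me j X
          ≫ (D.deform t u).st i (j ◃ X) := by
  rw [deform_six_down D t u h hij]
  simp only [deform, lo_eq_hi hij]
  have e1 : i ◂ (u (lo i) • j ◂ D.en i X) = i ◂ j ◂ D.en i X ≫ i ◂ (u (lo i) • 𝟙 (j ◃ X)) := by
    rw [comp_map_smul_id]
  have e2 : j ◂ ((1 - t * D.x (hi j)) • 𝟙 (j ◃ X)) ≫ D.me j X
      = (1 - t * D.x (hi i)) • D.me j X + t • D.en j (j ◃ X) := by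
    rw [hD.force_v_hi ht, Preadditive.add_comp, Linear.smul_comp, Linear.smul_comp,
      Category.id_comp, hD.br_me, lo_eq_hi hij]
  have e3 : D.st i (j ◃ X) ≫ i ◂ (u (lo i) • 𝟙 (j ◃ X)) = u (lo i) • D.st i (j ◃ X) := by
    rw [← D.st_nat, Linear.smul_comp, Category.id_comp]
  rw [(hD.slides_six_u_lo ht hij).map_smul, (hD.slides_six_u_lo ht hij).map_smul, e1,
    reassoc_of% (hD.six_dot j i h X), Preadditive.add_comp, Category.assoc, Category.assoc, e3,
    hD.force_u_lo ht, e2]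
  simp only [Preadditive.add_comp, Preadditive.comp_add, Linear.smul_comp, Linear.comp_smul,
    Category.comp_id, br]
  rw [← reassoc_of% (D.en_nat j (D.en i (j ◃ X)))]
  -- Moving u_i over the strand i on one side and forcing at the merge on the other produce the same
  -- doubly dotted correction, with coefficient t u_i u_{i+1}.
  linear_combination (norm := module)
    (-u (lo i) * ht.inv (hi i)) • j ◂ D.en i (j ◃ X) ≫ D.me j X ≫ D.st i (j ◃ X)

end

end IsModel

end DiagAction

end DiagAction

end HeckeDiag


/-! ### Adjacent colors: trivalent vertices, distant strands and the double 6-valent vertex. -/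

namespace HeckeDiag

open CategoryTheory

section DiagAction

variable {n : ℕ} {R : Type*} [CommRing R] {C : Type*} [Category C] [Preadditive C] [Linear R C]
  {F : Color n → C ⥤ C}

local notation:91 i:92 " ◃ " X:91 => CategoryTheory.Functor.obj (F i) X
local notation:91 i:92 " ◂ " f:91 => CategoryTheory.Functor.map (F i) f

namespace DiagAction

namespace IsModel

variable [∀ i, (F i).Additive] {D : DiagAction R F} (hD : D.IsModel) {t : R} {u : Fin n → R}
  (ht : D.IsAdmissible t u) {i j : Color n} (hij : i.val + 1 = j.val)
include hD ht hij

/-- Between the two stacked vertices the factors become scalars up to one term with a broken strand.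
That term vanishes by `six_br_six_merge`, and the remaining one is the undeformed relation with the
correct factors. -/
theorem deform_six_merge_up (h : Adjacent i j) (X : C) :
    (D.deform t u).me i (j ◃ i ◃ X) ≫ (D.deform t u).si i j h X
      = i ◂ (D.deform t u).si i j h X ≫ (D.deform t u).si i j h (j ◃ X)
        ≫ j ◂ i ◂ (D.deform t u).me j X := by
  have e1 : (D.deform t u).si i j h (j ◃ X) ≫ j ◂ i ◂ (D.deform t u).me j X
      = (u (lo i) * u (hi j)) •
        (i ◂ (((1 - t * D.x (hi i)) * (1 - t * D.x (hi j))) • 𝟙 (j ◃ i ◃ j ◃ X))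
          ≫ D.si i j h (j ◃ X) ≫ j ◂ i ◂ D.me j X
          ≫ j ◂ i ◂ ((1 - t * D.x (hi i)) • 𝟙 _)) := by
    have f1 : i ◂ j ◂ i ◂ ((1 - t * D.x (hi j)) • 𝟙 (j ◃ X))
        = i ◂ j ◂ ((1 - t * D.x (hi j)) • 𝟙 (i ◃ j ◃ X)) := by
      rw [hD.slides_six_v_hi ht hij]
    have f2 : j ◂ i ◂ ((1 - t * D.x (hi i)) • 𝟙 (j ◃ j ◃ X)) ≫ j ◂ i ◂ (D.deform t u).me j X
        = j ◂ i ◂ j ◂ ((1 - t * D.x (hi j)) • 𝟙 (j ◃ X)) ≫ j ◂ i ◂ D.me j X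
          ≫ j ◂ i ◂ ((1 - t * D.x (hi i)) • 𝟙 _) := by
      simp only [deform, ← Functor.map_comp, Linear.smul_comp, Linear.comp_smul, Category.id_comp,
        Category.comp_id]
    rw [deform_six_up D t u h hij, Linear.smul_comp, Category.assoc, Category.assoc, f2,
      ← reassoc_of% (D.si_nat i j h ((1 - t * D.x (hi j)) • 𝟙 (j ◃ X))), f1,
      ← Functor.map_comp_assoc, ← Functor.map_comp, Linear.smul_comp, Category.id_comp,
      smul_smul, hD.slides_six_mid_vv ht hij]
  have e3 : ((1 - t * D.x (hi i)) * (1 - t * D.x (hi j)) * (u (lo i) * u (hi j))) •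
      D.si i j h X ≫ j ◂ i ◂ ((1 - t * D.x (hi i)) • 𝟙 (j ◃ X))
      = (1 - t * D.x (hi i)) • D.si i j h X
        + ((1 - t * D.x (hi i)) * (t * u (lo i))) • D.si i j h X ≫ j ◂ D.br i (j ◃ X) := by
    rw [show (1 - t * D.x (hi i)) * (1 - t * D.x (hi j)) * (u (lo i) * u (hi j))
        = (1 - t * D.x (hi i)) * u (lo i) by
          linear_combination (1 - t * D.x (hi i)) * u (lo i) * ht.inv (hi j),
      mul_smul, ← Linear.comp_smul, ← (hD.slides_six_u_lo ht hij).map_smul,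
      hD.u_lo_v_hi ht, Functor.map_add, (((ht.slides j).mul (hD.slides_six_u_lo ht hij))).map_smul,
      Preadditive.comp_add, CategoryTheory.Functor.map_id, Category.comp_id, Linear.comp_smul,
      smul_add, smul_smul]
  have e4 : i ◂ (D.deform t u).si i j h X
        ≫ i ◂ (((1 - t * D.x (hi i)) * (1 - t * D.x (hi j))) • 𝟙 (j ◃ i ◃ j ◃ X))
      = i ◂ i ◂ j ◂ ((1 - t * D.x (hi i)) • 𝟙 (i ◃ X))
        ≫ (i ◂ ((1 - t * D.x (hi i)) • D.si i j h X)
          + i ◂ (((1 - t * D.x (hi i)) * (t * u (lo i))) • 𝟙 _)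
            ≫ i ◂ D.si i j h X ≫ i ◂ j ◂ D.br i (j ◃ X)) := by
    rw [deform_six_up D t u h hij, comp_map_smul_id, smul_smul, ← Linear.comp_smul, e3,
      Functor.map_comp, Functor.map_add]
    congr 2
    rw [← Functor.map_comp, ← Functor.map_comp, Linear.smul_comp, Category.id_comp]
  rw [e1, Linear.comp_smul, reassoc_of% e4, Preadditive.add_comp, Preadditive.comp_add]
  simp only [Category.assoc]
  rw [reassoc_of% (hD.six_br_six_merge i j h X), Limits.zero_comp, Limits.comp_zero,
    Limits.comp_zero, add_zero, deform_six_up D t u h hij, Linear.comp_smul]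
  simp only [deform, Category.assoc]
  rw [← reassoc_of% (D.me_nat i _), reassoc_of% (hD.six_merge i j h X)]
  simp only [← Functor.map_comp_assoc, Linear.smul_comp, Linear.comp_smul, Category.id_comp]

/-- Only the merges carry factors. Pulling the upper one down to the region between the vertices and
forcing it across j produces 1 - t x_{i+2} and a broken strand; the latter contributes zero by
`six_br_six_merge`. -/
theorem deform_six_merge_down (h : Adjacent j i) (X : C) :
    (D.deform t u).me j (i ◃ j ◃ X) ≫ (D.deform t u).si j i h X
      = j ◂ (D.deform t u).si j i h X ≫ (D.deform t u).si j i h (i ◃ X)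
        ≫ i ◂ j ◂ (D.deform t u).me i X := by
  simp only [deform_six_down D t u h hij]
  simp only [deform, Category.assoc]
  have e1 : j ◂ D.si j i h X ≫ j ◂ i ◂ j ◂ ((1 - t * D.x (hi i)) • 𝟙 (i ◃ X))
      = j ◂ ((1 - t * D.x (hi j)) • D.si j i h X)
        - t • j ◂ D.si j i h X ≫ j ◂ i ◂ D.br j (i ◃ X) := by
    rw [← lo_eq_hi hij, hD.force_v_lo ht, Functor.map_sub, (hD.slides_six_v_hi ht hij).map_smul,
      (ht.slides i).map_smul, ← Functor.map_comp, Preadditive.comp_sub, Linear.comp_smul,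
      Linear.comp_smul, CategoryTheory.Functor.map_id, Category.comp_id, Functor.map_sub,
      (ht.slides j).map_smul, Functor.map_comp]
  rw [Functor.map_comp, Functor.map_comp, ← reassoc_of% (D.si_nat j i h _), reassoc_of% e1,
    Preadditive.sub_comp, Linear.smul_comp, Category.assoc, hD.six_br_six_merge, smul_zero,
    sub_zero, hD.six_merge, ← Functor.map_comp_assoc,
    Linear.smul_comp, Category.id_comp]

theorem deform_six_distant_up (k : Color n) (h : Adjacent i j) (hik : Distant i k)
    (hjk : Distant j k) (X : C) :
    i ◂ j ◂ (D.deform t u).cr i k hik X ≫ i ◂ (D.deform t u).cr j k hjk (i ◃ X)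
        ≫ (D.deform t u).cr i k hik (j ◃ i ◃ X) ≫ k ◂ (D.deform t u).si i j h X
      = (D.deform t u).si i j h (k ◃ X) ≫ j ◂ i ◂ (D.deform t u).cr j k hjk X
        ≫ j ◂ (D.deform t u).cr i k hik (j ◃ X) ≫ (D.deform t u).cr j k hjk (i ◃ j ◃ X) := by
  simp only [deform_six_up D t u h hij]
  simp only [deform]
  have s1 : Slides F k (u (lo i)) := hD.slides_u ht k _ (lo_ne_lo hik) (lo_ne_hi hik)
  have s2 : Slides F k (u (hi j)) := hD.slides_u ht k _ (hi_ne_lo hjk) (hi_ne_hi hjk)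
  have s3 : Slides F k (1 - t * D.x (hi i)) := hD.slides_v ht k _ (hi_ne_lo hik) (hi_ne_hi hik)
  have e1 (f : i ◃ X ⟶ i ◃ X) : i ◂ D.cr j k hjk (i ◃ X) ≫ D.cr i k hik (j ◃ i ◃ X)
      ≫ k ◂ i ◂ j ◂ f = i ◂ j ◂ k ◂ f ≫ i ◂ D.cr j k hjk (i ◃ X) ≫ D.cr i k hik (j ◃ i ◃ X) := by
    rw [← D.cr_nat, ← Functor.map_comp_assoc, ← D.cr_nat, Functor.map_comp_assoc]
  have e2 (f : j ◃ X ⟶ j ◃ X) : j ◂ D.cr i k hik (j ◃ X) ≫ D.cr j k hjk (i ◃ j ◃ X)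
      ≫ k ◂ j ◂ i ◂ f = j ◂ i ◂ k ◂ f ≫ j ◂ D.cr i k hik (j ◃ X) ≫ D.cr j k hjk (i ◃ j ◃ X) := by
    rw [← D.cr_nat, ← Functor.map_comp_assoc, ← D.cr_nat, Functor.map_comp_assoc]
  have e3 : i ◂ j ◂ D.cr i k hik X ≫ i ◂ j ◂ k ◂ ((1 - t * D.x (hi i)) • 𝟙 (i ◃ X))
      = i ◂ j ◂ ((1 - t * D.x (hi i)) • 𝟙 _) ≫ i ◂ j ◂ D.cr i k hik X := by
    rw [s3, ← Functor.map_comp, ← Functor.map_comp, ← Functor.map_comp, ← Functor.map_comp]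
    simp
  have e4 : j ◂ i ◂ ((1 - t * D.x (hi i)) • 𝟙 _) ≫ j ◂ i ◂ D.cr j k hjk X
      = j ◂ i ◂ D.cr j k hjk X ≫ j ◂ i ◂ k ◂ ((1 - t * D.x (hi i)) • 𝟙 (j ◃ X)) := by
    rw [s3, ← Functor.map_comp, ← Functor.map_comp, ← Functor.map_comp, ← Functor.map_comp]
    simp
  rw [(s1.mul s2).map_smul]
  simp only [Functor.map_comp, Linear.comp_smul, Linear.smul_comp, Category.assoc]
  rw [reassoc_of% (e1 ((1 - t * D.x (hi i)) • 𝟙 (i ◃ X))), reassoc_of% e3, reassoc_of% e4,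
    ← e2, ← reassoc_of% (hD.six_distant i j k h hik hjk X)]

/-- The factor between the two vertices prevents a direct use of `six_six`. Forced across the last
strand, it becomes a factor at the far right plus a broken strand. The former slides away through
the lower vertex by naturality, and `six_six` applies; the latter is resolved by `six_dot` below and
`st_six_right` above. Both sides are then combinations of the same few diagrams, whose coefficients
agree by u_j (1 - t x_j) = 1. -/
theorem deform_six_six_up (h : Adjacent i j) (X : C) :
    (D.deform t u).si i j h X ≫ (D.deform t u).si j i h.symm X
      = 𝟙 _ + i ◂ (D.deform t u).en j (i ◃ X) ≫ (D.deform t u).me i X ≫ (D.deform t u).sp i X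
        ≫ i ◂ (D.deform t u).st j (i ◃ X) := by
  have s1 : Slides F i (u (hi j)) := hD.slides_six_u_hi ht hij
  have s2 : Slides F i (1 - t * D.x (hi j)) := hD.slides_six_v_hi ht hij
  have hA : i ◂ j ◂ ((1 - t * D.x (hi i)) • 𝟙 (i ◃ X))
      = (1 - t * D.x (hi j)) • 𝟙 _ - t • i ◂ D.br j (i ◃ X) := by
    rw [← lo_eq_hi hij, hD.force_v_lo ht, Functor.map_sub, s2, (ht.slides i).map_smul]
  have hB : j ◂ i ◂ ((1 - t * D.x (hi i)) • 𝟙 (j ◃ X))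
      = j ◂ i ◂ j ◂ ((1 - t * D.x (hi j)) • 𝟙 X) - t • j ◂ i ◂ D.br j X := by
    rw [hD.force_v_hi ht j, Functor.map_add, Functor.map_add, lo_eq_hi hij, (ht.slides i).map_smul,
      (ht.slides j).map_smul, add_sub_cancel_right]
  have hK : D.br i (j ◃ i ◃ X) ≫ i ◂ D.en j (i ◃ X) ≫ D.me i X
      = D.en i (j ◃ i ◃ X) ≫ D.en j (i ◃ X) := by
    rw [br, Category.assoc, ← reassoc_of% (D.st_nat i (D.en j (i ◃ X))), hD.unit_left,
      Category.comp_id]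
  have hv : i ◂ ((1 - t * D.x (hi i)) • 𝟙 (j ◃ i ◃ X))
      = (1 - t * D.x (lo i)) • 𝟙 _ + t • D.br i (j ◃ i ◃ X) := hD.force_v_hi ht ..
  have first : i ◂ j ◂ ((1 - t * D.x (hi i)) • 𝟙 (i ◃ X)) ≫ D.si i j h X
        ≫ j ◂ i ◂ j ◂ ((1 - t * D.x (hi j)) • 𝟙 X) ≫ D.si j i h.symm X
      = (1 - t * D.x (hi j)) • ((1 - t * D.x (lo i)) • 𝟙 _ + t • D.br i (j ◃ i ◃ X)
        + (1 - t * D.x (lo i)) • i ◂ D.en j (i ◃ X) ≫ D.me i X ≫ D.sp i X ≫ i ◂ D.st j (i ◃ X)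
        + t • D.en i (j ◃ i ◃ X) ≫ D.en j (i ◃ X) ≫ D.sp i X ≫ i ◂ D.st j (i ◃ X)) := by
    have e : i ◂ j ◂ ((1 - t * D.x (hi i)) • 𝟙 (i ◃ X))
        ≫ i ◂ j ◂ i ◂ ((1 - t * D.x (hi j)) • 𝟙 X)
        = (1 - t * D.x (hi j)) • ((1 - t * D.x (lo i)) • 𝟙 _ + t • D.br i (j ◃ i ◃ X)) := by
      have hs := hD.slides_vv ht j
      rw [lo_eq_hi hij] at hs
      rw [s2, ← Functor.map_comp, ← Functor.map_comp, Linear.smul_comp, Category.id_comp,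
        smul_smul, hs, mul_comm, mul_smul, s2.map_smul, hv]
    rw [← reassoc_of% (D.si_nat i j h _), reassoc_of% e, hD.six_six]
    simp only [Linear.smul_comp, Preadditive.add_comp, Preadditive.comp_add, Category.id_comp,
      Category.comp_id, reassoc_of% hK]
    module
  have hE1 : i ◂ D.br j (i ◃ X) ≫ D.en i (j ◃ i ◃ X) = D.en i (j ◃ i ◃ X) ≫ D.br j (i ◃ X) :=
    D.en_nat ..
  have hE2 : i ◂ j ◂ ((1 - t * D.x (hi i)) • 𝟙 (i ◃ X)) ≫ i ◂ D.en j (i ◃ X) ≫ D.me i X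
      = (1 - t * D.x (lo i)) • i ◂ D.en j (i ◃ X) ≫ D.me i X
        + t • D.en i (j ◃ i ◃ X) ≫ D.en j (i ◃ X) := by
    rw [← Functor.map_comp_assoc, D.en_nat, Linear.comp_smul, Category.comp_id,
      ← map_smul_id_comp, Category.assoc, hv]
    simp only [Preadditive.add_comp, Linear.smul_comp, Category.id_comp, hK]
  have hbb : D.br j (i ◃ X) ≫ D.en j (i ◃ X)
      = (D.x (hi i) - D.x (hi j)) • D.en j (i ◃ X) := by
    rw [br, Category.assoc, hD.barbell, lo_eq_hi hij, Linear.comp_smul, Category.comp_id]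
  have hb : D.st j (i ◃ X) ≫ D.en j (i ◃ X) = (D.x (hi i) - D.x (hi j)) • 𝟙 _ := by
    rw [hD.barbell, lo_eq_hi hij]
  have second : i ◂ j ◂ ((1 - t * D.x (hi i)) • 𝟙 (i ◃ X)) ≫ D.si i j h X
        ≫ j ◂ i ◂ D.br j X ≫ D.si j i h.symm X
      = (1 - t * D.x (hi j)) • D.br i (j ◃ i ◃ X)
        + (1 - t * D.x (hi i)) • D.en i (j ◃ i ◃ X) ≫ D.en j (i ◃ X) ≫ D.sp i X
          ≫ i ◂ D.st j (i ◃ X)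
        + (1 - t * D.x (lo i)) • i ◂ D.en j (i ◃ X) ≫ D.me i X ≫ D.st j (i ◃ X)
          ≫ D.st i (j ◃ i ◃ X)
        + (D.x (hi i) - D.x (hi j)) • ((1 - t * D.x (lo i)) •
            i ◂ D.en j (i ◃ X) ≫ D.me i X ≫ D.sp i X ≫ i ◂ D.st j (i ◃ X)
          + t • D.en i (j ◃ i ◃ X) ≫ D.en j (i ◃ X) ≫ D.sp i X ≫ i ◂ D.st j (i ◃ X)) := by
    have e0 : j ◂ i ◂ D.br j X = j ◂ i ◂ D.en j X ≫ j ◂ i ◂ D.st j X := by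
      rw [br, Functor.map_comp, Functor.map_comp]
    rw [e0, Category.assoc, reassoc_of% (hD.six_dot i j h X), hD.st_six_right j i h.symm,
      Preadditive.add_comp, Preadditive.comp_add]
    simp only [Preadditive.comp_add, Category.assoc, reassoc_of% hE2]
    rw [hA]
    simp only [Preadditive.add_comp, Preadditive.sub_comp, Linear.smul_comp, Category.assoc,
      Category.id_comp, reassoc_of% hE1, reassoc_of% hbb, reassoc_of% hb, Linear.comp_smul]
    simp only [br, Category.assoc]
    module
  rw [deform_six_up D t u h hij, deform_six_down D t u h.symm hij, hB]
  simp only [Linear.smul_comp, Preadditive.comp_sub, Preadditive.sub_comp, Linear.comp_smul,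
    Category.assoc, first, second]
  simp only [deform, Category.assoc]
  have hT : i ◂ (u (lo j) • D.en j (i ◃ X)) ≫ i ◂ ((1 - t * D.x (hi i)) • 𝟙 _)
      = i ◂ D.en j (i ◃ X) := by
    rw [← Functor.map_comp, lo_eq_hi hij, Linear.smul_comp, Linear.comp_smul, Category.comp_id,
      smul_smul, mul_comm, ht.inv, one_smul]
  have hT2 : i ◂ ((1 - t * D.x (lo i)) • 𝟙 (i ◃ X)) ≫ i ◂ (u (hi j) • D.st j (i ◃ X))
      = u (hi j) • ((1 - t * D.x (hi i)) • i ◂ D.st j (i ◃ X)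
        - t • D.br i (i ◃ X) ≫ i ◂ D.st j (i ◃ X)) := by
    rw [s1.map_smul, hD.force_v_lo ht]
    simp only [Preadditive.sub_comp, Linear.smul_comp, Linear.comp_smul, Category.id_comp, smul_sub]
  have hW : D.sp i X ≫ D.br i (i ◃ X) ≫ i ◂ D.st j (i ◃ X)
      = D.st j (i ◃ X) ≫ D.st i (j ◃ i ◃ X) := by
    rw [br, Category.assoc, reassoc_of% (hD.counit_left i X), D.st_nat]
  rw [reassoc_of% hT, hT2]
  simp only [Linear.comp_smul, Preadditive.comp_sub, hW]
  have i1 := ht.inv (lo i)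
  have i3 := ht.inv (hi j)
  linear_combination (norm := module) ((1 - t * D.x (lo i)) * u (lo i) * i3 + i1) • 𝟙 (i ◃ j ◃ i ◃ X)
    + (u (hi j) * (1 - t * D.x (hi i)) * i1) •
      i ◂ D.en j (i ◃ X) ≫ D.me i X ≫ D.sp i X ≫ i ◂ D.st j (i ◃ X)
    - (t * u (hi j) * i1) • i ◂ D.en j (i ◃ X) ≫ D.me i X ≫ D.st j (i ◃ X) ≫ D.st i (j ◃ i ◃ X)

/-- The same strategy as for `deform_six_six_up`, with the deformed vertex on top: the far right
factor now slides upwards through it. -/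
theorem deform_six_six_down (h : Adjacent j i) (X : C) :
    (D.deform t u).si j i h X ≫ (D.deform t u).si i j h.symm X
      = 𝟙 _ + j ◂ (D.deform t u).en i (j ◃ X) ≫ (D.deform t u).me j X ≫ (D.deform t u).sp j X
        ≫ j ◂ (D.deform t u).st i (j ◃ X) := by
  have s1 : Slides F j (u (lo i)) := hD.slides_six_u_lo ht hij
  have s2 : Slides F j (1 - t * D.x (lo i)) := hD.slides_six_v_lo ht hij
  have hA : i ◂ j ◂ ((1 - t * D.x (hi i)) • 𝟙 (i ◃ X))
      = i ◂ j ◂ i ◂ ((1 - t * D.x (lo i)) • 𝟙 X) + t • i ◂ j ◂ D.br i X := by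
    rw [hD.force_v_lo ht i, Functor.map_sub, Functor.map_sub, (ht.slides j).map_smul,
      (ht.slides i).map_smul, sub_add_cancel]
  have hv : j ◂ ((1 - t * D.x (hi i)) • 𝟙 (i ◃ j ◃ X))
      = (1 - t * D.x (hi j)) • 𝟙 _ - t • D.br j (i ◃ j ◃ X) := by
    rw [← lo_eq_hi hij, hD.force_v_lo ht]
  have hB : j ◂ i ◂ ((1 - t * D.x (hi i)) • 𝟙 (j ◃ X))
      = (1 - t * D.x (lo i)) • 𝟙 _ + t • j ◂ D.br i (j ◃ X) := by
    rw [hD.force_v_hi ht, Functor.map_add, s2, (ht.slides j).map_smul]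
  have hst : D.st j (j ◃ X) ≫ j ◂ D.st i (j ◃ X) = D.st i (j ◃ X) ≫ D.st j (i ◃ j ◃ X) :=
    (D.st_nat ..).symm
  have hK : D.sp j X ≫ j ◂ D.st i (j ◃ X) ≫ D.br j (i ◃ j ◃ X)
      = D.st i (j ◃ X) ≫ D.st j (i ◃ j ◃ X) := by
    rw [br, reassoc_of% (D.en_nat j (D.st i (j ◃ X))), reassoc_of% (hD.counit_left j X)]
  have first : D.si j i h X ≫ i ◂ j ◂ i ◂ ((1 - t * D.x (lo i)) • 𝟙 X) ≫ D.si i j h.symm X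
        ≫ j ◂ i ◂ ((1 - t * D.x (hi i)) • 𝟙 (j ◃ X))
      = (1 - t * D.x (lo i)) • ((1 - t * D.x (hi j)) • 𝟙 _ - t • D.br j (i ◃ j ◃ X)
        + (1 - t * D.x (hi j)) •
          j ◂ D.en i (j ◃ X) ≫ D.me j X ≫ D.sp j X ≫ j ◂ D.st i (j ◃ X)
        - t • j ◂ D.en i (j ◃ X) ≫ D.me j X ≫ D.st i (j ◃ X) ≫ D.st j (i ◃ j ◃ X)) := by
    have e : j ◂ i ◂ j ◂ ((1 - t * D.x (lo i)) • 𝟙 X)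
        ≫ j ◂ i ◂ ((1 - t * D.x (hi i)) • 𝟙 (j ◃ X))
        = (1 - t * D.x (lo i)) • ((1 - t * D.x (hi j)) • 𝟙 _ - t • D.br j (i ◃ j ◃ X)) := by
      rw [s2, ← Functor.map_comp, ← Functor.map_comp, Linear.smul_comp, Category.id_comp,
        smul_smul, hD.slides_vv ht i, mul_smul, s2.map_smul, hv]
    rw [reassoc_of% (D.si_nat i j h.symm _), e, reassoc_of% (hD.six_six j i h)]
    simp only [Linear.comp_smul, Preadditive.add_comp, Preadditive.comp_sub, Category.id_comp,
      Category.comp_id, Category.assoc, hK]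
    module
  have hS2 : D.sp j X ≫ j ◂ D.st i (j ◃ X) ≫ j ◂ i ◂ ((1 - t * D.x (hi i)) • 𝟙 (j ◃ X))
      = (1 - t * D.x (hi j)) • D.sp j X ≫ j ◂ D.st i (j ◃ X)
        - t • D.st i (j ◃ X) ≫ D.st j (i ◃ j ◃ X) := by
    rw [← Functor.map_comp, ← D.st_nat, Functor.map_comp, ← lo_eq_hi hij, hD.force_v_lo ht j]
    simp only [Preadditive.comp_sub, Preadditive.sub_comp, Linear.smul_comp, Linear.comp_smul,
      Category.id_comp, br, Category.assoc, reassoc_of% (hD.counit_left j X), hst]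
  have hS1 : D.st i (j ◃ X) ≫ D.st j (i ◃ j ◃ X) ≫ j ◂ i ◂ ((1 - t * D.x (hi i)) • 𝟙 (j ◃ X))
      = (1 - t * D.x (hi i)) • D.st i (j ◃ X) ≫ D.st j (i ◃ j ◃ X) := by
    rw [← D.st_nat, ← reassoc_of% (D.st_nat i ((1 - t * D.x (hi i)) • 𝟙 (j ◃ X))),
      Linear.smul_comp, Category.id_comp]
  have hb : D.st i (j ◃ X) ≫ D.en i (j ◃ X) = (D.x (lo i) - D.x (hi i)) • 𝟙 _ := hD.barbell ..
  have hZ : D.st j (i ◃ j ◃ X) ≫ j ◂ D.br i (j ◃ X) = D.br i (j ◃ X) ≫ D.st j (i ◃ j ◃ X) :=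
    (D.st_nat ..).symm
  have second : D.si j i h X ≫ i ◂ j ◂ D.br i X ≫ D.si i j h.symm X
        ≫ j ◂ i ◂ ((1 - t * D.x (hi i)) • 𝟙 (j ◃ X))
      = (1 - t * D.x (lo i)) • D.br j (i ◃ j ◃ X)
        + (1 - t * D.x (hi j)) • D.en j (i ◃ j ◃ X) ≫ D.en i (j ◃ X) ≫ D.sp j X
          ≫ j ◂ D.st i (j ◃ X)
        + (1 - t * D.x (hi i)) • j ◂ D.en i (j ◃ X) ≫ D.me j X ≫ D.st i (j ◃ X)
          ≫ D.st j (i ◃ j ◃ X)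
        + (D.x (lo i) - D.x (hi i)) • ((1 - t * D.x (hi j)) •
            j ◂ D.en i (j ◃ X) ≫ D.me j X ≫ D.sp j X ≫ j ◂ D.st i (j ◃ X)
          - t • j ◂ D.en i (j ◃ X) ≫ D.me j X ≫ D.st i (j ◃ X) ≫ D.st j (i ◃ j ◃ X)) := by
    have e0 : i ◂ j ◂ D.br i X = i ◂ j ◂ D.en i X ≫ i ◂ j ◂ D.st i X := by
      rw [br, Functor.map_comp, Functor.map_comp]
    rw [e0, Category.assoc, reassoc_of% (hD.six_dot j i h X),
      reassoc_of% (hD.st_six_right i j h.symm X)]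
    simp only [Preadditive.comp_add, Preadditive.add_comp, Category.assoc, hS2, hS1,
      reassoc_of% hb]
    rw [hB]
    simp only [Preadditive.comp_add, Preadditive.comp_sub, Linear.smul_comp, Category.comp_id,
      Category.id_comp, hZ, Linear.comp_smul]
    simp only [br, Category.assoc]
    module
  rw [deform_six_up D t u h.symm hij, deform_six_down D t u h hij, hA]
  simp only [Linear.comp_smul, Preadditive.comp_add, Preadditive.add_comp, Linear.smul_comp,
    first, second]
  simp only [deform, Category.assoc]
  have hT : j ◂ ((1 - t * D.x (lo j)) • 𝟙 (j ◃ X)) ≫ j ◂ (u (hi i) • D.st i (j ◃ X))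
      = j ◂ D.st i (j ◃ X) := by
    rw [← Functor.map_comp, lo_eq_hi hij, Linear.smul_comp, Category.id_comp, smul_smul, ht.inv,
      one_smul]
  have hW : j ◂ D.en i (j ◃ X) ≫ D.br j (j ◃ X) ≫ D.me j X
      = D.en j (i ◃ j ◃ X) ≫ D.en i (j ◃ X) := by
    rw [br, Category.assoc, hD.unit_left, Category.comp_id, D.en_nat]
  have hT2 : j ◂ (u (lo i) • D.en i (j ◃ X)) ≫ j ◂ ((1 - t * D.x (hi j)) • 𝟙 _) ≫ D.me j X
      = u (lo i) • ((1 - t * D.x (hi i)) • j ◂ D.en i (j ◃ X) ≫ D.me j X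
        + t • D.en j (i ◃ j ◃ X) ≫ D.en i (j ◃ X)) := by
    rw [s1.map_smul, hD.force_v_hi ht, lo_eq_hi hij]
    simp only [Preadditive.add_comp, Preadditive.comp_add, Linear.smul_comp, Linear.comp_smul,
      Category.id_comp, hW]
    module
  rw [hT, reassoc_of% hT2]
  simp only [Linear.smul_comp, Preadditive.add_comp, Category.assoc]
  have i1 := ht.inv (lo i)
  have i3 := ht.inv (hi j)
  linear_combination (norm := module) ((1 - t * D.x (lo i)) * u (lo i) * i3 + i1) • 𝟙 (j ◃ i ◃ j ◃ X)
    + (u (lo i) * (1 - t * D.x (hi i)) * i3) •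
      j ◂ D.en i (j ◃ X) ≫ D.me j X ≫ D.sp j X ≫ j ◂ D.st i (j ◃ X)
    + (t * u (lo i) * i3) • D.en j (i ◃ j ◃ X) ≫ D.en i (j ◃ X) ≫ D.sp j X ≫ j ◂ D.st i (j ◃ X)

end IsModel

end DiagAction

end DiagAction

end HeckeDiag


/-! ### The full set of relations for both deformations, the Zamolodchikov relation by a half turn.
-/

namespace HeckeDiag

open CategoryTheory

section DiagAction

variable {n : ℕ} {R : Type*} [CommRing R] {C : Type*} [Category C] [Preadditive C] [Linear R C]
  {F : Color n → C ⥤ C}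

local notation:91 i:92 " ◃ " X:91 => CategoryTheory.Functor.obj (F i) X
local notation:91 i:92 " ◂ " f:91 => CategoryTheory.Functor.map (F i) f

namespace DiagAction

variable [∀ i, (F i).Additive] {D : DiagAction R F} {t : R} {u : Fin n → R}

/-- The exponential deformation satisfies the local relations. -/
theorem IsModel.deform_isModel (hD : D.IsModel) (ht : D.IsAdmissible t u) :
    (D.deform t u).IsModel where
  merge_assoc := hD.deform_merge_assoc ht
  split_coassoc := hD.deform_split_coassoc ht
  frobenius_left := hD.deform_frobenius_left ht
  frobenius_right := hD.deform_frobenius_right ht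
  unit_left := hD.deform_unit_left ht
  unit_right := hD.deform_unit_right ht
  counit_left := hD.deform_counit_left ht
  counit_right := hD.deform_counit_right ht
  needle := hD.deform_needle ht
  barbell := hD.deform_barbell ht
  force_lo := hD.deform_force_lo ht
  force_hi := hD.deform_force_hi ht
  force_other := hD.deform_force_other ht
  cross_rotate := hD.deform_cross_rotate ht
  cross_cross := hD.cross_cross
  cross_dot := hD.deform_cross_dot ht
  cross_merge := hD.deform_cross_merge ht
  six_rotate i j h X := by
    rcases h with hij | hij
    · exact hD.deform_six_rotate_up ht hij (Or.inl hij) X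
    · exact hD.deform_six_rotate_down ht hij (Or.inr hij) X
  six_dot i j h X := by
    rcases h with hij | hij
    · exact hD.deform_six_dot_up ht hij (Or.inl hij) X
    · exact hD.deform_six_dot_down ht hij (Or.inr hij) X
  six_six i j h X := by
    rcases h with hij | hij
    · exact hD.deform_six_six_up ht hij (Or.inl hij) X
    · exact hD.deform_six_six_down ht hij (Or.inr hij) X
  six_merge i j h X := by
    rcases h with hij | hij
    · exact hD.deform_six_merge_up ht hij (Or.inl hij) X
    · exact hD.deform_six_merge_down ht hij (Or.inr hij) X
  three_distant := hD.three_distant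
  six_distant i j k h hik hjk X := by
    rcases h with hij | hij
    · exact hD.deform_six_distant_up ht hij k (Or.inl hij) hik hjk X
    · have h : Adjacent i j := Or.inr hij
      change _ ≫ _ ≫ _ ≫ k ◂ (D.deform t u).si i j h X = (D.deform t u).si i j h (k ◃ X) ≫ _
      rw [deform_six_down D t u h hij, deform_six_down D t u h hij]
      exact hD.six_distant i j k h hik hjk X

/-! ### Half-turn rotation of diagrams -/

/-- A pair of functors with a natural pairing `L (L' X) ⟶ X`. -/
structure Pairing (C : Type*) [Category C] where
  L : C ⥤ C
  L' : C ⥤ C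
  c : L' ⋙ L ⟶ 𝟭 C

namespace Pairing

/-- The pairing is nondegenerate. -/
def Faithful (P : Pairing C) : Prop :=
  ∀ ⦃Y X : C⦄ (f g : Y ⟶ P.L'.obj X),
    P.L.map f ≫ P.c.app X = P.L.map g ≫ P.c.app X → f = g

/-- The transformations `f` and `g` are rotations of each other. -/
def Mate (P Q : Pairing C) (f : P.L ⟶ Q.L) (g : Q.L' ⟶ P.L') : Prop :=
  ∀ X : C, f.app (Q.L'.obj X) ≫ Q.c.app X = P.L.map (g.app X) ≫ P.c.app X

theorem Mate.comp {P Q S : Pairing C} {f : P.L ⟶ Q.L} {g : Q.L' ⟶ P.L'} {f' : Q.L ⟶ S.L}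
    {g' : S.L' ⟶ Q.L'} (h : Mate P Q f g) (h' : Mate Q S f' g') :
    Mate P S (f ≫ f') (g' ≫ g) := fun X => by
  rw [NatTrans.comp_app, Category.assoc, h' X, ← NatTrans.naturality_assoc, h X,
    NatTrans.comp_app, Functor.map_comp_assoc]

/-- For a nondegenerate pairing a mate is determined by its partner. Hence an equation between two
composites implies the equation between their half turns. -/
theorem Mate.app_eq {P Q : Pairing C} (hP : P.Faithful) {f f' : P.L ⟶ Q.L} {g g' : Q.L' ⟶ P.L'}
    (h : Mate P Q f g) (h' : Mate P Q f' g') (hf : ∀ X, f.app X = f'.app X) (X : C) :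
    g.app X = g'.app X := by
  refine hP _ _ ((h X).symm.trans (Eq.trans ?_ (h' X)))
  rw [hf]

variable (C) in
/-- The pairing of the identity functor with itself. -/
def one : Pairing C := ⟨𝟭 C, 𝟭 C, 𝟙 _⟩

theorem one_faithful : (one C).Faithful := fun Y X f g h =>
  (Category.comp_id (X := Y) (Y := X) f).symm.trans (h.trans (Category.comp_id (X := Y) (Y := X) g))

variable (D) in
/-- Extending a pairing by nested caps. -/
def cons (i : Color n) (P : Pairing C) : Pairing C where
  L := P.L ⋙ F i
  L' := F i ⋙ P.L'
  c :=
    { app := fun X => i ◂ P.c.app (i ◃ X) ≫ D.cap i X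
      naturality := fun X Y f => by
        have h := P.c.naturality (i ◂ f)
        simp only [Functor.comp_map, Functor.id_map] at h ⊢
        rw [Category.assoc, ← D.cap_nat i f, ← Functor.map_comp_assoc, h, Functor.map_comp,
          Category.assoc] }

/-- The cup undoes the new outer cap by a zigzag, so a map into a strand can be recovered from its
capped version. -/
theorem cons_faithful (hD : D.IsModel) {P : Pairing C} (hP : P.Faithful) (i : Color n) :
    (cons D i P).Faithful := fun Y X (f : Y ⟶ P.L'.obj (i ◃ X)) (g : Y ⟶ P.L'.obj (i ◃ X)) h => by
  have key : ∀ {Z : C} (a : Z ⟶ i ◃ X), a = D.cup i Z ≫ i ◂ (i ◂ a ≫ D.cap i X) := by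
    intro Z a
    rw [Functor.map_comp, ← reassoc_of% (D.cup_nat i a), hD.cap_snake_right, Category.comp_id]
  have h' : i ◂ (P.L.map f ≫ P.c.app (i ◃ X)) ≫ D.cap i X
      = i ◂ (P.L.map g ≫ P.c.app (i ◃ X)) ≫ D.cap i X := by
    rw [Functor.map_comp_assoc, Functor.map_comp_assoc]
    exact h
  refine hP (X := i ◃ X) f g ?_
  exact (key _).trans ((congrArg (fun a => D.cup i _ ≫ i ◂ a) h').trans (key _).symm)

theorem Mate.cons {P Q : Pairing C} {f : P.L ⟶ Q.L} {g : Q.L' ⟶ P.L'} (h : Mate P Q f g)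
    (i : Color n) :
    Mate (cons D i P) (cons D i Q) (Functor.whiskerRight f (F i)) (Functor.whiskerLeft (F i) g) :=
  fun X => by
    change i ◂ f.app (Q.L'.obj (i ◃ X)) ≫ i ◂ Q.c.app (i ◃ X) ≫ D.cap i X
      = i ◂ P.L.map (g.app (i ◃ X)) ≫ i ◂ P.c.app (i ◃ X) ≫ D.cap i X
    rw [← Functor.map_comp_assoc, h (i ◃ X), Functor.map_comp, Category.assoc]

end Pairing

open Pairing

/-- The half turn consists of two one-click rotations, each moving one leg of the vertex around a
cap. -/
theorem IsModel.cross_half_turn (hD : D.IsModel) (i j : Color n) (h : Distant i j) (X : C) :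
    D.cr i j h (i ◃ j ◃ X) ≫ j ◂ D.cap i (j ◃ X) ≫ D.cap j X
      = i ◂ j ◂ D.cr i j h X ≫ i ◂ D.cap j (i ◃ X) ≫ D.cap i X := by
  have e (i j : Color n) (h : Distant i j) (X : C) :
      j ◂ D.cr i j h X ≫ D.cap j (i ◃ X) = D.cr j i h.symm (j ◃ X) ≫ i ◂ D.cap j X := by
    rw [← hD.cross_rotate j i h.symm]
    simp only [Functor.map_comp, Category.assoc]
    rw [D.cap_nat, reassoc_of% (D.cap_nat j (D.cr j i h.symm (j ◃ X))),
      reassoc_of% (hD.cap_snake_left j (i ◃ j ◃ X))]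
  rw [← Functor.map_comp_assoc, e, Functor.map_comp_assoc, D.cap_nat, reassoc_of% (e j i h.symm _)]

/-- A half turn of a hexavalent vertex is three one-click rotations. Each exchanges the two colors,
so `six i j` is turned into `six j i`. This exchange replaces deformed vertices by undeformed ones.
-/
theorem IsModel.six_half_turn (hD : D.IsModel) (i j : Color n) (h : Adjacent i j) (X : C) :
    D.si i j h (j ◃ i ◃ j ◃ X) ≫ j ◂ i ◂ D.cap j (i ◃ j ◃ X) ≫ j ◂ D.cap i (j ◃ X) ≫ D.cap j X
      = i ◂ j ◂ i ◂ D.si j i h.symm X ≫ i ◂ j ◂ D.cap i (j ◃ i ◃ X) ≫ i ◂ D.cap j (i ◃ X)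
        ≫ D.cap i X := by
  have e (i j : Color n) (h : Adjacent i j) (X : C) :
      j ◂ D.si i j h X ≫ D.cap j (i ◃ j ◃ X) = D.si j i h.symm (i ◃ X) ≫ i ◂ j ◂ D.cap i X := by
    rw [← hD.six_rotate j i h.symm]
    simp only [Functor.map_comp, Category.assoc]
    rw [D.cap_nat, reassoc_of% (D.cap_nat j (D.si j i h.symm (i ◃ X))),
      reassoc_of% (hD.cap_snake_left j (i ◃ j ◃ i ◃ X))]
  have e1 : i ◂ j ◂ i ◂ D.si j i h.symm X ≫ i ◂ j ◂ D.cap i (j ◃ i ◃ X)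
      = i ◂ j ◂ D.si i j h (j ◃ X) ≫ i ◂ j ◂ j ◂ i ◂ D.cap j X := by
    rw [← Functor.map_comp, ← Functor.map_comp, e j i h.symm, Functor.map_comp, Functor.map_comp]
  have e2 : i ◂ j ◂ D.si i j h (j ◃ X) ≫ i ◂ D.cap j (i ◃ j ◃ j ◃ X)
      = i ◂ D.si j i h.symm (i ◃ j ◃ X) ≫ i ◂ i ◂ j ◂ D.cap i (j ◃ X) := by
    rw [← Functor.map_comp, e, Functor.map_comp]
  rw [reassoc_of% e1, ← Functor.map_comp_assoc (F i) (j ◂ j ◂ i ◂ D.cap j X), D.cap_nat,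
    Functor.map_comp_assoc, reassoc_of% e2, D.cap_nat, reassoc_of% (D.cap_nat i (j ◂ D.cap i (j ◃ X))),
    reassoc_of% (e j i h.symm (i ◃ j ◃ X))]

variable (D) in
/-- The 4-valent vertex as a natural transformation. -/
def crTrans (i j : Color n) (h : Distant i j) : F j ⋙ F i ⟶ F i ⋙ F j where
  app X := D.cr i j h X
  naturality _ _ f := D.cr_nat i j h f

variable (D) in
/-- The 6-valent vertex as a natural transformation. -/
def siTrans (i j : Color n) (h : Adjacent i j) : F i ⋙ F j ⋙ F i ⟶ F j ⋙ F i ⋙ F j where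
  app X := D.si i j h X
  naturality _ _ f := D.si_nat i j h f

theorem IsModel.mate_cross (hD : D.IsModel) (i j : Color n) (h : Distant i j) (P : Pairing C) :
    Mate (cons D i (cons D j P)) (cons D j (cons D i P))
      (Functor.whiskerLeft P.L (D.crTrans i j h)) (Functor.whiskerRight (D.crTrans i j h) P.L') :=
  fun X => by
    change D.cr i j h (P.L.obj (P.L'.obj (i ◃ j ◃ X)))
        ≫ j ◂ (i ◂ P.c.app (i ◃ j ◃ X) ≫ D.cap i (j ◃ X)) ≫ D.cap j X
      = i ◂ j ◂ P.L.map (P.L'.map (D.cr i j h X))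
        ≫ i ◂ (j ◂ P.c.app (j ◃ i ◃ X) ≫ D.cap j (i ◃ X)) ≫ D.cap i X
    have h1 : P.L.map (P.L'.map (D.cr i j h X)) ≫ P.c.app (j ◃ i ◃ X)
      = P.c.app (i ◃ j ◃ X) ≫ D.cr i j h X := P.c.naturality (D.cr i j h X)
    have h2 : i ◂ j ◂ P.L.map (P.L'.map (D.cr i j h X)) ≫ i ◂ j ◂ P.c.app (j ◃ i ◃ X)
        = i ◂ j ◂ P.c.app (i ◃ j ◃ X) ≫ i ◂ j ◂ D.cr i j h X := by
      rw [← Functor.map_comp, ← Functor.map_comp, h1, Functor.map_comp, Functor.map_comp]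
    rw [Functor.map_comp, Functor.map_comp, Category.assoc, Category.assoc, reassoc_of% h2,
      ← hD.cross_half_turn]
    exact ((reassoc_of% (D.cr_nat i j h (P.c.app (i ◃ j ◃ X)))) (j ◂ D.cap i (j ◃ X) ≫ D.cap j X)).symm

theorem IsModel.mate_six (hD : D.IsModel) (i j : Color n) (h : Adjacent i j) (P : Pairing C) :
    Mate (cons D i (cons D j (cons D i P))) (cons D j (cons D i (cons D j P)))
      (Functor.whiskerLeft P.L (D.siTrans i j h))
      (Functor.whiskerRight (D.siTrans j i h.symm) P.L') :=
  fun X => by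
    change D.si i j h (P.L.obj (P.L'.obj (j ◃ i ◃ j ◃ X)))
        ≫ j ◂ (i ◂ (j ◂ P.c.app (j ◃ i ◃ j ◃ X) ≫ D.cap j (i ◃ j ◃ X)) ≫ D.cap i (j ◃ X))
          ≫ D.cap j X
      = i ◂ j ◂ i ◂ P.L.map (P.L'.map (D.si j i h.symm X))
        ≫ i ◂ (j ◂ (i ◂ P.c.app (i ◃ j ◃ i ◃ X) ≫ D.cap i (j ◃ i ◃ X)) ≫ D.cap j (i ◃ X))
          ≫ D.cap i X
    have h1 : P.L.map (P.L'.map (D.si j i h.symm X)) ≫ P.c.app (i ◃ j ◃ i ◃ X)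
      = P.c.app (j ◃ i ◃ j ◃ X) ≫ D.si j i h.symm X := P.c.naturality (D.si j i h.symm X)
    have h2 : i ◂ j ◂ i ◂ P.L.map (P.L'.map (D.si j i h.symm X))
          ≫ i ◂ j ◂ i ◂ P.c.app (i ◃ j ◃ i ◃ X)
        = i ◂ j ◂ i ◂ P.c.app (j ◃ i ◃ j ◃ X) ≫ i ◂ j ◂ i ◂ D.si j i h.symm X := by
      simp only [← Functor.map_comp]
      rw [h1]
    simp only [Functor.map_comp, Category.assoc]
    rw [reassoc_of% h2, ← hD.six_half_turn i j h]
    exact ((reassoc_of% (D.si_nat i j h (P.c.app (j ◃ i ◃ j ◃ X)))) (j ◂ i ◂ D.cap j (i ◃ j ◃ X)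
      ≫ j ◂ D.cap i (j ◃ X) ≫ D.cap j X)).symm

variable (D) in
/-- The half-turn of the Zamolodchikov relation. -/
def RotatedZamolodchikov : Prop :=
  ∀ (i j k : Color n) (hij : Adjacent i j) (hjk : Adjacent j k) (hik : Distant i k),
    i.val + 1 = j.val → j.val + 1 = k.val → ∀ X : C,
    k ◂ j ◂ i ◂ D.si k j hjk.symm X ≫ k ◂ D.si j i hij.symm (k ◃ j ◃ X)
        ≫ k ◂ i ◂ j ◂ D.cr i k hik (j ◃ X) ≫ D.cr k i hik.symm (j ◃ k ◃ i ◃ j ◃ X)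
        ≫ i ◂ D.si k j hjk.symm (i ◃ j ◃ X) ≫ i ◂ j ◂ k ◂ D.si j i hij.symm X
      = k ◂ j ◂ D.cr i k hik (j ◃ k ◃ X) ≫ D.si k j hjk.symm (i ◃ j ◃ k ◃ X)
        ≫ j ◂ k ◂ D.si j i hij.symm (k ◃ X) ≫ j ◂ D.cr k i hik.symm (j ◃ i ◃ k ◃ X)
        ≫ j ◂ i ◂ k ◂ j ◂ D.cr i k hik X ≫ j ◂ i ◂ D.si k j hjk.symm (i ◃ X)
        ≫ D.si j i hij.symm (k ◃ j ◃ i ◃ X) ≫ i ◂ j ◂ D.cr i k hik (j ◃ i ◃ X)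

/-- Each side of the relation is a composite of whiskered vertices. Its mate is the composite of the
individual mates in reverse order, and `Mate.app_eq` compares the two sides. -/
theorem IsModel.rotatedZamolodchikov (hD : D.IsModel) (hZ : D.Zamolodchikov) :
    D.RotatedZamolodchikov := by
  intro i j k hij hjk hik h1 h2 X
  have hl := (hD.mate_six i j hij (cons D k (cons D j (cons D i (one C))))).comp <|
    (((hD.mate_six j k hjk (cons D i (one C))).cons i).cons j).comp <|
    (((((hD.mate_cross k i hik.symm (one C)).cons j).cons k).cons i).cons j).comp <|
    ((hD.mate_cross i k hik (cons D j (cons D i (cons D k (one C))))).cons j).comp <|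
    (((hD.mate_six i j hij (cons D k (one C))).cons k).cons j).comp <|
    hD.mate_six j k hjk (cons D i (cons D j (cons D k (one C))))
  have hr := (((hD.mate_cross i k hik (cons D j (cons D i (one C)))).cons j).cons i).comp <|
    ((((hD.mate_six i j hij (one C)).cons k).cons j).cons i).comp <|
    ((hD.mate_six j k hjk (cons D i (cons D j (one C)))).cons i).comp <|
    (hD.mate_cross i k hik (cons D j (cons D k (cons D i (cons D j (one C)))))).comp <|
    ((((hD.mate_cross k i hik.symm (cons D j (one C))).cons j).cons i).cons k).comp <|
    ((hD.mate_six i j hij (cons D k (cons D j (one C)))).cons k).comp <|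
    ((((hD.mate_six j k hjk (one C)).cons i).cons j).cons k).comp <|
    ((hD.mate_cross i k hik (cons D j (cons D k (one C)))).cons j).cons k
  have hf : (cons D i (cons D j (cons D i (cons D k (cons D j (cons D i (one C))))))).Faithful := by
    iterate 6 refine cons_faithful hD ?_ _
    exact one_faithful
  have key := Mate.app_eq hf hl hr (fun X => hZ i j k hij hjk hik h1 h2 X) X
  -- Mates reverse composition and hence bracket the factors to the left. Up to reassociation the
  -- two statements agree by definition.
  refine Eq.trans ?_ (Eq.trans key ?_) <;> (simp only [← Category.assoc]; rfl)

theorem IsModel.zamolodchikov_of_rotated (hD : D.IsModel) (hZ : D.RotatedZamolodchikov) :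
    D.Zamolodchikov := by
  intro i j k hij hjk hik h1 h2 X
  have hl := ((((hD.mate_six k j hjk.symm (one C)).cons i).cons j).cons k).comp <|
    ((hD.mate_six j i hij.symm (cons D k (cons D j (one C)))).cons k).comp <|
    ((((hD.mate_cross i k hik (cons D j (one C))).cons j).cons i).cons k).comp <|
    (hD.mate_cross k i hik.symm (cons D j (cons D k (cons D i (cons D j (one C)))))).comp <|
    ((hD.mate_six k j hjk.symm (cons D i (cons D j (one C)))).cons i).comp <|
    (((hD.mate_six j i hij.symm (one C)).cons k).cons j).cons i
  have hr := (((hD.mate_cross i k hik (cons D j (cons D k (one C)))).cons j).cons k).comp <|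
    (hD.mate_six k j hjk.symm (cons D i (cons D j (cons D k (one C))))).comp <|
    (((hD.mate_six j i hij.symm (cons D k (one C))).cons k).cons j).comp <|
    ((hD.mate_cross k i hik.symm (cons D j (cons D i (cons D k (one C))))).cons j).comp <|
    (((((hD.mate_cross i k hik (one C)).cons j).cons k).cons i).cons j).comp <|
    (((hD.mate_six k j hjk.symm (cons D i (one C))).cons i).cons j).comp <|
    (hD.mate_six j i hij.symm (cons D k (cons D j (cons D i (one C))))).comp <|
    ((hD.mate_cross i k hik (cons D j (cons D i (one C)))).cons j).cons i
  have hf : (cons D k (cons D j (cons D i (cons D k (cons D j (cons D k (one C))))))).Faithful := by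
    iterate 6 refine cons_faithful hD ?_ _
    exact one_faithful
  have key := Mate.app_eq hf hl hr (fun X => hZ i j k hij hjk hik h1 h2 X) X
  refine Eq.trans ?_ (Eq.trans key ?_) <;> (simp only [← Category.assoc]; rfl)

/-- The exponential deformation satisfies the Zamolodchikov relation. -/
theorem IsModel.deform_zamolodchikov (hD : D.IsModel) (ht : D.IsAdmissible t u)
    (hZ : D.Zamolodchikov) : (D.deform t u).Zamolodchikov := by
  -- The rotated relation contains only vertices with source (i+1, i, i+1) and 4-valent vertices,
  -- all untouched by the deformation, so it is literally the rotated relation of the original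
  -- action.
  refine (hD.deform_isModel ht).zamolodchikov_of_rotated ?_
  intro i j k hij hjk hik h1 h2 X
  rw [deform_six_down D t u hjk.symm h2, deform_six_down D t u hij.symm h1,
    deform_six_down D t u hjk.symm h2, deform_six_down D t u hij.symm h1,
    deform_six_down D t u hjk.symm h2, deform_six_down D t u hij.symm h1,
    deform_six_down D t u hjk.symm h2, deform_six_down D t u hij.symm h1]
  exact hD.rotatedZamolodchikov hZ i j k hij hjk hik h1 h2 X

/-! ### The deformation by translation of the variables -/

variable (D) in
/-- The deformation along the exponential of the lowering operator. -/
def translate (t : R) : DiagAction R F :=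
  { D with x := fun j => D.x j + t }

/-- Only the relations that mention variables need an argument. The barbell sees a difference of two
variables, and in the forcing relations the added t slides through the strand. -/
theorem IsModel.translate_isModel (hD : D.IsModel) (ht : ∀ i, Slides F i t) :
    (D.translate t).IsModel :=
  { hD with
    barbell := fun i X => by
      rw [show (D.translate t).x (lo i) - (D.translate t).x (hi i) = D.x (lo i) - D.x (hi i) from
        add_sub_add_right_eq_sub _ _ _]
      exact hD.barbell i X
    force_lo := fun i X => by
      change i ◂ ((D.x (lo i) + t) • 𝟙 X) = (D.x (hi i) + t) • 𝟙 _ + D.br i X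
      rw [add_smul, Functor.map_add, hD.force_lo, ht i, add_smul, add_right_comm]
    force_hi := fun i X => by
      change i ◂ ((D.x (hi i) + t) • 𝟙 X) = (D.x (lo i) + t) • 𝟙 _ - D.br i X
      rw [add_smul, Functor.map_add, hD.force_hi, ht i, add_smul, sub_add_eq_add_sub]
    force_other := fun i j X hlo hhi => (hD.slides_other i j hlo hhi).add (ht i) X }

end DiagAction

end DiagAction

end HeckeDiag


namespace HeckeDiag

open CategoryTheory

/-! ### Evaluation of formal expressions in power series -/

section Eval

variable {n : ℕ}

namespace HomSeries

theorem eq_of_tensor_unit {a b : Word n} {f g : HomSeries a b}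
    (h : f.tensor (id []) (s := a ++ []) (t := b ++ []) rfl rfl = g.tensor (id []) rfl rfl) :
    f = g := by
  -- The words a ++ [] and a are equal but not by definition; freeing source and target permits
  -- specialising to a and b, where the right unit law is stated.
  have key : ∀ (s t : Word n) (hs : s = a ++ []) (ht : t = b ++ []),
      f.tensor (id []) hs ht = g.tensor (id []) hs ht := by
    rintro s t rfl rfl
    exact h
  have h2 := key a b (List.append_nil a).symm (List.append_nil b).symm
  rwa [tensor_unit, tensor_unit] at h2

end HomSeries

theorem SeriesCat.strand_strand (i j : Color n) {q r : SeriesCat n} (f : q ⟶ r) :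
    (strand i).map ((strand j).map f)
      = (HomSeries.id [i, j]).tensor (c := q) (d := r) f rfl rfl := by
  have h := HomSeries.tensor_assoc (HomSeries.id [i]) (HomSeries.id [j]) f (ab := [i, j])
    (ab' := [i, j]) (s := i :: j :: q) (t := i :: j :: r) rfl rfl rfl rfl rfl rfl rfl rfl
  rw [HomSeries.tensor_id] at h
  exact h.symm

theorem SeriesCat.strand_strand_strand (i j k : Color n) {q r : SeriesCat n} (f : q ⟶ r) :
    (strand i).map ((strand j).map ((strand k).map f))
      = (HomSeries.id [i, j, k]).tensor (c := q) (d := r) f rfl rfl := by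
  have h := HomSeries.tensor_assoc (HomSeries.id [i, j]) (HomSeries.id [k]) f (ab := [i, j, k])
    (ab' := [i, j, k]) (s := i :: j :: k :: q) (t := i :: j :: k :: r) rfl rfl rfl rfl rfl rfl rfl
    rfl
  rw [HomSeries.tensor_id] at h
  rw [strand_strand]
  exact h.symm

namespace HomSeries

theorem tensor_id_natural {a b q r : Word n} (g : HomSeries a b) (f : HomSeries q r) :
    ((id a).tensor f rfl rfl).comp (g.tensor (id r) rfl rfl)
      = (g.tensor (id q) rfl rfl).comp ((id b).tensor f rfl rfl) := by
  rw [← interchange, ← interchange]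
  simp only [id_comp, comp_id]

theorem tensor_id_comp_natural {a q r : Word n} (g : HomSeries a []) (f : HomSeries q r) :
    ((id a).tensor f rfl rfl).comp (g.tensor (id r) rfl rfl) = (g.tensor (id q) rfl rfl).comp f := by
  have h1 := interchange (id a) g f (id r) (s := a ++ q) (m := a ++ r) (t := r) rfl rfl rfl
  have h2 := interchange g (id []) (id q) f (s := a ++ q) (m := q) (t := r) rfl rfl rfl
  rw [comp_id, id_comp] at h1 h2
  rw [unit_tensor] at h2
  exact h1.symm.trans h2

theorem comp_tensor_id_natural {b q r : Word n} (g : HomSeries [] b) (f : HomSeries q r) :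
    f.comp (g.tensor (id r) rfl rfl) = (g.tensor (id q) rfl rfl).comp ((id b).tensor f rfl rfl) := by
  have h1 := interchange (id []) g f (id r) (s := q) (m := r) (t := b ++ r) rfl rfl rfl
  have h2 := interchange g (id b) (id q) f (s := q) (m := b ++ q) (t := b ++ r) rfl rfl rfl
  rw [comp_id, id_comp] at h1 h2
  rw [unit_tensor] at h1
  exact h1.symm.trans h2

end HomSeries

variable (val : ∀ a b : Word n, Gen n a b → HomSeries a b)

/-- The value of a formal expression, given the values of the generators. -/
def Term.eval {a b : Word n} : Term n a b → HomSeries a b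
  | .of g => val _ _ g
  | .id a => HomSeries.id a
  | .comp f g => (eval f).comp (eval g)
  | .tensor f g hs ht => (eval f).tensor (eval g) hs ht
  | .zero => 0
  | .add f g => eval f + eval g
  | .neg f => -eval f

/-- The action of the generating diagrams on the category of power series determined by their
values. -/
def DiagAction.ofVal : DiagAction (PolySeries n) (SeriesCat.strand (n := n)) where
  x j := val _ _ (.box j)
  en i q := (val _ _ (.enddot i)).tensor (c := q) (HomSeries.id q) rfl rfl
  st i q := (val _ _ (.startdot i)).tensor (c := q) (HomSeries.id q) rfl rfl
  me i q := (val _ _ (.merge i)).tensor (c := q) (HomSeries.id q) rfl rfl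
  sp i q := (val _ _ (.split i)).tensor (c := q) (HomSeries.id q) rfl rfl
  cr i j h q := (val _ _ (.cross i j h)).tensor (c := q) (HomSeries.id q) rfl rfl
  si i j h q := (val _ _ (.six i j h)).tensor (c := q) (HomSeries.id q) rfl rfl
  en_nat i q r f := HomSeries.tensor_id_comp_natural (val _ _ (.enddot i)) f
  st_nat i q r f := HomSeries.comp_tensor_id_natural (val _ _ (.startdot i)) f
  me_nat i q r f := by
    rw [SeriesCat.strand_strand]
    exact HomSeries.tensor_id_natural (val _ _ (.merge i)) f
  sp_nat i q r f := by
    rw [SeriesCat.strand_strand]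
    exact HomSeries.tensor_id_natural (val _ _ (.split i)) f
  cr_nat i j h q r f := by
    rw [SeriesCat.strand_strand, SeriesCat.strand_strand]
    exact HomSeries.tensor_id_natural (val _ _ (.cross i j h)) f
  si_nat i j h q r f := by
    rw [SeriesCat.strand_strand_strand, SeriesCat.strand_strand_strand]
    exact HomSeries.tensor_id_natural (val _ _ (.six i j h)) f

/-- The values of the generators satisfy the local relations. -/
def RespectsLocalRel : Prop :=
  ∀ {a b : Word n} {f g : Term n a b}, LocalRel n f g → f.eval val = g.eval val

variable {val}

/-- The morphism `φ` is the value of the formal expression `T` with strands `q` on the right. -/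
structure IsValue (val : ∀ a b : Word n, Gen n a b → HomSeries a b) {a b : Word n} (T : Term n a b)
    (q : Word n) {X Y : SeriesCat n} (φ : X ⟶ Y) (hX : X = a ++ q) (hY : Y = b ++ q) : Prop where
  eq : φ = (T.eval val).tensor (HomSeries.id q) hX hY

namespace IsValue

variable {a b c s t q : Word n} {X Y Z : SeriesCat n}

/-- The statements of this group are inference rules. Read backwards, they match a formal expression
with the corresponding composite of natural transformations, the strands q on the right being the
object to which these are applied. -/
theorem comp {f : Term n a b} {g : Term n b c} {φ : X ⟶ Y} {ψ : Y ⟶ Z} {hX : X = a ++ q}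
    {hZ : Z = c ++ q} (hY : Y = b ++ q) (hf : IsValue val f q φ hX hY)
    (hg : IsValue val g q ψ hY hZ) : IsValue val (f.comp g) q (φ ≫ ψ) hX hZ := by
  have h := HomSeries.interchange (f.eval val) (g.eval val) (HomSeries.id q) (HomSeries.id q)
    hX hY hZ
  rw [HomSeries.id_comp] at h
  exact ⟨(congrArg₂ HomSeries.comp hf.eq hg.eq).trans h.symm⟩

theorem comp_assoc {d : Word n} {f : Term n a b} {g : Term n b c} {k : Term n c d} {φ : X ⟶ Y}
    {hX : X = a ++ q} {hY : Y = d ++ q} (h : IsValue val (f.comp (g.comp k)) q φ hX hY) :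
    IsValue val ((f.comp g).comp k) q φ hX hY := by
  refine ⟨h.eq.trans ?_⟩
  rw [Term.eval, Term.eval, Term.eval, Term.eval, HomSeries.comp_assoc]

theorem right {f : Term n a b} {φ : X ⟶ Y} {hs : s = a ++ c} {ht : t = b ++ c} {hX : X = s ++ q}
    {hY : Y = t ++ q} (hX' : X = a ++ (c ++ q)) (hY' : Y = b ++ (c ++ q))
    (h : IsValue val f (c ++ q) φ hX' hY') :
    IsValue val (f.tensor (.id c) hs ht) q φ hX hY := by
  have h2 := HomSeries.tensor_assoc (f.eval val) (HomSeries.id c) (HomSeries.id q) hs ht hX hY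
    rfl rfl hX' hY'
  rw [HomSeries.tensor_id] at h2
  exact ⟨h.eq.trans h2.symm⟩

theorem left {f : Term n a b} {i : Color n} {φ : X ⟶ Y} {hs : s = [i] ++ a} {ht : t = [i] ++ b}
    {hX : (SeriesCat.strand i).obj X = s ++ q} {hY : (SeriesCat.strand i).obj Y = t ++ q}
    (hX' : X = a ++ q) (hY' : Y = b ++ q) (h : IsValue val f q φ hX' hY') :
    IsValue val ((Term.id [i]).tensor f hs ht) q ((SeriesCat.strand i).map φ) hX hY := by
  subst hX' hY'
  have h2 := HomSeries.tensor_assoc (HomSeries.id [i]) (f.eval val) (HomSeries.id q) hs ht hX hY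
    rfl rfl rfl rfl
  exact ⟨Eq.trans (congrArg (SeriesCat.strand i).map h.eq) h2.symm⟩

theorem left_cons {f : Term n a b} {i j : Color n} {w : Word n} {φ : X ⟶ Y}
    {hs : s = (i :: j :: w) ++ a} {ht : t = (i :: j :: w) ++ b}
    {hX : (SeriesCat.strand i).obj X = s ++ q} {hY : (SeriesCat.strand i).obj Y = t ++ q}
    (hX' : X = ((j :: w) ++ a) ++ q) (hY' : Y = ((j :: w) ++ b) ++ q)
    (h : IsValue val ((Term.id (j :: w)).tensor f rfl rfl) q φ hX' hY') :
    IsValue val ((Term.id (i :: j :: w)).tensor f hs ht) q ((SeriesCat.strand i).map φ) hX hY := by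
  have h2 := HomSeries.tensor_assoc (HomSeries.id [i]) (HomSeries.id (j :: w)) (f.eval val)
    (ab := i :: j :: w) (ab' := i :: j :: w) rfl rfl hs ht rfl rfl hs ht
  rw [HomSeries.tensor_id] at h2
  refine ⟨(left (hs := hs) (ht := ht) (hX := hX) (hY := hY) hX' hY' h).eq.trans ?_⟩
  exact (congrArg (fun k => HomSeries.tensor k (HomSeries.id q) hX hY) h2).symm

theorem id {hX hX' : X = a ++ q} : IsValue val (Term.id a) q (𝟙 X) hX hX' := by
  subst hX
  exact ⟨(HomSeries.tensor_id rfl).symm⟩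

theorem zero {hX : X = a ++ q} {hY : Y = b ++ q} :
    IsValue val (Term.zero : Term n a b) q (0 : X ⟶ Y) hX hY :=
  ⟨(HomSeries.zero_tensor _ _ _).symm⟩

theorem add {f g : Term n a b} {φ ψ : X ⟶ Y} {hX : X = a ++ q} {hY : Y = b ++ q}
    (hf : IsValue val f q φ hX hY) (hg : IsValue val g q ψ hX hY) :
    IsValue val (f.add g) q (φ + ψ) hX hY :=
  ⟨(congrArg₂ (· + ·) hf.eq hg.eq).trans (HomSeries.add_tensor _ _ _ _ _).symm⟩

theorem sub {f g : Term n a b} {φ ψ : X ⟶ Y} {hX : X = a ++ q} {hY : Y = b ++ q}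
    (hf : IsValue val f q φ hX hY) (hg : IsValue val g q ψ hX hY) :
    IsValue val (f.add g.neg) q (φ - ψ) hX hY := by
  rw [sub_eq_add_neg]
  exact hf.add ⟨(congrArg Neg.neg hg.eq).trans (HomSeries.neg_tensor _ _ _ _).symm⟩

theorem box {j : Fin n} {hX hY : X = [] ++ q} :
    IsValue val (Term.box j) q ((DiagAction.ofVal val).x j • 𝟙 X) hX hY := by
  have key : ∀ (X : SeriesCat n) (h : X = q),
      IsValue val (Term.box j) q ((DiagAction.ofVal val).x j • 𝟙 X) h h := by
    rintro _ rfl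
    exact ⟨rfl⟩
  exact key X hX

theorem box_sub_box {j k : Fin n} {hX hY : X = [] ++ q} :
    IsValue val ((Term.box j).add (Term.box k).neg) q
      (((DiagAction.ofVal val).x j - (DiagAction.ofVal val).x k) • 𝟙 X) hX hY := by
  rw [sub_smul]
  exact box.sub box

end IsValue

theorem RespectsLocalRel.eq_of_isValue (h : RespectsLocalRel val) {a b q : Word n}
    {X Y : SeriesCat n} {f g : Term n a b} (hfg : LocalRel n f g) {φ ψ : X ⟶ Y} (hX : X = a ++ q)
    (hY : Y = b ++ q) (hf : IsValue val f q φ hX hY) (hg : IsValue val g q ψ hX hY) : φ = ψ := by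
  rw [hf.eq, h hfg, hg.eq]

theorem eval_eq_of_isValue {a b : Word n} {X Y : SeriesCat n} {f g : Term n a b} {φ ψ : X ⟶ Y}
    (h : φ = ψ) (hX : X = a ++ []) (hY : Y = b ++ []) (hf : IsValue val f [] φ hX hY)
    (hg : IsValue val g [] ψ hX hY) : f.eval val = g.eval val := by
  subst hX hY
  exact HomSeries.eq_of_tensor_unit (hf.eq.symm.trans (h.trans hg.eq))

/-- Placing strands to the right of a local relation gives the corresponding equation of natural
transformations at every word. -/
theorem RespectsLocalRel.isModel (hr : RespectsLocalRel val) :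
    (DiagAction.ofVal val).IsModel := by
  refine ⟨fun i X => hr.eq_of_isValue (.merge_assoc i) (q := X) rfl rfl ?_ ?_,
    fun i X => hr.eq_of_isValue (.split_coassoc i) (q := X) rfl rfl ?_ ?_,
    fun i X => hr.eq_of_isValue (.frobenius_left i) (q := X) rfl rfl ?_ ?_,
    fun i X => hr.eq_of_isValue (.frobenius_right i) (q := X) rfl rfl ?_ ?_,
    fun i X => hr.eq_of_isValue (.unit_left i) (q := X) rfl rfl ?_ ?_,
    fun i X => hr.eq_of_isValue (.unit_right i) (q := X) rfl rfl ?_ ?_,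
    fun i X => hr.eq_of_isValue (.counit_left i) (q := X) rfl rfl ?_ ?_,
    fun i X => hr.eq_of_isValue (.counit_right i) (q := X) rfl rfl ?_ ?_,
    fun i X => hr.eq_of_isValue (.needle i) (q := X) rfl rfl ?_ ?_,
    fun i X => hr.eq_of_isValue (.barbell i) (q := X) rfl rfl ?_ ?_,
    fun i X => hr.eq_of_isValue (.force_lo i) (q := X) rfl rfl ?_ ?_,
    fun i X => hr.eq_of_isValue (.force_hi i) (q := X) rfl rfl ?_ ?_,
    fun i j X hlo hhi => hr.eq_of_isValue (.force_other i j hlo hhi) (q := X) rfl rfl ?_ ?_,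
    fun i j h X => hr.eq_of_isValue (.cross_rotate i j h) (q := X) rfl rfl ?_ ?_,
    fun i j h X => hr.eq_of_isValue (.cross_cross i j h) (q := X) rfl rfl ?_ ?_,
    fun i j h X => hr.eq_of_isValue (.cross_dot i j h) (q := X) rfl rfl ?_ ?_,
    fun i j h X => hr.eq_of_isValue (.cross_merge i j h) (q := X) rfl rfl ?_ ?_,
    fun i j h X => hr.eq_of_isValue (.six_rotate i j h) (q := X) rfl rfl ?_ ?_,
    fun i j h X => hr.eq_of_isValue (.six_dot i j h) (q := X) rfl rfl ?_ ?_,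
    fun i j h X => hr.eq_of_isValue (.six_six i j h) (q := X) rfl rfl ?_ ?_,
    fun i j h X => hr.eq_of_isValue (.six_merge i j h) (q := X) rfl rfl ?_ ?_,
    fun i j k hij hik hjk X => hr.eq_of_isValue (.three_distant i j k hij hik hjk) (q := X) rfl rfl ?_ ?_,
    fun i j k hij hik hjk X => hr.eq_of_isValue (.six_distant i j k hij hik hjk) (q := X) rfl rfl ?_ ?_⟩
  all_goals
    -- The order is significant: expressions are bracketed to the left and composites of
    -- transformations to the right, so `comp_assoc` precedes `comp`. Likewise long identities are
    -- peeled by `left_cons` before `left`, and `box_sub_box` precedes `sub`.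
    repeat' first
      | refine IsValue.comp_assoc ?_
      | refine IsValue.comp ?_ ?_ ?_
      | refine IsValue.left_cons ?_ ?_ ?_
      | refine IsValue.left ?_ ?_ ?_
      | refine IsValue.right ?_ ?_ ?_
      | exact IsValue.box_sub_box
      | refine IsValue.sub ?_ ?_
      | refine IsValue.add ?_ ?_
      | exact IsValue.box
      | exact IsValue.id
      | exact IsValue.zero
      | exact ⟨rfl⟩
      | rfl

/-- The converse direction needs only the empty word on the right, since tensoring with its identity
loses nothing. -/
theorem DiagAction.IsModel.respectsLocalRel (hD : (DiagAction.ofVal val).IsModel)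
    (hZ : (DiagAction.ofVal val).Zamolodchikov) : RespectsLocalRel val := by
  intro a b f g hfg
  refine LocalRel.casesOn (motive := fun f g _ => f.eval val = g.eval val) hfg
    (fun i => eval_eq_of_isValue (hD.merge_assoc i []) rfl rfl ?_ ?_)
    (fun i => eval_eq_of_isValue (hD.split_coassoc i []) rfl rfl ?_ ?_)
    (fun i => eval_eq_of_isValue (hD.frobenius_left i []) rfl rfl ?_ ?_)
    (fun i => eval_eq_of_isValue (hD.frobenius_right i []) rfl rfl ?_ ?_)
    (fun i => eval_eq_of_isValue (hD.unit_left i []) rfl rfl ?_ ?_)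
    (fun i => eval_eq_of_isValue (hD.unit_right i []) rfl rfl ?_ ?_)
    (fun i => eval_eq_of_isValue (hD.counit_left i []) rfl rfl ?_ ?_)
    (fun i => eval_eq_of_isValue (hD.counit_right i []) rfl rfl ?_ ?_)
    (fun i => eval_eq_of_isValue (hD.needle i []) rfl rfl ?_ ?_)
    (fun i => eval_eq_of_isValue (hD.barbell i []) rfl rfl ?_ ?_)
    (fun i => eval_eq_of_isValue (hD.force_lo i []) rfl rfl ?_ ?_)
    (fun i => eval_eq_of_isValue (hD.force_hi i []) rfl rfl ?_ ?_)
    (fun i j hlo hhi => eval_eq_of_isValue (hD.force_other i j [] hlo hhi) rfl rfl ?_ ?_)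
    (fun i j h => eval_eq_of_isValue (hD.cross_rotate i j h []) rfl rfl ?_ ?_)
    (fun i j h => eval_eq_of_isValue (hD.cross_cross i j h []) rfl rfl ?_ ?_)
    (fun i j h => eval_eq_of_isValue (hD.cross_dot i j h []) rfl rfl ?_ ?_)
    (fun i j h => eval_eq_of_isValue (hD.cross_merge i j h []) rfl rfl ?_ ?_)
    (fun i j h => eval_eq_of_isValue (hD.six_rotate i j h []) rfl rfl ?_ ?_)
    (fun i j h => eval_eq_of_isValue (hD.six_dot i j h []) rfl rfl ?_ ?_)
    (fun i j h => eval_eq_of_isValue (hD.six_six i j h []) rfl rfl ?_ ?_)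
    (fun i j h => eval_eq_of_isValue (hD.six_merge i j h []) rfl rfl ?_ ?_)
    (fun i j k hij hik hjk => eval_eq_of_isValue (hD.three_distant i j k hij hik hjk []) rfl rfl ?_ ?_)
    (fun i j k hij hik hjk => eval_eq_of_isValue (hD.six_distant i j k hij hik hjk []) rfl rfl ?_ ?_)
    (fun i j k hij hjk hik h1 h2 => eval_eq_of_isValue (hZ i j k hij hjk hik h1 h2 []) rfl rfl ?_ ?_)
  all_goals
    repeat' first
      | refine IsValue.comp_assoc ?_
      | refine IsValue.comp ?_ ?_ ?_
      | refine IsValue.left_cons ?_ ?_ ?_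
      | refine IsValue.left ?_ ?_ ?_
      | refine IsValue.right ?_ ?_ ?_
      | exact IsValue.box_sub_box
      | refine IsValue.sub ?_ ?_
      | refine IsValue.add ?_ ?_
      | exact IsValue.box
      | exact IsValue.id
      | exact IsValue.zero
      | exact ⟨rfl⟩
      | rfl

theorem RespectsLocalRel.zamolodchikov (hr : RespectsLocalRel val) :
    (DiagAction.ofVal val).Zamolodchikov := by
  intro i j k hij hjk hik h1 h2 X
  refine hr.eq_of_isValue (.zamolodchikov i j k hij hjk hik h1 h2) (q := X) rfl rfl ?_ ?_
  all_goals
    repeat' first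
      | refine IsValue.comp_assoc ?_
      | refine IsValue.comp ?_ ?_ ?_
      | refine IsValue.left_cons ?_ ?_ ?_
      | refine IsValue.left ?_ ?_ ?_
      | refine IsValue.right ?_ ?_ ?_
      | exact IsValue.box_sub_box
      | refine IsValue.sub ?_ ?_
      | refine IsValue.add ?_ ?_
      | exact IsValue.box
      | exact IsValue.id
      | exact IsValue.zero
      | exact ⟨rfl⟩
      | rfl

end Eval

end HeckeDiag


/-! ### Passing from formal expressions to morphisms. -/

namespace HeckeDiag

open CategoryTheory

section Lift

variable {n : ℕ} {val : ∀ a b : Word n, Gen n a b → HomSeries a b}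

theorem RespectsLocalRel.eval_eq (h : RespectsLocalRel val) {a b : Word n} {f g : Term n a b}
    (hfg : Rel n f g) : f.eval val = g.eval val := by
  induction hfg with
  | refl => rfl
  | symm _ ih => exact ih.symm
  | trans _ _ ih ih' => exact ih.trans ih'
  | comp_congr _ _ ih ih' => exact congrArg₂ HomSeries.comp ih ih'
  | tensor_congr hs ht _ _ ih ih' => exact congrArg₂ (HomSeries.tensor · · hs ht) ih ih'
  | add_congr _ _ ih ih' => exact congrArg₂ (· + ·) ih ih'
  | neg_congr _ ih => exact congrArg Neg.neg ih
  | add_assoc => exact add_assoc _ _ _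
  | add_comm => exact add_comm _ _
  | zero_add => exact zero_add _
  | neg_add => exact neg_add_cancel _
  | add_comp => exact HomSeries.add_comp _ _ _
  | comp_add => exact HomSeries.comp_add _ _ _
  | add_tensor => exact HomSeries.add_tensor _ _ _ _ _
  | tensor_add => exact HomSeries.tensor_add _ _ _ _ _
  | id_comp => exact HomSeries.id_comp _
  | comp_id => exact HomSeries.comp_id _
  | comp_assoc => exact HomSeries.comp_assoc _ _ _
  | tensor_id => exact HomSeries.tensor_id _
  | interchange => exact HomSeries.interchange _ _ _ _ _ _ _
  | unit_tensor => exact HomSeries.unit_tensor _ _ _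
  | tensor_unit => exact HomSeries.tensor_unit _ _ _
  | tensor_assoc => exact HomSeries.tensor_assoc _ _ _ _ _ _ _ _ _ _ _
  | of_local h' => exact h h'

/-- The map to power series determined by values of the generators that satisfy the local
relations. -/
def lift (h : RespectsLocalRel val) {a b : Word n} (f : Hom a b) : HomSeries a b :=
  Quotient.lift (Term.eval val) (fun _ _ hfg => h.eval_eq hfg) f

variable (h : RespectsLocalRel val)

theorem lift_comp {a b c : Word n} (f : Hom a b) (g : Hom b c) :
    lift h (f.comp g) = (lift h f).comp (lift h g) := by
  induction f using Hom.ind; induction g using Hom.ind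
  rfl

theorem lift_tens {a b c d : Word n} (f : Hom a b) (g : Hom c d) :
    lift h (f.tens g) = (lift h f).tensor (lift h g) rfl rfl := by
  induction f using Hom.ind; induction g using Hom.ind
  rfl

theorem lift_add {a b : Word n} (f g : Hom a b) : lift h (f + g) = lift h f + lift h g := by
  induction f using Hom.ind; induction g using Hom.ind
  rfl

/-- The coefficients of the map to power series. -/
def liftCoeff (k : ℕ) : Operator n := fun _ _ => AddMonoidHom.mk' (fun f => lift h f k)
  (fun f g => congrFun (lift_add h f g) k)

theorem liftCoeff_comp (k : ℕ) {a b c : Word n} (f : Hom a b) (g : Hom b c) :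
    liftCoeff h k a c (f.comp g) = ∑ p ∈ Finset.HasAntidiagonal.antidiagonal k,
      (liftCoeff h p.1 a b f).comp (liftCoeff h p.2 b c g) :=
  congrFun (lift_comp h f g) k

theorem liftCoeff_tens (k : ℕ) {a b c d : Word n} (f : Hom a b) (g : Hom c d) :
    liftCoeff h k (a ++ c) (b ++ d) (f.tens g) = ∑ p ∈ Finset.HasAntidiagonal.antidiagonal k,
      (liftCoeff h p.1 a b f).tens (liftCoeff h p.2 c d g) :=
  congrFun (lift_tens h f g) k

end Lift

/-! ### Coefficients of series, and the generator values of the two exponentials. -/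

section Coeff

variable {n : ℕ}

namespace HomSeries

theorem const_apply_zero {a b : Word n} (f : Hom a b) : const f 0 = f :=
  Pi.single_eq_same (M := fun _ => Hom a b) 0 f

theorem const_apply_succ {a b : Word n} (f : Hom a b) (k : ℕ) : const f (k + 1) = 0 :=
  Pi.single_eq_of_ne (M := fun _ => Hom a b) (Nat.succ_ne_zero k) f

theorem comp_apply_zero {a b c : Word n} (f : HomSeries a b) (g : HomSeries b c) :
    (f.comp g) 0 = (f 0).comp (g 0) := by
  simp [comp, cauchy, Hom.compHom_apply]

theorem comp_apply_one {a b c : Word n} (f : HomSeries a b) (g : HomSeries b c) :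
    (f.comp g) 1 = (f 0).comp (g 1) + (f 1).comp (g 0) := by
  simp [comp, cauchy, Hom.compHom_apply, Finset.Nat.antidiagonal_succ]

theorem tensor_apply_zero {a b c d s t : Word n} (f : HomSeries a b) (g : HomSeries c d)
    (hs : s = a ++ c) (ht : t = b ++ d) : (f.tensor g hs ht) 0 = (f 0).tensor (g 0) hs ht := by
  simp [tensor, cauchy, Hom.tensorHom_apply]

theorem tensor_apply_one {a b c d s t : Word n} (f : HomSeries a b) (g : HomSeries c d)
    (hs : s = a ++ c) (ht : t = b ++ d) :
    (f.tensor g hs ht) 1 = (f 0).tensor (g 1) hs ht + (f 1).tensor (g 0) hs ht := by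
  simp [tensor, cauchy, Hom.tensorHom_apply, Finset.Nat.antidiagonal_succ]

theorem const_tensor_apply {a b c d s t : Word n} (f : Hom a b) (g : HomSeries c d)
    (hs : s = a ++ c) (ht : t = b ++ d) (k : ℕ) :
    ((const f).tensor g hs ht) k = f.tensor (g k) hs ht :=
  congrFun (cauchy_const_left _ f g) k

end HomSeries

namespace PolySeries

variable (n) in
/-- The formal variable of the power series. -/
def t : PolySeries n := Pi.single (M := fun _ => Hom (n := n) [] []) 1 (Hom.id [])

/-- A polynomial, as a constant power series. -/
def C (f : Hom (n := n) [] []) : PolySeries n := HomSeries.const f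

theorem t_smul_zero {a b : Word n} (f : HomSeries a b) : (t n • f) 0 = 0 := by
  have h : t n 0 = 0 := Pi.single_eq_of_ne (M := fun _ => Hom (n := n) [] []) zero_ne_one _
  refine (HomSeries.tensor_apply_zero (t n) f rfl rfl).trans ?_
  exact (congrArg (fun p => Hom.tensor p (f 0) rfl rfl) h).trans
    (map_zero (AddMonoidHom.flip (Hom.tensorHom rfl rfl) (f 0)))

theorem t_smul_succ {a b : Word n} (f : HomSeries a b) (k : ℕ) : (t n • f) (k + 1) = f k := by
  rw [add_comm, smul_def]
  exact (cauchy_single_left (Hom.tensorHom rfl rfl) 1 (Hom.id []) f k).trans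
    (Hom.unit_tensor (f k) rfl rfl)

theorem slides_t (i : Color n) : DiagAction.Slides SeriesCat.strand i (t n) := fun (X : Word n) => by
  funext k
  refine (HomSeries.const_tensor_apply (Hom.id [i]) (t n • HomSeries.id X) rfl rfl k).trans ?_
  change (Hom.id [i]).tensor ((t n • HomSeries.id X) k) rfl rfl = (t n • HomSeries.id (i :: X)) k
  have h0 {a b : Word n} : (Hom.id [i]).tensor (0 : Hom a b) rfl rfl = 0 :=
    map_zero (Hom.tensorHom rfl rfl (Hom.id [i]))
  rcases k with _ | k
  · rw [t_smul_zero, t_smul_zero, h0]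
  · rw [t_smul_succ, t_smul_succ]
    rcases k with _ | k
    · exact Hom.tensor_id rfl
    · rw [HomSeries.id, HomSeries.const_apply_succ, HomSeries.id, HomSeries.const_apply_succ, h0]

/-- The powers of a polynomial. -/
def pow (f : Hom (n := n) [] []) : ℕ → Hom (n := n) [] []
  | 0 => Hom.id []
  | k + 1 => f.tens (pow f k)

/-- The geometric series, inverse of `1 - t f`. -/
def geom (f : Hom (n := n) [] []) : PolySeries n := pow f

theorem inv_geom (f : Hom (n := n) [] []) : (1 - t n * C f) * geom f = 1 := by
  have h : (show HomSeries [] [] from geom f) = HomSeries.id []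
      + t n • (HomSeries.const f).tensor (s := []) (t := []) (show HomSeries [] [] from geom f)
        rfl rfl := by
    funext k
    rw [HomSeries.add_apply]
    rcases k with _ | k
    · rw [t_smul_zero, add_zero]
      exact (HomSeries.const_apply_zero _).symm
    · rw [t_smul_succ, HomSeries.id, HomSeries.const_apply_succ, zero_add]
      exact (HomSeries.const_tensor_apply f (geom f) rfl rfl k).symm
  have h2 : geom f = 1 + t n * (C f * geom f) := h
  linear_combination h2

end PolySeries

/-- The generating diagrams as constant power series. -/
def constVal (a b : Word n) (g : Gen n a b) : HomSeries a b := HomSeries.const (Hom.of g)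

theorem eval_constVal {a b : Word n} (f : Term n a b) :
    f.eval constVal = HomSeries.const (Hom.mk f) := by
  induction f with
  | of g => rfl
  | id a => rfl
  | comp f g ihf ihg => rw [Term.eval, ihf, ihg, Hom.mk_comp, HomSeries.const_comp]
  | tensor f g hs ht ihf ihg => rw [Term.eval, ihf, ihg, Hom.mk_tensor, HomSeries.const_tensor]
  | zero => exact HomSeries.const_zero.symm
  | add f g ihf ihg => rw [Term.eval, ihf, ihg, Hom.mk_add, HomSeries.const_add]
  | neg f ih => rw [Term.eval, ih, Hom.mk_neg, HomSeries.const_neg]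

/-- The relations hold tautologically for constant series. The resulting action is the one to be
deformed. -/
theorem constVal_respects : RespectsLocalRel (constVal (n := n)) := fun {a b f g} h => by
  rw [eval_constVal, eval_constVal, Hom.mk_eq (Rel.of_local h)]

variable (n) in
/-- The tautological action on the category of power series. -/
def baseAction : DiagAction (PolySeries n) (SeriesCat.strand (n := n)) := .ofVal constVal

theorem baseAction_isModel : (baseAction n).IsModel := constVal_respects.isModel

theorem baseAction_zamolodchikov : (baseAction n).Zamolodchikov := constVal_respects.zamolodchikov

theorem baseAction_isAdmissible :
    (baseAction n).IsAdmissible (PolySeries.t n) (fun j => PolySeries.geom (Hom.x j)) where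
  inv j := PolySeries.inv_geom (Hom.x j)
  slides := PolySeries.slides_t

/-! ### The exponential of the lowering operator -/

/-- The values of the exponential of the lowering operator on the generators. -/
def lowerVal : ∀ a b : Word n, Gen n a b → HomSeries a b
  | _, _, .box j => (PolySeries.C (Hom.x j) + PolySeries.t n : PolySeries n)
  | _, _, .enddot i => HomSeries.const (Hom.enddot i)
  | _, _, .startdot i => HomSeries.const (Hom.startdot i)
  | _, _, .merge i => HomSeries.const (Hom.merge i)
  | _, _, .split i => HomSeries.const (Hom.split i)
  | _, _, .cross i j h => HomSeries.const (Hom.cross i j h)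
  | _, _, .six i j h => HomSeries.const (Hom.six i j h)

theorem translate_eq_ofVal :
    (baseAction n).translate (PolySeries.t n) = DiagAction.ofVal lowerVal := rfl

theorem lowerVal_respects : RespectsLocalRel (lowerVal (n := n)) :=
  DiagAction.IsModel.respectsLocalRel
    (translate_eq_ofVal (n := n) ▸ baseAction_isModel.translate_isModel PolySeries.slides_t)
    -- The Zamolodchikov relation mentions no variable, so translation leaves it unchanged.
    (translate_eq_ofVal (n := n) ▸ baseAction_zamolodchikov)

/-! ### The exponential of the raising operator -/

/-- The values of the exponential of the raising operator on the generators. -/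
def raiseVal : ∀ a b : Word n, Gen n a b → HomSeries a b
  | _, _, .box j => (PolySeries.C (Hom.x j) * PolySeries.geom (Hom.x j) : PolySeries n)
  | _, _, .enddot i => PolySeries.geom (Hom.x (lo i)) • HomSeries.const (Hom.enddot i)
  | _, _, .startdot i => PolySeries.geom (Hom.x (hi i)) • HomSeries.const (Hom.startdot i)
  | _, _, .merge i =>
    ((HomSeries.id [i]).tensor ((1 - PolySeries.t n * PolySeries.C (Hom.x (hi i))) •
      HomSeries.id [i]) rfl rfl).comp (HomSeries.const (Hom.merge i))
  | _, _, .split i => (HomSeries.const (Hom.split i)).comp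
    ((HomSeries.id [i]).tensor ((1 - PolySeries.t n * PolySeries.C (Hom.x (lo i))) •
      HomSeries.id [i]) rfl rfl)
  | _, _, .cross i j h => HomSeries.const (Hom.cross i j h)
  | _, _, .six i j h =>
    if i.val + 1 = j.val then
      (PolySeries.geom (Hom.x (lo i)) * PolySeries.geom (Hom.x (hi j))) •
        (((HomSeries.id [i, j]).tensor ((1 - PolySeries.t n * PolySeries.C (Hom.x (hi i))) •
          HomSeries.id [i]) rfl rfl).comp
        ((HomSeries.const (Hom.six i j h)).comp
          ((HomSeries.id [j, i]).tensor ((1 - PolySeries.t n * PolySeries.C (Hom.x (hi i))) •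
          HomSeries.id [j]) rfl rfl)))
    else HomSeries.const (Hom.six i j h)

namespace HomSeries

theorem smul_tensor {a b c d s t : Word n} (p : PolySeries n) (f : HomSeries a b)
    (g : HomSeries c d) (hs : s = a ++ c) (ht : t = b ++ d) :
    (p • f).tensor g hs ht = p • f.tensor g hs ht :=
  tensor_assoc _ _ _ _ _ _ _ _ _ _ _

theorem comp_tensor_id {a b c q s t : Word n} (f : HomSeries a b) (g : HomSeries b c) (m : Word n)
    (hm : m = b ++ q) (hs : s = a ++ q) (ht : t = c ++ q) :
    (f.comp g).tensor (id q) hs ht = (f.tensor (id q) hs hm).comp (g.tensor (id q) hm ht) := by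
  rw [← interchange f g (id q) (id q), id_comp]

theorem id_tensor_smul_tensor {a w q s t sq tq : Word n} (p : PolySeries n)
    (hs : s = a ++ w) (ht : t = a ++ w) (hsq : sq = s ++ q) (htq : tq = t ++ q) :
    ((id a).tensor (p • id w) hs ht).tensor (id q) hsq htq
      = (id a).tensor (p • id (w ++ q)) (by rw [hsq, hs, List.append_assoc])
        (by rw [htq, ht, List.append_assoc]) := by
  rw [tensor_assoc (id a) (p • id w) (id q) hs ht hsq htq rfl rfl
    (by rw [hsq, hs, List.append_assoc]) (by rw [htq, ht, List.append_assoc]), smul_tensor,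
    tensor_id]

end HomSeries

theorem raiseVal_six_up {i j : Color n} (h : Adjacent i j) (hij : i.val + 1 = j.val) :
    raiseVal _ _ (.six i j h)
      = (PolySeries.geom (Hom.x (lo i)) * PolySeries.geom (Hom.x (hi j))) •
        (((HomSeries.id [i, j]).tensor ((1 - PolySeries.t n * PolySeries.C (Hom.x (hi i))) •
          HomSeries.id [i]) rfl rfl).comp
        ((HomSeries.const (Hom.six i j h)).comp
          ((HomSeries.id [j, i]).tensor ((1 - PolySeries.t n * PolySeries.C (Hom.x (hi i))) •
          HomSeries.id [j]) rfl rfl))) := if_pos hij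

theorem raiseVal_six_down {i j : Color n} (h : Adjacent i j) (hij : ¬ i.val + 1 = j.val) :
    raiseVal _ _ (.six i j h) = HomSeries.const (Hom.six i j h) := if_neg hij

/-- A deformed transformation is a deformed generator with identity strands on its right, because
its factors lie to the left of the last strand of the generator or in front of it. This
identification brings the abstract computation back to generators. -/
theorem deform_eq_ofVal :
    (baseAction n).deform (PolySeries.t n) (fun j => PolySeries.geom (Hom.x j))
      = DiagAction.ofVal raiseVal := by
  have hx : ∀ j : Fin n, (baseAction n).x j = PolySeries.C (Hom.x j) := fun j => rfl
  unfold DiagAction.deform DiagAction.ofVal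
  congr 1
  · funext i q
    exact (HomSeries.smul_tensor _ _ _ _ _).symm
  · funext i q
    exact (HomSeries.smul_tensor _ _ _ _ _).symm
  · funext i q
    refine Eq.trans ?_ (HomSeries.comp_tensor_id (a := [i, i]) (b := [i, i]) (c := [i]) (q := q)
      (s := i :: i :: q) (t := i :: q) _ _ (i :: i :: q) rfl rfl rfl).symm
    exact congrArg (HomSeries.comp · _)
      (HomSeries.id_tensor_smul_tensor (a := [i]) (w := [i]) (q := q) _ rfl rfl rfl rfl).symm
  · funext i q
    refine Eq.trans ?_ (HomSeries.comp_tensor_id (a := [i]) (b := [i, i]) (c := [i, i]) (q := q)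
      (s := i :: q) (t := i :: i :: q) _ _ (i :: i :: q) rfl rfl rfl).symm
    exact congrArg (HomSeries.comp _ ·)
      (HomSeries.id_tensor_smul_tensor (a := [i]) (w := [i]) (q := q) _ rfl rfl rfl rfl).symm
  · funext i j h q
    by_cases hij : i.val + 1 = j.val
    · refine (if_pos hij).trans (Eq.trans ?_
        (congrArg (fun f => HomSeries.tensor f (HomSeries.id q) rfl rfl)
          (raiseVal_six_up h hij)).symm)
      refine Eq.trans ?_ (HomSeries.smul_tensor _ _ _ _ _).symm
      refine congrArg (fun f : HomSeries (i :: j :: i :: q) (j :: i :: j :: q) => _ • f) ?_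
      refine Eq.trans ?_ (HomSeries.comp_tensor_id (a := [i, j, i]) (b := [i, j, i])
        (c := [j, i, j]) (q := q) (s := i :: j :: i :: q) (t := j :: i :: j :: q) _ _
        (i :: j :: i :: q) rfl rfl rfl).symm
      refine congrArg₂ HomSeries.comp ?_ (Eq.trans (congrArg (HomSeries.comp _ ·) ?_)
        (HomSeries.comp_tensor_id (a := [i, j, i]) (b := [j, i, j])
        (c := [j, i, j]) (q := q) (s := i :: j :: i :: q) (t := j :: i :: j :: q) _ _
        (j :: i :: j :: q) rfl rfl rfl).symm)
      · exact (SeriesCat.strand_strand i j _).trans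
          (HomSeries.id_tensor_smul_tensor (a := [i, j]) (w := [i]) (q := q) _ rfl rfl rfl rfl).symm
      · exact (SeriesCat.strand_strand j i _).trans
          (HomSeries.id_tensor_smul_tensor (a := [j, i]) (w := [j]) (q := q) _ rfl rfl rfl rfl).symm
    · exact (if_neg hij).trans
        (congrArg (fun f => HomSeries.tensor f (HomSeries.id q) rfl rfl)
          (raiseVal_six_down h hij)).symm

theorem raiseVal_respects : RespectsLocalRel (raiseVal (n := n)) :=
  DiagAction.IsModel.respectsLocalRel
    (deform_eq_ofVal (n := n) ▸ baseAction_isModel.deform_isModel baseAction_isAdmissible)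
    (deform_eq_ofVal (n := n) ▸ baseAction_isModel.deform_zamolodchikov baseAction_isAdmissible
      baseAction_zamolodchikov)

end Coeff

end HeckeDiag


/-! ### Vandermonde convolutions. -/

namespace HeckeDiag

section Convolution

open Finset

variable {A B C : Type*} [AddCommGroup A] [AddCommGroup B] [AddCommGroup C]

theorem sum_antidiagonal_shift (φ : ℕ × ℕ → C) (a b l : ℕ)
    (h : ∀ p, p.1 < a ∨ p.2 < b → φ p = 0) :
    ∑ p ∈ HasAntidiagonal.antidiagonal l, φ (a + p.1, b + p.2) = ∑ p ∈ HasAntidiagonal.antidiagonal (a + b + l), φ p := by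
  refine sum_of_injOn (fun p => (a + p.1, b + p.2)) ?_ ?_ ?_ ?_
  · rintro ⟨x, y⟩ - ⟨x', y'⟩ - h
    simpa using h
  · rintro ⟨x, y⟩ hxy
    simp only [mem_coe, HasAntidiagonal.mem_antidiagonal] at hxy ⊢
    omega
  · rintro ⟨x, y⟩ hxy hn
    refine h _ ?_
    by_contra! hc
    refine hn ⟨(x - a, y - b), ?_, ?_⟩
    · simp only [mem_coe, HasAntidiagonal.mem_antidiagonal] at hxy ⊢
      simp only at hc
      omega
    · simp only [Prod.mk.injEq] at hc ⊢
      omega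
  · intros
    rfl

/-- Divided powers of a product. -/
theorem sum_choose_convolution (φ : A →+ B →+ C) (F : ℕ → A) (G : ℕ → B) (k l : ℕ) :
    ∑ p ∈ HasAntidiagonal.antidiagonal k, ∑ q ∈ HasAntidiagonal.antidiagonal l,
        φ ((p.1 + q.1).choose p.1 • F (p.1 + q.1)) ((p.2 + q.2).choose p.2 • G (p.2 + q.2))
      = (k + l).choose k • ∑ p ∈ HasAntidiagonal.antidiagonal (k + l), φ (F p.1) (G p.2) := by
  -- Vandermonde's identity with upper index p.1 + p.2 = k + l distributes the binomial coefficient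
  -- over the two factors.
  have e : ∀ p ∈ HasAntidiagonal.antidiagonal (k + l), (k + l).choose k • φ (F p.1) (G p.2)
      = ∑ q ∈ HasAntidiagonal.antidiagonal k, φ (p.1.choose q.1 • F p.1) (p.2.choose q.2 • G p.2) := by
    intro p hp
    rw [← HasAntidiagonal.mem_antidiagonal.mp hp, Nat.add_choose_eq, sum_smul]
    refine sum_congr rfl fun q _ => ?_
    rw [map_nsmul, map_nsmul, AddMonoidHom.nsmul_apply, smul_smul, mul_comm]
  refine Eq.trans ?_ ((smul_sum.trans (sum_congr rfl e)).trans sum_comm).symm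
  refine sum_congr rfl fun q hq => ?_
  have h := sum_antidiagonal_shift
    (fun p => φ (p.1.choose q.1 • F p.1) (p.2.choose q.2 • G p.2)) q.1 q.2 l (by
      rintro p (hp | hp)
      · simp [Nat.choose_eq_zero_of_lt hp]
      · simp [Nat.choose_eq_zero_of_lt hp])
  rw [HasAntidiagonal.mem_antidiagonal.mp hq] at h
  exact h

/-- Commutation of divided powers on a product. -/
theorem sum_commutation_convolution (φ : A →+ B →+ C) (F : ℕ → ℕ → A) (G : ℕ → ℕ → B) (m m' : ℤ)
    (r s : ℕ) :
    ∑ p ∈ HasAntidiagonal.antidiagonal s, ∑ q ∈ HasAntidiagonal.antidiagonal r,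
        φ (∑ t ∈ range (min q.1 p.1 + 1),
            ((-1) ^ t * Ring.choose (m + q.1 - p.1) t : ℤ) • F (p.1 - t) (q.1 - t))
          (∑ t ∈ range (min q.2 p.2 + 1),
            ((-1) ^ t * Ring.choose (m' + q.2 - p.2) t : ℤ) • G (p.2 - t) (q.2 - t))
      = ∑ t ∈ range (min r s + 1), ((-1) ^ t * Ring.choose (m + m' + r - s) t : ℤ) •
          ∑ p ∈ HasAntidiagonal.antidiagonal (r - t), ∑ q ∈ HasAntidiagonal.antidiagonal (s - t),
            φ (F q.1 p.1) (G q.2 p.2) := by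
  have e : ∀ t ∈ range (min r s + 1), ((-1) ^ t * Ring.choose (m + m' + r - s) t : ℤ) •
          ∑ p ∈ HasAntidiagonal.antidiagonal (r - t), ∑ q ∈ HasAntidiagonal.antidiagonal (s - t), φ (F q.1 p.1) (G q.2 p.2)
      = ∑ p ∈ HasAntidiagonal.antidiagonal (r - t), ∑ q ∈ HasAntidiagonal.antidiagonal (s - t), ∑ z ∈ HasAntidiagonal.antidiagonal t,
          φ (((-1) ^ z.1 * Ring.choose (m + p.1 - q.1) z.1 : ℤ) • F q.1 p.1)
            (((-1) ^ z.2 * Ring.choose (m' + p.2 - q.2) z.2 : ℤ) • G q.2 p.2) := by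
    intro t ht
    rw [smul_sum]
    refine sum_congr rfl fun p hp => ?_
    rw [smul_sum]
    refine sum_congr rfl fun q hq => ?_
    have hp' := HasAntidiagonal.mem_antidiagonal.mp hp
    have hq' := HasAntidiagonal.mem_antidiagonal.mp hq
    have ht' := mem_range.mp ht
    -- The same t is subtracted from r and from s, so the upper index is additive in the two
    -- factors, and Vandermonde for generalized binomials splits t.
    have h1 : m + m' + r - s = (m + p.1 - q.1) + (m' + p.2 - q.2) := by
      have h2 : (p.1 : ℤ) + p.2 = r - t := by omega
      have h3 : (q.1 : ℤ) + q.2 = s - t := by omega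
      linarith
    rw [h1, Ring.add_choose_eq t (Commute.all _ _), mul_sum, sum_smul]
    refine sum_congr rfl fun z hz => ?_
    rw [map_zsmul, map_zsmul, AddMonoidHom.zsmul_apply, smul_smul, ← HasAntidiagonal.mem_antidiagonal.mp hz]
    congr 1
    ring
  refine Eq.trans ?_ (sum_congr rfl e).symm
  simp only [map_sum, AddMonoidHom.finsetSum_apply]
  simp only [sum_sigma']
  -- On the left x.1 splits s and x.2.1 splits r, while x.2.2.2 and x.2.2.1 are the values of t in
  -- the first and second factor. The map subtracts them from the splittings and adds them up to the
  -- total t.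
  refine sum_nbij'
    (fun x => ⟨x.2.2.1 + x.2.2.2, ⟨(x.2.1.1 - x.2.2.2, x.2.1.2 - x.2.2.1),
      ⟨(x.1.1 - x.2.2.2, x.1.2 - x.2.2.1), (x.2.2.2, x.2.2.1)⟩⟩⟩)
    (fun x => ⟨(x.2.2.1.1 + x.2.2.2.1, x.2.2.1.2 + x.2.2.2.2),
      ⟨(x.2.1.1 + x.2.2.2.1, x.2.1.2 + x.2.2.2.2), ⟨x.2.2.2.2, x.2.2.2.1⟩⟩⟩) ?_ ?_ ?_ ?_ ?_
  · rintro ⟨⟨a, b⟩, ⟨⟨c, d⟩, ⟨e, f⟩⟩⟩ hx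
    simp only [mem_sigma, HasAntidiagonal.mem_antidiagonal, mem_range] at hx ⊢
    omega
  · rintro ⟨a, ⟨⟨c, d⟩, ⟨⟨e, f⟩, ⟨g, h⟩⟩⟩⟩ hx
    simp only [mem_sigma, HasAntidiagonal.mem_antidiagonal, mem_range] at hx ⊢
    omega
  · rintro ⟨⟨a, b⟩, ⟨⟨c, d⟩, ⟨e, f⟩⟩⟩ hx
    simp only [mem_sigma, HasAntidiagonal.mem_antidiagonal, mem_range] at hx
    simp only [Sigma.mk.injEq, Prod.mk.injEq, heq_eq_eq, and_true]
    omega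
  · rintro ⟨a, ⟨⟨c, d⟩, ⟨⟨e, f⟩, ⟨g, h⟩⟩⟩⟩ hx
    simp only [mem_sigma, HasAntidiagonal.mem_antidiagonal, mem_range] at hx
    simp only [Sigma.mk.injEq, Prod.mk.injEq, heq_eq_eq, and_true]
    omega
  · rintro ⟨⟨a, b⟩, ⟨⟨c, d⟩, ⟨e, f⟩⟩⟩ hx
    simp only [mem_sigma, HasAntidiagonal.mem_antidiagonal, mem_range] at hx
    have h1 : ((c - f : ℕ) : ℤ) - ((a - f : ℕ) : ℤ) = c - a := by omega
    have h2 : ((d - e : ℕ) : ℤ) - ((b - e : ℕ) : ℤ) = d - b := by omega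
    simp only [add_sub_assoc, h1, h2]

/-- The alternating Vandermonde identity. -/
theorem sum_neg_one_pow_choose_mul (c : ℤ) (s : ℕ) (hs : s ≠ 0) :
    ∑ t ∈ range (s + 1), (-1) ^ t * Ring.choose c t * Ring.choose (c - 1 + (s - t : ℕ)) (s - t) = 0 := by
  -- Vandermonde for c + (-c) = 0. Negating the upper index of the second binomial then creates the
  -- alternating signs.
  have h := Ring.add_choose_eq s (Commute.all c (-c))
  rw [add_neg_cancel, Ring.choose_zero_ite, if_neg hs, Nat.sum_antidiagonal_eq_sum_range_succ_mk] at h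
  have h2 : (0 : ℤ) = (-1) ^ s * 0 := by simp
  rw [h2, h, mul_sum]
  refine sum_congr rfl fun t ht => ?_
  rw [mem_range] at ht
  obtain ⟨u, rfl⟩ : ∃ u, s = t + u := ⟨s - t, by omega⟩
  simp only [Nat.add_sub_cancel_left]
  rw [Ring.choose_neg, Units.smul_def, Int.coe_negOnePow_natCast, smul_eq_mul, pow_add,
    show c + (u : ℤ) - 1 = c - 1 + u by ring]
  have h3 : ((-1 : ℤ) ^ u) * (-1) ^ u = 1 := by rw [← mul_pow]; simp
  linear_combination (-(-1) ^ t * Ring.choose c t * Ring.choose (c - 1 + (u : ℤ)) u) * h3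

end Convolution

end HeckeDiag


namespace HeckeDiag

variable {n : ℕ}

/-! ### Induction principles -/

namespace Hom

/-- Both exponentials fix the vertices S_{i+1,i}. Obtaining S_{i,i+1} from them by rotation avoids
every computation with its complicated image. -/
theorem six_eq_rotation (i j : Color n) (h : Adjacent i j) :
    six j i h.symm = (((cup i).tens (id [j, i, j])).comp
      ((id [i]).tens ((six i j h).tens (id [j])))).comp ((id [i, j, i]).tens (cap j)) :=
  (mk_eq (Rel.of_local (.six_rotate i j h))).symm

/-- Induction on morphisms. Half of the 6-valent vertices are rotations of the other half. -/
theorem gen_induction {P : ∀ a b : Word n, Hom a b → Prop} (x : ∀ j, P [] [] (x j))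
    (enddot : ∀ i, P [i] [] (enddot i)) (startdot : ∀ i, P [] [i] (startdot i))
    (merge : ∀ i, P [i, i] [i] (merge i)) (split : ∀ i, P [i] [i, i] (split i))
    (cross : ∀ i j h, P [i, j] [j, i] (cross i j h))
    (six : ∀ i j h, j.val + 1 = i.val → P [i, j, i] [j, i, j] (six i j h))
    (id : ∀ a, P a a (id a))
    (comp : ∀ {a b c} (f : Hom a b) (g : Hom b c), P a b f → P b c g → P a c (f.comp g))
    (tens : ∀ {a b c d} (f : Hom a b) (g : Hom c d), P a b f → P c d g →
      P (a ++ c) (b ++ d) (f.tens g))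
    (zero : ∀ a b, P a b 0) (add : ∀ {a b} (f g : Hom a b), P a b f → P a b g → P a b (f + g))
    (neg : ∀ {a b} (f : Hom a b), P a b f → P a b (-f)) {a b : Word n} (f : Hom a b) :
    P a b f := by
  induction f using ind with | _ T =>
  induction T with
  | of g =>
    cases g with
    | box j => exact x j
    | enddot i => exact enddot i
    | startdot i => exact startdot i
    | merge i => exact merge i
    | split i => exact split i
    | cross i j h => exact cross i j h
    | six i j h =>
      rcases h with h' | h'
      · have := comp _ _ (comp _ _ (tens _ _ (comp _ _ (startdot j) (split j)) (id [i, j, i]))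
          (tens (a := [j]) (b := [j]) (c := [j, i, j] ++ [i]) (d := [i, j, i] ++ [i]) _ _ (id [j])
            (tens (a := [j, i, j]) (b := [i, j, i]) (c := [i]) (d := [i]) _ _
              (six j i (Or.inr h') h') (id [i]))))
          (tens (a := [j, i, j]) (b := [j, i, j]) (c := [i, i]) (d := []) _ _ (id [j, i, j]) (comp _ _ (merge i) (enddot i)))
        exact (congrArg (P [i, j, i] [j, i, j]) (six_eq_rotation j i (Or.inr h'))).mpr this
      · exact six i j _ h'
  | id a => exact id a
  | comp f g hf hg => exact comp _ _ hf hg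
  | tensor f g hs ht hf hg =>
    subst hs ht
    exact tens _ _ hf hg
  | zero => exact zero _ _
  | add f g hf hg => exact add _ _ hf hg
  | neg f hf => exact neg _ hf

end Hom

/-- Induction on homogeneous morphisms. -/
theorem IsHomogeneous.gen_induction {P : ∀ a b : Word n, Hom a b → ℤ → Prop}
    (x : ∀ j, P [] [] (Hom.x j) 2)
    (enddot : ∀ i, P [i] [] (Hom.enddot i) 1) (startdot : ∀ i, P [] [i] (Hom.startdot i) 1)
    (merge : ∀ i, P [i, i] [i] (Hom.merge i) (-1)) (split : ∀ i, P [i] [i, i] (Hom.split i) (-1))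
    (cross : ∀ i j h, P [i, j] [j, i] (Hom.cross i j h) 0)
    (six : ∀ i j h, j.val + 1 = i.val → P [i, j, i] [j, i, j] (Hom.six i j h) 0)
    (id : ∀ a, P a a (Hom.id a) 0)
    (comp : ∀ {a b c m m'} (f : Hom a b) (g : Hom b c), P a b f m → P b c g m' →
      P a c (f.comp g) (m + m'))
    (tens : ∀ {a b c d m m'} (f : Hom a b) (g : Hom c d), P a b f m → P c d g m' →
      P (a ++ c) (b ++ d) (f.tens g) (m + m'))
    (zero : ∀ a b m, P a b 0 m)
    (add : ∀ {a b m} (f g : Hom a b), P a b f m → P a b g m → P a b (f + g) m)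
    (neg : ∀ {a b m} (f : Hom a b), P a b f m → P a b (-f) m) {a b : Word n} {f : Hom a b} {m : ℤ}
    (hf : IsHomogeneous f m) : P a b f m := by
  induction hf with
  | of g =>
    cases g with
    | box j => exact x j
    | enddot i => exact enddot i
    | startdot i => exact startdot i
    | merge i => exact merge i
    | split i => exact split i
    | cross i j h => exact cross i j h
    | six i j h =>
      rcases h with h' | h'
      · have := comp _ _ (comp _ _ (tens _ _ (comp _ _ (startdot j) (split j)) (id [i, j, i]))
          (tens (a := [j]) (b := [j]) (c := [j, i, j] ++ [i]) (d := [i, j, i] ++ [i]) _ _ (id [j])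
            (tens (a := [j, i, j]) (b := [i, j, i]) (c := [i]) (d := [i]) _ _
              (six j i (Or.inr h') h') (id [i]))))
          (tens (a := [j, i, j]) (b := [j, i, j]) (c := [i, i]) (d := []) _ _ (id [j, i, j]) (comp _ _ (merge i) (enddot i)))
        exact (congrArg (P [i, j, i] [j, i, j] · 0) (Hom.six_eq_rotation j i (Or.inr h'))).mpr this
      · exact six i j _ h'
  | id a => exact id a
  | comp _ _ hf hg => exact comp _ _ hf hg
  | tens _ _ hf hg => exact tens _ _ hf hg
  | zero a b m => exact zero a b m
  | add _ _ hf hg => exact add _ _ hf hg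
  | neg _ hf => exact neg _ hf

/-! ### Higher derivations -/

open Finset (HasAntidiagonal.antidiagonal)

namespace Hom

theorem add_tens {a b c d : Word n} (f f' : Hom a b) (g : Hom c d) :
    (f + f').tens g = f.tens g + f'.tens g := add_tensor f f' g rfl rfl

theorem tens_add {a b c d : Word n} (f : Hom a b) (g g' : Hom c d) :
    f.tens (g + g') = f.tens g + f.tens g' := tensor_add f g g' rfl rfl

theorem zero_comp {a b c : Word n} (g : Hom b c) : (0 : Hom a b).comp g = 0 :=
  DFunLike.congr_fun (map_zero (compHom a b c)) g

theorem comp_zero {a b c : Word n} (f : Hom a b) : f.comp (0 : Hom b c) = 0 :=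
  map_zero (compHom a b c f)

theorem zero_tens {a b c d : Word n} (g : Hom c d) : (0 : Hom a b).tens g = 0 :=
  DFunLike.congr_fun (map_zero (tensorHom (a := a) (b := b) (c := c) (d := d) rfl rfl)) g

theorem tens_zero {a b c d : Word n} (f : Hom a b) : f.tens (0 : Hom c d) = 0 :=
  map_zero (tensorHom (c := c) (d := d) rfl rfl f)

theorem neg_comp {a b c : Word n} (f : Hom a b) (g : Hom b c) : (-f).comp g = -f.comp g :=
  DFunLike.congr_fun (map_neg (compHom a b c) f) g

theorem comp_neg {a b c : Word n} (f : Hom a b) (g : Hom b c) : f.comp (-g) = -f.comp g :=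
  map_neg (compHom a b c f) g

theorem neg_tens {a b c d : Word n} (f : Hom a b) (g : Hom c d) : (-f).tens g = -f.tens g :=
  DFunLike.congr_fun (map_neg (tensorHom rfl rfl) f) g

theorem tens_neg {a b c d : Word n} (f : Hom a b) (g : Hom c d) : f.tens (-g) = -f.tens g :=
  map_neg (tensorHom rfl rfl f) g

theorem nsmul_tens {a b c d : Word n} (k : ℕ) (f : Hom a b) (g : Hom c d) :
    (k • f).tens g = k • f.tens g :=
  DFunLike.congr_fun (map_nsmul (tensorHom rfl rfl) k f) g

theorem tens_nsmul {a b c d : Word n} (k : ℕ) (f : Hom a b) (g : Hom c d) :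
    f.tens (k • g) = k • f.tens g :=
  map_nsmul (tensorHom rfl rfl f) k g

end Hom

/-- Sequences of operators that satisfy the higher Leibniz rules. -/
structure IsHigherDerivation (D : ℕ → Operator n) : Prop where
  map_id_zero : ∀ a, D 0 a a (Hom.id a) = Hom.id a
  map_id_succ : ∀ k a, D (k + 1) a a (Hom.id a) = 0
  map_comp : ∀ (k : ℕ) {a b c : Word n} (f : Hom a b) (g : Hom b c),
    D k a c (f.comp g) = ∑ p ∈ HasAntidiagonal.antidiagonal k, (D p.1 a b f).comp (D p.2 b c g)
  map_tens : ∀ (k : ℕ) {a b c d : Word n} (f : Hom a b) (g : Hom c d),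
    D k (a ++ c) (b ++ d) (f.tens g)
      = ∑ p ∈ HasAntidiagonal.antidiagonal k, (D p.1 a b f).tens (D p.2 c d g)

namespace IsHigherDerivation

variable {D : ℕ → Operator n} (hD : IsHigherDerivation D)
include hD

theorem map_id_tens (k : ℕ) (a : Word n) {c d : Word n} (g : Hom c d) :
    D k (a ++ c) (a ++ d) ((Hom.id a).tens g) = (Hom.id a).tens (D k c d g) := by
  rw [hD.map_tens, Finset.sum_eq_single (0, k), hD.map_id_zero]
  · rintro ⟨i, j⟩ hij hne
    obtain rfl | i := i
    · simp only [Finset.HasAntidiagonal.mem_antidiagonal, zero_add] at hij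
      exact absurd (by rw [hij]) hne
    · rw [hD.map_id_succ, Hom.zero_tens]
  · simp

theorem map_tens_id (k : ℕ) (a : Word n) {c d : Word n} (g : Hom c d) :
    D k (c ++ a) (d ++ a) (g.tens (Hom.id a)) = (D k c d g).tens (Hom.id a) := by
  rw [hD.map_tens, Finset.sum_eq_single (k, 0), hD.map_id_zero]
  · rintro ⟨i, j⟩ hij hne
    obtain rfl | j := j
    · simp only [Finset.HasAntidiagonal.mem_antidiagonal, add_zero] at hij
      exact absurd (by rw [hij]) hne
    · rw [hD.map_id_succ, Hom.tens_zero]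
  · simp

/-- Composition with a morphism all of whose higher derivatives vanish. -/
theorem map_comp_of_const (k : ℕ) {a b c : Word n} (f : Hom a b) (g : Hom b c)
    (h0 : D 0 b c g = g) (h : ∀ k, D (k + 1) b c g = 0) :
    D k a c (f.comp g) = (D k a b f).comp g := by
  rw [hD.map_comp, Finset.sum_eq_single (k, 0), h0]
  · rintro ⟨i, j⟩ hij hne
    obtain rfl | j := j
    · simp only [Finset.HasAntidiagonal.mem_antidiagonal, add_zero] at hij
      exact absurd (by rw [hij]) hne
    · rw [h, Hom.comp_zero]
  · simp

theorem map_const_comp (k : ℕ) {a b c : Word n} (f : Hom a b) (g : Hom b c)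
    (h0 : D 0 a b f = f) (h : ∀ k, D (k + 1) a b f = 0) :
    D k a c (f.comp g) = f.comp (D k b c g) := by
  rw [hD.map_comp, Finset.sum_eq_single (0, k), h0]
  · rintro ⟨i, j⟩ hij hne
    obtain rfl | i := i
    · simp only [Finset.HasAntidiagonal.mem_antidiagonal, zero_add] at hij
      exact absurd (by rw [hij]) hne
    · rw [h, Hom.zero_comp]
  · simp

theorem map_tens_of_const (k : ℕ) {a b c d : Word n} (f : Hom a b) (g : Hom c d)
    (h0 : D 0 c d g = g) (h : ∀ k, D (k + 1) c d g = 0) :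
    D k (a ++ c) (b ++ d) (f.tens g) = (D k a b f).tens g := by
  rw [hD.map_tens, Finset.sum_eq_single (k, 0), h0]
  · rintro ⟨i, j⟩ hij hne
    obtain rfl | j := j
    · simp only [Finset.HasAntidiagonal.mem_antidiagonal, add_zero] at hij
      exact absurd (by rw [hij]) hne
    · rw [h, Hom.tens_zero]
  · simp

theorem isDerivation (h0 : D 0 = 1) : IsDerivation (D 1) where
  map_comp f g := by
    rw [hD.map_comp]
    simp [Finset.Nat.antidiagonal_succ, h0, add_comm]
  map_tens f g := by
    rw [hD.map_tens]
    simp [Finset.Nat.antidiagonal_succ, h0, add_comm]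

omit hD in
/-- The product law on a single morphism. -/
def MulLaw (D : ℕ → Operator n) (a b : Word n) (f : Hom a b) : Prop :=
  ∀ k l, D k a b (D l a b f) = (k + l).choose k • D (k + l) a b f

theorem mulLaw_id (a : Word n) : MulLaw D a a (Hom.id a) := by
  rintro k (_ | l)
  · simp [hD.map_id_zero]
  · rw [hD.map_id_succ, ← add_assoc, hD.map_id_succ, map_zero, smul_zero]

theorem mulLaw_comp {a b c : Word n} (f : Hom a b) (g : Hom b c) (hf : MulLaw D a b f)
    (hg : MulLaw D b c g) : MulLaw D a c (f.comp g) := by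
  intro k l
  rw [hD.map_comp, hD.map_comp, map_sum]
  simp only [hD.map_comp, hf _ _, hg _ _]
  rw [Finset.sum_comm]
  exact sum_choose_convolution (Hom.compHom a b c) (fun k => D k a b f) (fun k => D k b c g) k l

theorem mulLaw_tens {a b c d : Word n} (f : Hom a b) (g : Hom c d) (hf : MulLaw D a b f)
    (hg : MulLaw D c d g) : MulLaw D (a ++ c) (b ++ d) (f.tens g) := by
  intro k l
  rw [hD.map_tens, hD.map_tens, map_sum]
  simp only [hD.map_tens, hf _ _, hg _ _]
  rw [Finset.sum_comm]
  exact sum_choose_convolution (Hom.tensorHom rfl rfl) (fun k => D k a b f)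
    (fun k => D k c d g) k l

omit hD in
theorem mulLaw_zero (a b : Word n) : MulLaw D a b 0 := fun k l => by simp

omit hD in
theorem mulLaw_add {a b : Word n} (f g : Hom a b) (hf : MulLaw D a b f) (hg : MulLaw D a b g) :
    MulLaw D a b (f + g) := fun k l => by
  rw [map_add, map_add, hf, hg, map_add, smul_add]

omit hD in
theorem mulLaw_neg {a b : Word n} (f : Hom a b) (hf : MulLaw D a b f) : MulLaw D a b (-f) :=
  fun k l => by rw [map_neg, map_neg, hf, map_neg, smul_neg]

/-- The product law for a morphism all of whose higher derivatives vanish. -/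
theorem mulLaw_of_const {a b : Word n} (f : Hom a b) (h0 : D 0 a b f = f)
    (h : ∀ k, D (k + 1) a b f = 0) : MulLaw D a b f := by
  rintro k (_ | l)
  · simp [h0]
  · rw [h, ← add_assoc, h, map_zero, smul_zero]

end IsHigherDerivation

theorem liftCoeff_isHigherDerivation {val : ∀ a b : Word n, Gen n a b → HomSeries a b}
    (h : RespectsLocalRel val) : IsHigherDerivation (liftCoeff h) where
  map_id_zero _ := HomSeries.const_apply_zero _
  map_id_succ k a := HomSeries.const_apply_succ (Hom.id a) k
  map_comp := liftCoeff_comp h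
  map_tens := liftCoeff_tens h

/-- The product law with l = 1 reads D_k D_1 = (k+1) D_{k+1}, and induction yields the factorial. -/
theorem factorial_smul_of_mul {D : ℕ → Operator n} (h0 : D 0 = 1)
    (h : ∀ k l : ℕ, D k * D l = (k + l).choose k • D (k + l)) (k : ℕ) :
    k.factorial • D k = D 1 ^ k := by
  induction k with
  | zero => simp [h0]
  | succ k ih =>
    rw [pow_succ, ← ih, smul_mul_assoc, h, Nat.choose_succ_self_right, smul_smul,
      Nat.factorial_succ, mul_comm]

end HeckeDiag


namespace HeckeDiag

variable {n : ℕ}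

open Finset (HasAntidiagonal.antidiagonal)
open PolySeries (pow)

/-! ### The divided powers of the raising and lowering operators -/

/-- The divided powers of the raising operator. -/
def raise : ℕ → Operator n := liftCoeff raiseVal_respects

/-- The divided powers of the lowering operator. -/
def lower : ℕ → Operator n := liftCoeff lowerVal_respects

theorem raise_isHigherDerivation : IsHigherDerivation (raise (n := n)) :=
  liftCoeff_isHigherDerivation _

theorem lower_isHigherDerivation : IsHigherDerivation (lower (n := n)) :=
  liftCoeff_isHigherDerivation _

namespace HomSeries

theorem comp_const_apply {a b c : Word n} (f : HomSeries a b) (g : Hom b c) (k : ℕ) :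
    (f.comp (const g)) k = (f k).comp g :=
  congrFun (cauchy_const_right _ f g) k

theorem const_comp_apply {a b c : Word n} (f : Hom a b) (g : HomSeries b c) (k : ℕ) :
    ((const f).comp g) k = f.comp (g k) :=
  congrFun (cauchy_const_left _ f g) k

theorem tensor_const_apply {a b c d s t : Word n} (f : HomSeries a b) (g : Hom c d)
    (hs : s = a ++ c) (ht : t = b ++ d) (k : ℕ) :
    (f.tensor (const g) hs ht) k = (f k).tensor g hs ht :=
  congrFun (cauchy_const_right _ f g) k

theorem one_sub_t_mul_C_smul_id (f : Hom (n := n) [] []) (a : Word n) :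
    (1 - PolySeries.t n * PolySeries.C f) • id a
      = id a - PolySeries.t n • (const (f.tens (Hom.id a)) : HomSeries a a) := by
  rw [sub_smul, one_smul, mul_smul]
  congr 2
  exact (const_tensor f (Hom.id a) rfl rfl).symm

theorem one_sub_t_mul_C_smul_id_zero (f : Hom (n := n) [] []) (a : Word n) :
    ((1 - PolySeries.t n * PolySeries.C f) • id a) 0 = Hom.id a := by
  rw [one_sub_t_mul_C_smul_id, sub_eq_add_neg, add_apply, neg_apply, PolySeries.t_smul_zero,
    neg_zero, add_zero]
  exact const_apply_zero _

theorem one_sub_t_mul_C_smul_id_one (f : Hom (n := n) [] []) (a : Word n) :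
    ((1 - PolySeries.t n * PolySeries.C f) • id a) 1 = -f.tens (Hom.id a) := by
  rw [one_sub_t_mul_C_smul_id, sub_eq_add_neg, add_apply, neg_apply, PolySeries.t_smul_succ,
    const_apply_zero, id, const_apply_succ, zero_add]

theorem one_sub_t_mul_C_smul_id_add_two (f : Hom (n := n) [] []) (a : Word n) (k : ℕ) :
    ((1 - PolySeries.t n * PolySeries.C f) • id a) (k + 2) = 0 := by
  rw [one_sub_t_mul_C_smul_id, sub_eq_add_neg, add_apply, neg_apply, PolySeries.t_smul_succ,
    const_apply_succ, id, const_apply_succ, neg_zero, zero_add]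

end HomSeries

/-- A polynomial placed between two strands. -/
def Hom.between (i : Color n) (f : Hom (n := n) [] []) : Hom [i, i] [i, i] :=
  (Hom.id [i]).tens (f.tens (Hom.id [i]))

section Values

theorem raise_x (k : ℕ) (j : Fin n) : raise k [] [] (Hom.x j) = pow (Hom.x j) (k + 1) :=
  HomSeries.const_tensor_apply (Hom.x j) (PolySeries.geom (Hom.x j)) rfl rfl k

theorem raise_enddot (k : ℕ) (i : Color n) :
    raise k [i] [] (Hom.enddot i) = (pow (Hom.x (lo i)) k).tens (Hom.enddot i) :=
  HomSeries.tensor_const_apply (PolySeries.geom (Hom.x (lo i))) (Hom.enddot i) rfl rfl k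

theorem raise_startdot (k : ℕ) (i : Color n) :
    raise k [] [i] (Hom.startdot i) = (pow (Hom.x (hi i)) k).tens (Hom.startdot i) :=
  HomSeries.tensor_const_apply (PolySeries.geom (Hom.x (hi i))) (Hom.startdot i) rfl rfl k

theorem raise_merge (k : ℕ) (i : Color n) : raise k [i, i] [i] (Hom.merge i)
    = ((Hom.id [i]).tens (((1 - PolySeries.t n * PolySeries.C (Hom.x (hi i))) •
      HomSeries.id [i]) k)).comp (Hom.merge i) :=
  (HomSeries.comp_const_apply _ (Hom.merge i) k).trans
    (congrArg (Hom.comp · _) (HomSeries.const_tensor_apply _ _ _ _ k))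

theorem raise_split (k : ℕ) (i : Color n) : raise k [i] [i, i] (Hom.split i)
    = (Hom.split i).comp ((Hom.id [i]).tens
      (((1 - PolySeries.t n * PolySeries.C (Hom.x (lo i))) • HomSeries.id [i]) k)) :=
  (HomSeries.const_comp_apply (Hom.split i) _ k).trans
    (congrArg (Hom.comp _ ·) (HomSeries.const_tensor_apply _ _ _ _ k))

theorem raise_zero_merge (i : Color n) : raise 0 [i, i] [i] (Hom.merge i) = Hom.merge i := by
  rw [raise_merge, HomSeries.one_sub_t_mul_C_smul_id_zero]
  exact (congrArg (Hom.comp · _) (Hom.tensor_id (a := [i]) (c := [i]) rfl)).trans (Hom.id_comp _)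

theorem raise_one_merge (i : Color n) : raise 1 [i, i] [i] (Hom.merge i)
    = -(Hom.between i (Hom.x (hi i))).comp (Hom.merge i) := by
  rw [raise_merge, HomSeries.one_sub_t_mul_C_smul_id_one]
  exact (congrArg (Hom.comp · _) (Hom.tens_neg (Hom.id [i]) _)).trans (Hom.neg_comp _ _)

theorem raise_add_two_merge (k : ℕ) (i : Color n) :
    raise (k + 2) [i, i] [i] (Hom.merge i) = 0 := by
  rw [raise_merge, HomSeries.one_sub_t_mul_C_smul_id_add_two]
  exact (congrArg (Hom.comp · _) (Hom.tens_zero (Hom.id [i]))).trans (Hom.zero_comp _)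

theorem raise_zero_split (i : Color n) : raise 0 [i] [i, i] (Hom.split i) = Hom.split i := by
  rw [raise_split, HomSeries.one_sub_t_mul_C_smul_id_zero]
  exact (congrArg (Hom.comp _ ·) (Hom.tensor_id (a := [i]) (c := [i]) rfl)).trans (Hom.comp_id _)

theorem raise_one_split (i : Color n) : raise 1 [i] [i, i] (Hom.split i)
    = -(Hom.split i).comp (Hom.between i (Hom.x (lo i))) := by
  rw [raise_split, HomSeries.one_sub_t_mul_C_smul_id_one]
  exact (congrArg (Hom.comp _ ·) (Hom.tens_neg (Hom.id [i]) _)).trans (Hom.comp_neg _ _)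

theorem raise_add_two_split (k : ℕ) (i : Color n) :
    raise (k + 2) [i] [i, i] (Hom.split i) = 0 := by
  rw [raise_split, HomSeries.one_sub_t_mul_C_smul_id_add_two]
  exact (congrArg (Hom.comp _ ·) (Hom.tens_zero (Hom.id [i]))).trans (Hom.comp_zero _)

theorem raise_zero_cross (i j : Color n) (h : Distant i j) :
    raise 0 [i, j] [j, i] (Hom.cross i j h) = Hom.cross i j h := HomSeries.const_apply_zero _

theorem raise_succ_cross (k : ℕ) (i j : Color n) (h : Distant i j) :
    raise (k + 1) [i, j] [j, i] (Hom.cross i j h) = 0 :=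
  HomSeries.const_apply_succ (Hom.cross i j h) k

theorem raise_zero_six (i j : Color n) (h : Adjacent i j) (hij : j.val + 1 = i.val) :
    raise 0 [i, j, i] [j, i, j] (Hom.six i j h) = Hom.six i j h :=
  (congrFun (raiseVal_six_down h (by omega)) 0).trans (HomSeries.const_apply_zero _)

theorem raise_succ_six (k : ℕ) (i j : Color n) (h : Adjacent i j) (hij : j.val + 1 = i.val) :
    raise (k + 1) [i, j, i] [j, i, j] (Hom.six i j h) = 0 :=
  (congrFun (raiseVal_six_down h (by omega)) (k + 1)).trans
    (HomSeries.const_apply_succ (Hom.six i j h) k)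

theorem lower_zero_x (j : Fin n) : lower 0 [] [] (Hom.x j) = Hom.x j := by
  change (PolySeries.C (Hom.x j) 0 + PolySeries.t n 0 : Hom [] []) = Hom.x j
  have h : PolySeries.t n 0 = 0 := Pi.single_eq_of_ne (M := fun _ => Hom (n := n) [] [])
    zero_ne_one _
  rw [h, add_zero]
  exact HomSeries.const_apply_zero _

theorem lower_one_x (j : Fin n) : lower 1 [] [] (Hom.x j) = Hom.id [] := by
  change (PolySeries.C (Hom.x j) 1 + PolySeries.t n 1 : Hom [] []) = Hom.id []
  have h : PolySeries.t n 1 = Hom.id [] := Pi.single_eq_same (M := fun _ => Hom (n := n) [] []) 1 _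
  rw [h, PolySeries.C, HomSeries.const_apply_succ, zero_add]

theorem lower_add_two_x (k : ℕ) (j : Fin n) : lower (k + 2) [] [] (Hom.x j) = 0 := by
  change (PolySeries.C (Hom.x j) (k + 2) + PolySeries.t n (k + 2) : Hom [] []) = 0
  have h : PolySeries.t n (k + 2) = 0 :=
    Pi.single_eq_of_ne (M := fun _ => Hom (n := n) [] []) (by omega) _
  rw [h, PolySeries.C, HomSeries.const_apply_succ, zero_add]

theorem lower_zero_of {a b : Word n} (g : Gen n a b) : lower 0 a b (Hom.of g) = Hom.of g := by
  cases g with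
  | box j => exact lower_zero_x j
  | _ => exact HomSeries.const_apply_zero _

theorem lower_succ_of (k : ℕ) {a b : Word n} (g : Gen n a b) (hg : ¬ g.IsBox) :
    lower (k + 1) a b (Hom.of g) = 0 := by
  cases g with
  | box j => exact absurd trivial hg
  | enddot i => exact HomSeries.const_apply_succ (Hom.enddot i) k
  | startdot i => exact HomSeries.const_apply_succ (Hom.startdot i) k
  | merge i => exact HomSeries.const_apply_succ (Hom.merge i) k
  | split i => exact HomSeries.const_apply_succ (Hom.split i) k
  | cross i j h => exact HomSeries.const_apply_succ (Hom.cross i j h) k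
  | six i j h => exact HomSeries.const_apply_succ (Hom.six i j h) k

end Values

/-! ### Powers of a polynomial -/

namespace PolySeries

theorem pow_add (f : Hom (n := n) [] []) (k l : ℕ) : pow f (k + l) = (pow f k).tens (pow f l) := by
  induction k with
  | zero => rw [zero_add]; exact (Hom.unit_tensor (pow f l) rfl rfl).symm
  | succ k ih =>
    rw [add_right_comm]
    exact (congrArg (Hom.tens f) ih).trans
      (Hom.tensor_assoc f (pow f k) (pow f l) rfl rfl rfl rfl rfl rfl rfl rfl).symm

theorem pow_one (f : Hom (n := n) [] []) : pow f 1 = f := Hom.tensor_unit f rfl rfl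

theorem between_comp_between (i : Color n) (f : Hom (n := n) [] []) (k l : ℕ) :
    (Hom.between i (pow f k)).comp (Hom.between i (pow f l)) = Hom.between i (pow f (k + l)) := by
  have h1 : (pow f k).comp (pow f l) = pow f (k + l) := by
    rw [pow_add]
    have h := Hom.interchange (pow f k) (Hom.id []) (Hom.id []) (pow f l) (s := []) (m := [])
      (t := []) rfl rfl rfl
    rw [Hom.comp_id, Hom.id_comp, Hom.tensor_unit, Hom.unit_tensor] at h
    exact h.symm
  have h2 := Hom.interchange (pow f k) (pow f l) (Hom.id [i]) (Hom.id [i]) (s := [i]) (m := [i])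
    (t := [i]) rfl rfl rfl
  have h3 := Hom.interchange (Hom.id [i]) (Hom.id [i]) ((pow f k).tens (Hom.id [i]))
    ((pow f l).tens (Hom.id [i])) (s := [i, i]) (m := [i, i]) (t := [i, i]) rfl rfl rfl
  rw [Hom.id_comp, h1] at h2
  rw [Hom.id_comp] at h3
  exact h3.symm.trans (congrArg (fun f => Hom.tensor (Hom.id [i]) f rfl rfl) h2.symm)

end PolySeries

open PolySeries

theorem sum_multichoose (l k : ℕ) :
    ∑ p ∈ HasAntidiagonal.antidiagonal k, l.multichoose p.2 = (l + 1).multichoose k := by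
  induction k with
  | zero => simp
  | succ k ih =>
    rw [Finset.Nat.sum_antidiagonal_succ, Nat.multichoose_succ_succ, ← ih]

theorem succ_multichoose (k l : ℕ) : (l + 1).multichoose k = (k + l).choose k := by
  rw [Nat.multichoose_eq]
  congr 1
  omega

/-- The coefficients of (x/(1 - t x))^l form the negative binomial series, here with multichoose
numbers. -/
theorem raise_pow (k l : ℕ) (j : Fin n) :
    raise k [] [] (pow (Hom.x j) l) = l.multichoose k • pow (Hom.x j) (l + k) := by
  induction l generalizing k with
  | zero =>
    rcases k with _ | k
    · simpa [pow] using raise_isHigherDerivation.map_id_zero []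
    · simpa [pow] using raise_isHigherDerivation.map_id_succ k []
  | succ l ih =>
    refine (raise_isHigherDerivation.map_tens k (Hom.x j) (pow (Hom.x j) l)).trans ?_
    rw [← sum_multichoose, Finset.sum_smul]
    refine Finset.sum_congr rfl fun p hp => ?_
    rw [raise_x, ih, Hom.tens_nsmul]
    refine congrArg (_ • ·) ((pow_add _ _ _).symm.trans (congrArg _ ?_))
    rw [Finset.HasAntidiagonal.mem_antidiagonal] at hp
    omega

/-- Applying the operators to x^l f multiplies the series of (x/(1 - t x))^l by 1/(1 - t x), and
summing multichoose numbers gives the binomial coefficient of the product law. -/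
theorem raise_mulLaw_pow_tens {a b : Word n} (f : Hom a b) (j : Fin n)
    (hf : ∀ k, raise k a b f = (pow (Hom.x j) k).tens f) :
    IsHigherDerivation.MulLaw raise a b f := by
  intro k l
  rw [hf]
  refine (raise_isHigherDerivation.map_tens k _ f).trans ?_
  rw [hf, ← succ_multichoose, ← sum_multichoose, ← Finset.Nat.sum_antidiagonal_swap,
    Finset.sum_smul]
  refine Finset.sum_congr rfl fun p hp => ?_
  rw [raise_pow, hf, Hom.nsmul_tens]
  refine congrArg (_ • ·) ((Hom.tensor_assoc (pow (Hom.x j) (l + p.2)) (pow (Hom.x j) p.1) f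
    rfl rfl rfl rfl rfl rfl rfl rfl).symm.trans ?_)
  refine congrArg (fun g : Hom [] [] => g.tens f) ((pow_add _ _ _).symm.trans (congrArg _ ?_))
  rw [Finset.HasAntidiagonal.mem_antidiagonal] at hp
  omega

theorem raise_between (k l : ℕ) (i : Color n) (j : Fin n) :
    raise k [i, i] [i, i] (Hom.between i (pow (Hom.x j) l))
      = l.multichoose k • Hom.between i (pow (Hom.x j) (l + k)) := by
  refine (raise_isHigherDerivation.map_id_tens k [i] _).trans ?_
  refine (congrArg (Hom.tens _) (raise_isHigherDerivation.map_tens_id k [i] _)).trans ?_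
  rw [raise_pow, Hom.nsmul_tens, Hom.tens_nsmul]
  rfl

theorem sum_antidiagonal_succ_of_linear {A : Type*} [AddCommMonoid A] (φ : ℕ × ℕ → A)
    (h : ∀ i j, φ (i, j + 2) = 0) (k : ℕ) :
    ∑ p ∈ HasAntidiagonal.antidiagonal (k + 1), φ p = φ (k, 1) + φ (k + 1, 0) := by
  rw [Finset.Nat.sum_antidiagonal_succ', Finset.sum_eq_single (k, 0)]
  · exact add_comm _ _
  · rintro ⟨i, _ | j⟩ hij hne
    · simp only [Finset.HasAntidiagonal.mem_antidiagonal, add_zero] at hij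
      exact absurd (by rw [hij]) hne
    · exact h i j
  · simp

theorem sum_antidiagonal_succ_of_linear' {A : Type*} [AddCommMonoid A] (φ : ℕ × ℕ → A)
    (h : ∀ i j, φ (i + 2, j) = 0) (k : ℕ) :
    ∑ p ∈ HasAntidiagonal.antidiagonal (k + 1), φ p = φ (1, k) + φ (0, k + 1) := by
  rw [← Finset.Nat.sum_antidiagonal_swap,
    sum_antidiagonal_succ_of_linear (fun p => φ p.swap) (fun i j => h j i)]
  rfl

/-- The series of the vertex is linear in t, so only l = 1 needs an argument. There the value -x f
must be killed by all operators of positive index. The two surviving terms of the Leibniz sum are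
the same power of x with opposite signs. -/
theorem raise_mulLaw_merge (i : Color n) :
    IsHigherDerivation.MulLaw raise [i, i] [i] (Hom.merge i) := by
  rintro k (_ | _ | l)
  · rw [raise_zero_merge, add_zero, Nat.choose_self, one_smul]
  · rw [zero_add, raise_one_merge, map_neg, raise_isHigherDerivation.map_comp,
      ← pow_one (Hom.x (hi i))]
    simp only [raise_between, Nat.multichoose_one, one_smul]
    rcases k with _ | k
    · simp [raise_zero_merge, raise_one_merge, pow_one]
    · rw [sum_antidiagonal_succ_of_linear _ fun i j => by rw [raise_add_two_merge, Hom.comp_zero],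
        raise_add_two_merge, raise_zero_merge, raise_one_merge, smul_zero, Hom.comp_neg,
        ← Hom.comp_assoc]
      have h := between_comp_between i (Hom.x (hi i)) (1 + k) 1
      rw [pow_one] at h
      rw [h, ← add_assoc, neg_add_cancel, neg_zero]
  · rw [raise_add_two_merge, show k + (l + 1 + 1) = k + l + 2 by ring, raise_add_two_merge,
      map_zero, smul_zero]

theorem raise_mulLaw_split (i : Color n) :
    IsHigherDerivation.MulLaw raise [i] [i, i] (Hom.split i) := by
  rintro k (_ | _ | l)
  · rw [raise_zero_split, add_zero, Nat.choose_self, one_smul]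
  · rw [zero_add, raise_one_split, map_neg, raise_isHigherDerivation.map_comp,
      ← pow_one (Hom.x (lo i))]
    simp only [raise_between, Nat.multichoose_one, one_smul]
    rcases k with _ | k
    · simp [raise_zero_split, raise_one_split, pow_one]
    · rw [sum_antidiagonal_succ_of_linear' _ fun i j => by rw [raise_add_two_split, Hom.zero_comp],
        raise_add_two_split, raise_zero_split, raise_one_split, smul_zero, Hom.neg_comp,
        Hom.comp_assoc]
      have h := between_comp_between i (Hom.x (lo i)) 1 (1 + k)
      rw [pow_one] at h
      rw [h, show 1 + (k + 1) = 1 + (1 + k) by ring, neg_add_cancel, neg_zero]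
  · rw [raise_add_two_split, show k + (l + 1 + 1) = k + l + 2 by ring, raise_add_two_split,
      map_zero, smul_zero]

/-- Convolution reduces the law to generators. Dots and variables give geometric series, trivalent
vertices linear polynomials, and the remaining vertices constants. -/
theorem raise_mulLaw {a b : Word n} (f : Hom a b) : IsHigherDerivation.MulLaw raise a b f := by
  have hD := raise_isHigherDerivation (n := n)
  induction f using Hom.gen_induction with
  | x j =>
    intro k l
    rw [raise_x, raise_pow, succ_multichoose, raise_x]
    congr 2
    ring
  | enddot i => exact raise_mulLaw_pow_tens _ _ (raise_enddot · i)
  | startdot i => exact raise_mulLaw_pow_tens _ _ (raise_startdot · i)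
  | merge i => exact raise_mulLaw_merge i
  | split i => exact raise_mulLaw_split i
  | cross i j h => exact hD.mulLaw_of_const _ (raise_zero_cross i j h) (raise_succ_cross · i j h)
  | six i j h hij => exact hD.mulLaw_of_const _ (raise_zero_six i j h hij) (raise_succ_six · i j h hij)
  | id a => exact hD.mulLaw_id a
  | comp f g hf hg => exact hD.mulLaw_comp f g hf hg
  | tens f g hf hg => exact hD.mulLaw_tens f g hf hg
  | zero a b => exact IsHigherDerivation.mulLaw_zero a b
  | add f g hf hg => exact IsHigherDerivation.mulLaw_add f g hf hg
  | neg f hf => exact IsHigherDerivation.mulLaw_neg f hf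

theorem lower_mulLaw {a b : Word n} (f : Hom a b) : IsHigherDerivation.MulLaw lower a b f := by
  have hD := lower_isHigherDerivation (n := n)
  have hg : ∀ {a b : Word n} (g : Gen n a b) (hg : ¬ g.IsBox),
      IsHigherDerivation.MulLaw lower a b (Hom.of g) := fun g hg =>
    hD.mulLaw_of_const _ (lower_zero_of g) (lower_succ_of · g hg)
  induction f using Hom.gen_induction with
  | x j =>
    rintro k (_ | _ | l)
    · rw [lower_zero_x, add_zero, Nat.choose_self, one_smul]
    · rw [zero_add, lower_one_x]
      rcases k with _ | k
      · rw [hD.map_id_zero, zero_add, lower_one_x, Nat.choose_zero_right, one_smul]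
      · rw [hD.map_id_succ, lower_add_two_x, smul_zero]
    · rw [lower_add_two_x, map_zero, ← add_assoc, ← add_assoc, lower_add_two_x, smul_zero]
  | enddot i => exact hg (.enddot i) id
  | startdot i => exact hg (.startdot i) id
  | merge i => exact hg (.merge i) id
  | split i => exact hg (.split i) id
  | cross i j h => exact hg (.cross i j h) id
  | six i j h _ => exact hg (.six i j h) id
  | id a => exact hD.mulLaw_id a
  | comp f g hf hg => exact hD.mulLaw_comp f g hf hg
  | tens f g hf hg => exact hD.mulLaw_tens f g hf hg
  | zero a b => exact IsHigherDerivation.mulLaw_zero a b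
  | add f g hf hg => exact IsHigherDerivation.mulLaw_add f g hf hg
  | neg f hf => exact IsHigherDerivation.mulLaw_neg f hf

theorem raise_zero_x (j : Fin n) : raise 0 [] [] (Hom.x j) = Hom.x j := by
  rw [raise_x, zero_add, pow_one]

namespace IsHigherDerivation

/-- The component of index zero is the identity, if it fixes the generators. -/
theorem map_zero_of_of {D : ℕ → Operator n} (hD : IsHigherDerivation D)
    (hx : ∀ j, D 0 [] [] (Hom.x j) = Hom.x j)
    (hen : ∀ i, D 0 [i] [] (Hom.enddot i) = Hom.enddot i)
    (hst : ∀ i, D 0 [] [i] (Hom.startdot i) = Hom.startdot i)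
    (hme : ∀ i, D 0 [i, i] [i] (Hom.merge i) = Hom.merge i)
    (hsp : ∀ i, D 0 [i] [i, i] (Hom.split i) = Hom.split i)
    (hcr : ∀ i j h, D 0 [i, j] [j, i] (Hom.cross i j h) = Hom.cross i j h)
    (hsi : ∀ i j h, j.val + 1 = i.val → D 0 [i, j, i] [j, i, j] (Hom.six i j h) = Hom.six i j h) :
    D 0 = 1 := by
  funext a b
  refine AddMonoidHom.ext fun f => ?_
  change D 0 a b f = f
  induction f using Hom.gen_induction with
  | x j => exact hx j
  | enddot i => exact hen i
  | startdot i => exact hst i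
  | merge i => exact hme i
  | split i => exact hsp i
  | cross i j h => exact hcr i j h
  | six i j h hij => exact hsi i j h hij
  | id a => exact hD.map_id_zero a
  | comp f g hf hg => rw [hD.map_comp]; simp [hf, hg]
  | tens f g hf hg => rw [hD.map_tens]; simp [hf, hg]
  | zero a b => exact map_zero _
  | add f g hf hg => rw [map_add, hf, hg]
  | neg f hf => rw [map_neg, hf]

theorem isDividedPowerSystem {D : ℕ → Operator n} (hD : IsHigherDerivation D) (h0 : D 0 = 1)
    (h : ∀ {a b : Word n} (f : Hom a b), MulLaw D a b f) : IsDividedPowerSystem D where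
  zero := h0
  mul k l := by
    funext a b
    exact AddMonoidHom.ext fun f => h f k l
  map_comp := hD.map_comp
  map_tens := hD.map_tens

end IsHigherDerivation

theorem raise_zero : raise (n := n) 0 = 1 := by
  refine raise_isHigherDerivation.map_zero_of_of raise_zero_x ?_ ?_ raise_zero_merge
    raise_zero_split raise_zero_cross raise_zero_six
  · exact fun i => (raise_enddot 0 i).trans (Hom.unit_tensor _ rfl rfl)
  · exact fun i => (raise_startdot 0 i).trans (Hom.unit_tensor _ rfl rfl)

theorem lower_zero : lower (n := n) 0 = 1 :=
  lower_isHigherDerivation.map_zero_of_of (lower_zero_of <| .box ·) (lower_zero_of <| .enddot ·)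
    (lower_zero_of <| .startdot ·) (lower_zero_of <| .merge ·) (lower_zero_of <| .split ·)
    (fun i j h => lower_zero_of (.cross i j h)) (fun i j h _ => lower_zero_of (.six i j h))

theorem raise_isDividedPowerSystem : IsDividedPowerSystem (raise (n := n)) :=
  raise_isHigherDerivation.isDividedPowerSystem raise_zero raise_mulLaw

theorem lower_isDividedPowerSystem : IsDividedPowerSystem (lower (n := n)) :=
  lower_isHigherDerivation.isDividedPowerSystem lower_zero lower_mulLaw

/-! ### Degrees -/

theorem IsHomogeneous.sum {ι : Type*} {a b : Word n} {s : Finset ι} {f : ι → Hom a b} {m : ℤ}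
    (h : ∀ i ∈ s, IsHomogeneous (f i) m) : IsHomogeneous (∑ i ∈ s, f i) m :=
  Finset.sum_induction f (IsHomogeneous · m) (fun _ _ => .add) (.zero a b m) h

theorem IsHomogeneous.pow {f : Hom (n := n) [] []} {m : ℤ} (h : IsHomogeneous f m) (k : ℕ) :
    IsHomogeneous (PolySeries.pow f k) (k * m) := by
  induction k with
  | zero =>
    rw [Nat.cast_zero, zero_mul]
    exact IsHomogeneous.id []
  | succ k ih =>
    have := h.tens ih
    rwa [show m + k * m = (k + 1 : ℕ) * m by push_cast; ring] at this

namespace IsHigherDerivation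

/-- A higher derivation shifts degrees, if it does so on the generators. -/
theorem isHomogeneous {D : ℕ → Operator n} (hD : IsHigherDerivation D) (d : ℤ)
    (hx : ∀ j k, IsHomogeneous (D k [] [] (Hom.x j)) (2 + d * k))
    (hen : ∀ i k, IsHomogeneous (D k [i] [] (Hom.enddot i)) (1 + d * k))
    (hst : ∀ i k, IsHomogeneous (D k [] [i] (Hom.startdot i)) (1 + d * k))
    (hme : ∀ i k, IsHomogeneous (D k [i, i] [i] (Hom.merge i)) (-1 + d * k))
    (hsp : ∀ i k, IsHomogeneous (D k [i] [i, i] (Hom.split i)) (-1 + d * k))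
    (hcr : ∀ i j h k, IsHomogeneous (D k [i, j] [j, i] (Hom.cross i j h)) (0 + d * k))
    (hsi : ∀ i j h k, j.val + 1 = i.val →
      IsHomogeneous (D k [i, j, i] [j, i, j] (Hom.six i j h)) (0 + d * k)) (k : ℕ)
    {a b : Word n} {f : Hom a b} {m : ℤ} (hf : IsHomogeneous f m) :
    IsHomogeneous (D k a b f) (m + d * k) := by
  refine hf.gen_induction (P := fun a b f m => ∀ k, IsHomogeneous (D k a b f) (m + d * k))
    hx hen hst hme hsp hcr (fun i j h hij k => hsi i j h k hij) ?_ ?_ ?_ ?_ ?_ ?_ k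
  · rintro a (_ | k)
    · rw [hD.map_id_zero]
      simpa using IsHomogeneous.id a
    · rw [hD.map_id_succ]
      exact .zero _ _ _
  · intro _ _ _ m m' f g hf hg k
    rw [hD.map_comp]
    refine IsHomogeneous.sum fun p hp => ?_
    rw [Finset.HasAntidiagonal.mem_antidiagonal] at hp
    have := (hf p.1).comp (hg p.2)
    rwa [show m + d * p.1 + (m' + d * p.2) = m + m' + d * k by rw [← hp]; push_cast; ring] at this
  · intro _ _ _ _ m m' f g hf hg k
    rw [hD.map_tens]
    refine IsHomogeneous.sum fun p hp => ?_
    rw [Finset.HasAntidiagonal.mem_antidiagonal] at hp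
    have := (hf p.1).tens (hg p.2)
    rwa [show m + d * p.1 + (m' + d * p.2) = m + m' + d * k by rw [← hp]; push_cast; ring] at this
  · intro a b m k
    rw [map_zero]
    exact .zero _ _ _
  · intro _ _ _ f g hf hg k
    rw [map_add]
    exact (hf k).add (hg k)
  · intro _ _ _ f hf k
    rw [map_neg]
    exact (hf k).neg

end IsHigherDerivation

theorem IsHomogeneous.between {f : Hom (n := n) [] []} {m : ℤ} (h : IsHomogeneous f m)
    (i : Color n) : IsHomogeneous (Hom.between i f) m := by
  have := (IsHomogeneous.id [i]).tens (h.tens (IsHomogeneous.id [i]))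
  rwa [add_zero, zero_add] at this

theorem isHomogeneous_x (j : Fin n) : IsHomogeneous (Hom.x j) 2 := .of (.box j)

theorem raise_isHomogeneous (k : ℕ) {a b : Word n} {f : Hom a b} {m : ℤ} (hf : IsHomogeneous f m) :
    IsHomogeneous (raise k a b f) (m + 2 * k) := by
  have cast : ∀ {a b : Word n} {f : Hom a b} {m m' : ℤ}, IsHomogeneous f m → m = m' →
      IsHomogeneous f m' := fun h e => e ▸ h
  refine raise_isHigherDerivation.isHomogeneous 2 ?_ ?_ ?_ ?_ ?_ ?_ ?_ k hf
  · intro j k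
    rw [raise_x]
    exact cast ((isHomogeneous_x j).pow (k + 1)) (by push_cast; ring)
  · intro i k
    rw [raise_enddot]
    exact cast (((isHomogeneous_x _).pow k).tens (.of (.enddot i))) (by simp [Gen.degree]; ring)
  · intro i k
    rw [raise_startdot]
    exact cast (((isHomogeneous_x _).pow k).tens (.of (.startdot i))) (by simp [Gen.degree]; ring)
  · rintro i (_ | _ | k)
    · rw [raise_zero_merge]
      exact cast (.of (.merge i)) rfl
    · rw [zero_add, raise_one_merge]
      exact cast (((isHomogeneous_x _).between i).comp (.of (.merge i))).neg rfl
    · rw [raise_add_two_merge]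
      exact .zero _ _ _
  · rintro i (_ | _ | k)
    · rw [raise_zero_split]
      exact cast (.of (.split i)) rfl
    · rw [zero_add, raise_one_split]
      exact cast (IsHomogeneous.comp (.of (.split i)) ((isHomogeneous_x _).between i)).neg rfl
    · rw [raise_add_two_split]
      exact .zero _ _ _
  · rintro i j h (_ | k)
    · rw [raise_zero_cross]
      exact cast (.of (.cross i j h)) rfl
    · rw [raise_succ_cross]
      exact .zero _ _ _
  · rintro i j h (_ | k) hij
    · rw [raise_zero_six i j h hij]
      exact cast (.of (.six i j h)) rfl
    · rw [raise_succ_six k i j h hij]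
      exact .zero _ _ _

theorem lower_isHomogeneous (k : ℕ) {a b : Word n} {f : Hom a b} {m : ℤ} (hf : IsHomogeneous f m) :
    IsHomogeneous (lower k a b f) (m - 2 * k) := by
  have hg : ∀ {a b : Word n} (g : Gen n a b) (_ : ¬ g.IsBox) (k : ℕ),
      IsHomogeneous (lower k a b (Hom.of g)) (g.degree + -2 * k) := by
    rintro a b g hg (_ | k)
    · rw [lower_zero_of]
      simpa using IsHomogeneous.of g
    · rw [lower_succ_of k g hg]
      exact .zero _ _ _
  rw [sub_eq_add_neg, ← neg_mul]
  refine lower_isHigherDerivation.isHomogeneous (-2) ?_ (fun i => hg (.enddot i) id)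
    (fun i => hg (.startdot i) id) (fun i => hg (.merge i) id) (fun i => hg (.split i) id)
    (fun i j h => hg (.cross i j h) id) (fun i j h k _ => hg (.six i j h) id k) k hf
  rintro j (_ | _ | k)
  · rw [lower_zero_x]
    simpa using isHomogeneous_x j
  · rw [zero_add, lower_one_x]
    exact IsHomogeneous.id []
  · rw [lower_add_two_x]
    exact .zero _ _ _

end HeckeDiag


namespace HeckeDiag

variable {n : ℕ}

open Finset (HasAntidiagonal.antidiagonal)
open PolySeries (pow)

/-! ### The commutation relation -/

/-- Kostant's commutation relation on a single morphism of weight `m`. -/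
def CommutationLaw (a b : Word n) (f : Hom a b) (m : ℤ) : Prop :=
  ∀ r s : ℕ, raise r a b (lower s a b f)
      = ∑ t ∈ Finset.range (min r s + 1),
          ((-1) ^ t * Ring.choose (m + r - s) t : ℤ) • lower (s - t) a b (raise (r - t) a b f)

/-- The binomial expansion of (x + t)^k. -/
theorem lower_pow (i k : ℕ) (j : Fin n) :
    lower i [] [] (pow (Hom.x j) k) = k.choose i • pow (Hom.x j) (k - i) := by
  induction k generalizing i with
  | zero =>
    rcases i with _ | i
    · simpa [pow] using lower_isHigherDerivation.map_id_zero []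
    · simpa [pow] using lower_isHigherDerivation.map_id_succ i []
  | succ k ih =>
    rcases i with _ | i
    · rw [lower_zero, Nat.choose_zero_right, one_smul]
      rfl
    refine (lower_isHigherDerivation.map_tens (i + 1) (Hom.x j) (pow (Hom.x j) k)).trans ?_
    rw [sum_antidiagonal_succ_of_linear' _ fun p q => by rw [lower_add_two_x]; exact Hom.zero_tens _]
    rw [lower_one_x, lower_zero_x, ih, ih, Nat.choose_succ_succ, add_smul, Nat.add_sub_add_right]
    refine congrArg₂ (· + ·) (Hom.unit_tensor _ rfl rfl) ?_
    refine (Hom.tens_nsmul _ _ _).trans ?_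
    rcases Nat.lt_or_ge i k with h | h
    · obtain ⟨l, rfl⟩ : ∃ l, k = i + l + 1 := ⟨k - i - 1, by omega⟩
      rw [show i + l + 1 - (i + 1) = l by omega, show i + l + 1 - i = l + 1 by omega]
      rfl
    · rw [Nat.choose_eq_zero_of_lt (by omega), zero_smul, zero_smul]

/-- All terms are multiples of the same F (r + e - s), and the coefficients add up to zero by the
alternating Vandermonde identity with c = 1 + e + r - s. The weight is 1 + e, with e = 0 for dots
and e = 1 for a variable. -/
theorem sum_commutation_choose {A : Type*} [AddCommGroup A] (F : ℕ → A) (e r s : ℕ) (hs : s ≠ 0)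
    (hsr : s ≤ r + e) :
    ∑ t ∈ Finset.range (s + 1), ((-1) ^ t * Ring.choose ((1 + e : ℤ) + r - s) t : ℤ) •
      ((r + e - t).choose (s - t) • F (r + e - t - (s - t))) = 0 := by
  have h := sum_neg_one_pow_choose_mul ((1 + e : ℤ) + r - s) s hs
  have h2 := congrArg (fun c : ℤ => c • F (r + e - s)) h
  simp only [Finset.sum_smul, zero_smul] at h2
  refine (Finset.sum_congr rfl fun t ht => ?_).trans h2
  rw [Finset.mem_range] at ht
  have h3 : ((1 + e : ℤ) + r - s - 1 + (s - t : ℕ) : ℤ) = ((r + e - t : ℕ) : ℤ) := by omega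
  rw [h3, Ring.choose_natCast, show r + e - t - (s - t) = r + e - s by omega, mul_smul _ _ (F _),
    natCast_zsmul]

namespace CommutationLaw

theorem of_lower_const {a b : Word n} {f : Hom a b} {m : ℤ} (h : ∀ k, lower (k + 1) a b f = 0)
    (hf : ∀ r s : ℕ, s ≠ 0 → ∑ t ∈ Finset.range (min r s + 1),
      ((-1) ^ t * Ring.choose (m + r - s) t : ℤ) • lower (s - t) a b (raise (r - t) a b f) = 0) :
    CommutationLaw a b f m := by
  rintro r (_ | s)
  · simp [lower_zero]
  · rw [h, map_zero, hf r _ s.succ_ne_zero]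

/-- Since all positive operators vanish, only t = r = s could contribute, and its coefficient
contains a binomial of 0 over a positive number. -/
theorem of_const {a b : Word n} {f : Hom a b} (hl : ∀ k, lower (k + 1) a b f = 0)
    (hr : ∀ k, raise (k + 1) a b f = 0) : CommutationLaw a b f 0 := by
  refine of_lower_const hl fun r s hs => Finset.sum_eq_zero fun t ht => ?_
  rw [Finset.mem_range] at ht
  rcases Nat.lt_or_ge t r with h | h
  · obtain ⟨u, hu⟩ : ∃ u, r - t = u + 1 := ⟨r - t - 1, by omega⟩
    rw [hu, hr, map_zero, smul_zero]
  · obtain rfl : t = r := by omega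
    rcases Nat.lt_or_ge t s with h' | h'
    · obtain ⟨u, hu⟩ : ∃ u, s - t = u + 1 := ⟨s - t - 1, by omega⟩
      rw [hu, Nat.sub_self, raise_zero]
      exact (congrArg _ (hl u)).trans (smul_zero _)
    · obtain rfl : t = s := by omega
      rw [zero_add, sub_self, Ring.choose_zero_ite, if_neg hs, mul_zero, zero_smul]

theorem of_dot {a b : Word n} {f : Hom a b} (j : Fin n) (h0 : lower 0 a b f = f)
    (hl : ∀ k, lower (k + 1) a b f = 0) (hr : ∀ k, raise k a b f = (pow (Hom.x j) k).tens f) :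
    CommutationLaw a b f 1 := by
  refine of_lower_const hl fun r s hs => ?_
  have key : ∀ i k, lower i a b ((pow (Hom.x j) k).tens f)
      = k.choose i • (pow (Hom.x j) (k - i)).tens f := by
    intro i k
    refine (lower_isHigherDerivation.map_tens_of_const i _ f h0 hl).trans ?_
    rw [lower_pow, Hom.nsmul_tens]
  simp only [hr, key]
  rcases Nat.lt_or_ge r s with h | h
  · refine Finset.sum_eq_zero fun t ht => ?_
    rw [Finset.mem_range] at ht
    rw [Nat.choose_eq_zero_of_lt (by omega), zero_smul, smul_zero]
  · rw [min_eq_right h]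
    have := sum_commutation_choose (fun k => ((pow (Hom.x j) k).tens f : Hom a b)) 0 r s hs h
    simpa only [Nat.cast_zero, add_zero] using this

/-- Raising gives x^{r+1}, so the right side is the case e = 1 of `sum_commutation_choose`. For
positive lowering index, the left side is nonzero only when r = 0 and that index is 1. -/
theorem x (j : Fin n) : CommutationLaw [] [] (Hom.x j) 2 := by
  rintro r (_ | s)
  · simp [lower_zero]
  simp only [raise_x, lower_pow]
  rcases Nat.lt_or_ge (r + 1) (s + 1) with h | h
  · obtain ⟨u, rfl⟩ : ∃ u, s = u + 1 := ⟨s - 1, by omega⟩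
    rw [lower_add_two_x, map_zero]
    refine (Finset.sum_eq_zero fun t ht => ?_).symm
    rw [Finset.mem_range] at ht
    rw [Nat.choose_eq_zero_of_lt (by omega), zero_smul, smul_zero]
  have hsum := sum_commutation_choose (fun k => pow (Hom.x j) k) 1 r (s + 1) s.succ_ne_zero h
  rw [show (1 : ℤ) + (1 : ℕ) = 2 by norm_num] at hsum
  rcases Nat.lt_or_ge r (s + 1) with h' | h'
  · obtain rfl : r = s := by omega
    rw [min_eq_left (Nat.le_succ r)]
    rcases r with _ | r
    · simp [lower_one_x, raise_zero]
      rfl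
    -- The vanishing sum has one more term than the range bounded by the minimum. That term has
    -- coefficient binom(1, r+2) = 0.
    · rw [lower_add_two_x, map_zero, ← hsum, Finset.sum_range_succ _ (r + 1 + 1)]
      rw [show (2 : ℤ) + (r + 1 : ℕ) - (r + 1 + 1 : ℕ) = (1 : ℕ) by push_cast; ring,
        Ring.choose_natCast (R := ℤ) 1 (r + 1 + 1), Nat.choose_eq_zero_of_lt (by omega), Nat.cast_zero, mul_zero, zero_smul,
        add_zero]
      refine Finset.sum_congr rfl fun t ht => ?_
      rw [Finset.mem_range] at ht
      rw [show r + 1 + 1 - t = r + 1 - t + 1 by omega]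
  · rw [min_eq_right h']
    have h0 : raise r [] [] (lower (s + 1) [] [] (Hom.x j)) = 0 := by
      rcases s with _ | s
      · obtain ⟨u, rfl⟩ : ∃ u, r = u + 1 := ⟨r - 1, by omega⟩
        rw [lower_one_x, raise_isHigherDerivation.map_id_succ]
      · rw [lower_add_two_x, map_zero]
    rw [h0, ← hsum]
    refine Finset.sum_congr rfl fun t ht => ?_
    rw [Finset.mem_range] at ht
    rw [show r + 1 - t = r - t + 1 by omega]

theorem choose_neg_one (k : ℕ) : Ring.choose (-1 : ℤ) k = (-1) ^ k := by
  rw [Ring.choose_neg, Units.smul_def, Int.coe_negOnePow_natCast, add_sub_cancel_left,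
    Ring.choose_natCast, Nat.choose_self, Nat.cast_one, smul_eq_mul, mul_one]

/-- A trivalent vertex f and g = d f span a representation of lowest weight -1, so only t = r and t
= r - 1 matter. For r = s > 0 these two terms are f and -f, because binom(-1, k) = (-1)^k. For s = r
- 1 > 0 the coefficient is binom(0, s) = 0, and in all other cases with s > 0 every term vanishes.
-/
theorem of_trivalent {a b : Word n} {f g : Hom a b} (hl : ∀ k, lower (k + 1) a b f = 0)
    (hr : raise 1 a b f = g) (hr' : ∀ k, raise (k + 2) a b f = 0) (hg : lower 1 a b g = -f)
    (hg' : ∀ k, lower (k + 2) a b g = 0) : CommutationLaw a b f (-1) := by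
  refine of_lower_const hl fun r s hs => ?_
  have hz : ∀ (c : ℤ) (i k : ℕ), 2 ≤ k → c • lower i a b (raise k a b f) = 0 := by
    intro c i k hk
    obtain ⟨u, rfl⟩ : ∃ u, k = u + 2 := ⟨k - 2, by omega⟩
    rw [hr', map_zero, smul_zero]
  have hl' : ∀ i, i ≠ 0 → lower i a b f = 0 := by
    intro i hi
    obtain ⟨u, rfl⟩ : ∃ u, i = u + 1 := ⟨i - 1, by omega⟩
    exact hl u
  have h0 : raise 0 a b f = f := by rw [raise_zero]; rfl
  have h0' : lower 0 a b f = f := by rw [lower_zero]; rfl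
  rcases r with _ | r
  · simp [h0, hl' s hs]
  rcases lt_trichotomy s r with h | rfl | h
  · refine Finset.sum_eq_zero fun t ht => ?_
    rw [Finset.mem_range] at ht
    exact hz _ _ _ (by omega)
  · rw [min_eq_right (Nat.le_succ s), Finset.sum_range_succ, Finset.sum_eq_zero, zero_add]
    · rw [show (-1 : ℤ) + (s + 1 : ℕ) - s = 0 by push_cast; ring, Ring.choose_zero_ite, if_neg hs,
        mul_zero, zero_smul]
    · intro t ht
      rw [Finset.mem_range] at ht
      exact hz _ _ _ (by omega)
  · rw [min_eq_left h, Finset.sum_range_succ, Finset.sum_range_succ, Finset.sum_eq_zero, zero_add,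
      Nat.add_sub_cancel_left, Nat.sub_self, hr, h0]
    · obtain ⟨u, rfl⟩ : ∃ u, s = r + 1 + u := ⟨s - (r + 1), by omega⟩
      rw [show r + 1 + u - r = u + 1 by omega, Nat.add_sub_cancel_left]
      rcases u with _ | u
      · rw [zero_add, hg, h0', add_zero, add_sub_cancel_right, choose_neg_one, choose_neg_one, ← mul_pow,
          ← mul_pow]
        simp
      · rw [hg', hl, smul_zero, smul_zero, add_zero]
    · intro t ht
      rw [Finset.mem_range] at ht
      exact hz _ _ _ (by omega)

/-- Kostant's relation is compatible with products because weights add, as expressed by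
`sum_commutation_convolution`. -/
theorem comp {a b c : Word n} {m m' : ℤ} (f : Hom a b) (g : Hom b c) (hf : CommutationLaw a b f m)
    (hg : CommutationLaw b c g m') : CommutationLaw a c (f.comp g) (m + m') := by
  intro r s
  have h := sum_commutation_convolution (Hom.compHom a b c)
    (fun u v => lower u a b (raise v a b f)) (fun u v => lower u b c (raise v b c g)) m m' r s
  simp only [← hf _ _, ← hg _ _] at h
  simp only [lower_isHigherDerivation.map_comp, raise_isHigherDerivation.map_comp, map_sum]
  exact h

theorem tens {a b c d : Word n} {m m' : ℤ} (f : Hom a b) (g : Hom c d)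
    (hf : CommutationLaw a b f m) (hg : CommutationLaw c d g m') :
    CommutationLaw (a ++ c) (b ++ d) (f.tens g) (m + m') := by
  intro r s
  have h := sum_commutation_convolution (Hom.tensorHom rfl rfl)
    (fun u v => lower u a b (raise v a b f)) (fun u v => lower u c d (raise v c d g)) m m' r s
  simp only [← hf _ _, ← hg _ _] at h
  simp only [lower_isHigherDerivation.map_tens, raise_isHigherDerivation.map_tens, map_sum]
  exact h

theorem zero (a b : Word n) (m : ℤ) : CommutationLaw a b 0 m := fun r s => by simp

theorem add {a b : Word n} {m : ℤ} (f g : Hom a b) (hf : CommutationLaw a b f m)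
    (hg : CommutationLaw a b g m) : CommutationLaw a b (f + g) m := fun r s => by
  simp only [map_add, smul_add, Finset.sum_add_distrib, hf r s, hg r s]

theorem neg {a b : Word n} {m : ℤ} (f : Hom a b) (hf : CommutationLaw a b f m) :
    CommutationLaw a b (-f) m := fun r s => by
  simp only [map_neg, smul_neg, Finset.sum_neg_distrib, hf r s]

theorem lower_between (k : ℕ) (i : Color n) (f : Hom (n := n) [] []) :
    lower k [i, i] [i, i] (Hom.between i f) = Hom.between i (lower k [] [] f) :=
  (lower_isHigherDerivation.map_id_tens k [i] _).trans
    (congrArg (Hom.tens _) (lower_isHigherDerivation.map_tens_id k [i] f))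

theorem between_id (i : Color n) : Hom.between i (Hom.id []) = Hom.id [i, i] :=
  (congrArg (Hom.tens (Hom.id [i])) (Hom.unit_tensor (Hom.id [i]) rfl rfl)).trans
    (Hom.tensor_id (a := [i]) (c := [i]) rfl)

theorem between_zero (i : Color n) : Hom.between i 0 = 0 :=
  (congrArg (Hom.tens (Hom.id [i])) (Hom.zero_tens (Hom.id [i]))).trans
    (Hom.tens_zero (Hom.id [i]))

end CommutationLaw

open CommutationLaw in
theorem IsHomogeneous.commutationLaw {a b : Word n} {f : Hom a b} {m : ℤ} (hf : IsHomogeneous f m) :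
    CommutationLaw a b f m := by
  have hl : ∀ {a b : Word n} (g : Gen n a b) (_ : ¬ g.IsBox) (k : ℕ),
      lower (k + 1) a b (Hom.of g) = 0 := fun g hg k => lower_succ_of k g hg
  refine hf.gen_induction CommutationLaw.x ?_ ?_ ?_ ?_ ?_ ?_ ?_ CommutationLaw.comp
    CommutationLaw.tens CommutationLaw.zero CommutationLaw.add CommutationLaw.neg
  · exact fun i => of_dot _ (lower_zero_of (.enddot i)) (hl (.enddot i) not_false) (raise_enddot · i)
  · exact fun i => of_dot _ (lower_zero_of (.startdot i)) (hl (.startdot i) not_false)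
      (raise_startdot · i)
  · intro i
    refine of_trivalent (hl (.merge i) not_false) (raise_one_merge i) (raise_add_two_merge · i) ?_ ?_
    · rw [map_neg, lower_isHigherDerivation.map_comp_of_const _ _ (Hom.merge i) (lower_zero_of (.merge i))
        (hl (.merge i) not_false), lower_between, lower_one_x, between_id, Hom.id_comp]
    · intro k
      rw [map_neg, lower_isHigherDerivation.map_comp_of_const _ _ (Hom.merge i) (lower_zero_of (.merge i))
        (hl (.merge i) not_false), lower_between, lower_add_two_x, between_zero, Hom.zero_comp, neg_zero]
  · intro i
    refine of_trivalent (hl (.split i) not_false) (raise_one_split i) (raise_add_two_split · i) ?_ ?_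
    · rw [map_neg, lower_isHigherDerivation.map_const_comp _ (Hom.split i) _ (lower_zero_of (.split i))
        (hl (.split i) not_false), lower_between, lower_one_x, between_id, Hom.comp_id]
    · intro k
      rw [map_neg, lower_isHigherDerivation.map_const_comp _ (Hom.split i) _ (lower_zero_of (.split i))
        (hl (.split i) not_false), lower_between, lower_add_two_x, between_zero, Hom.comp_zero, neg_zero]
  · exact fun i j h => of_const (hl (.cross i j h) not_false) (raise_succ_cross · i j h)
  · exact fun i j h hij => of_const (hl (.six i j h) not_false) (raise_succ_six · i j h hij)
  · exact fun a => of_const (lower_isHigherDerivation.map_id_succ · a)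
      (raise_isHigherDerivation.map_id_succ · a)

theorem isDividedPowersSl2Algebra :
    IsDividedPowersSl2Algebra (raise (n := n)) (lower (n := n)) where
  dd_system := raise_isDividedPowerSystem
  zz_system := lower_isDividedPowerSystem
  dd_degree k _ _ _ _ hf := raise_isHomogeneous k hf
  zz_degree k _ _ _ _ hf := lower_isHomogeneous k hf
  dd_zz r s _ _ _ _ hf := hf.commutationLaw r s

end HeckeDiag


namespace HeckeDiag

variable {n : ℕ}

open CategoryTheory
open PolySeries (pow)

/-! ### Derivations -/

namespace IsDerivation

variable {D E : Operator n}

theorem map_id (hD : IsDerivation D) (a : Word n) : D a a (Hom.id a) = 0 := by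
  have h := hD.map_comp (Hom.id a) (Hom.id a)
  rw [Hom.id_comp, Hom.comp_id, Hom.id_comp] at h
  exact left_eq_add.mp h

/-- Derivations that agree on the generators are equal. -/
theorem ext_of (hD : IsDerivation D) (hE : IsDerivation E)
    (h : ∀ {a b : Word n} (g : Gen n a b), D a b (Hom.of g) = E a b (Hom.of g)) : D = E := by
  funext a b
  refine AddMonoidHom.ext fun f => ?_
  change D a b f = E a b f
  induction f using Hom.gen_induction with
  | x j => exact h (.box j)
  | enddot i => exact h (.enddot i)
  | startdot i => exact h (.startdot i)
  | merge i => exact h (.merge i)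
  | split i => exact h (.split i)
  | cross i j hij => exact h (.cross i j hij)
  | six i j hij _ => exact h (.six i j hij)
  | id a => rw [hD.map_id, hE.map_id]
  | comp f g hf hg => rw [hD.map_comp, hE.map_comp, hf, hg]
  | tens f g hf hg => rw [hD.map_tens, hE.map_tens, hf, hg]
  | zero a b => rw [map_zero, map_zero]
  | add f g hf hg => rw [map_add, map_add, hf, hg]
  | neg f hf => rw [map_neg, map_neg, hf]

theorem add (hD : IsDerivation D) (hE : IsDerivation E) : IsDerivation (D + E) where
  map_comp {a b c} f g := by
    change D a c _ + E a c _ = (D a b f + E a b f).comp g + f.comp (D b c g + E b c g)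
    rw [hD.map_comp, hE.map_comp, Hom.add_comp, Hom.comp_add]
    abel
  map_tens {a b c d} f g := by
    change D _ _ _ + E _ _ _ = (D a b f + E a b f).tens g + f.tens (D c d g + E c d g)
    rw [hD.map_tens, hE.map_tens, Hom.add_tens, Hom.tens_add]
    abel

theorem neg (hD : IsDerivation D) : IsDerivation (-D) where
  map_comp {a b c} f g := by
    change -D a c _ = (-D a b f).comp g + f.comp (-D b c g)
    rw [hD.map_comp, Hom.neg_comp, Hom.comp_neg]
    abel
  map_tens {a b c d} f g := by
    change -D _ _ _ = (-D a b f).tens g + f.tens (-D c d g)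
    rw [hD.map_tens, Hom.neg_tens, Hom.tens_neg]
    abel

theorem lie_apply (D E : Operator n) {a b : Word n} (f : Hom a b) :
    ⁅D, E⁆ a b f = D a b (E a b f) - E a b (D a b f) := rfl

theorem lie (hD : IsDerivation D) (hE : IsDerivation E) : IsDerivation ⁅D, E⁆ where
  map_comp f g := by
    simp only [lie_apply, hD.map_comp, hE.map_comp, map_add, sub_eq_add_neg, Hom.add_comp,
      Hom.comp_add, Hom.neg_comp, Hom.comp_neg]
    abel
  map_tens f g := by
    simp only [lie_apply, hD.map_tens, hE.map_tens, map_add, sub_eq_add_neg, Hom.add_tens,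
      Hom.tens_add, Hom.neg_tens, Hom.tens_neg]
    abel

end IsDerivation

theorem IsRaising.unique {d d' : Operator n} (h : IsRaising d) (h' : IsRaising d') : d = d' := by
  refine h.toIsDerivation.ext_of h'.toIsDerivation fun g => ?_
  cases g with
  | box j => exact (h.map_x j).trans (h'.map_x j).symm
  | enddot i => exact (h.map_enddot i).trans (h'.map_enddot i).symm
  | startdot i => exact (h.map_startdot i).trans (h'.map_startdot i).symm
  | merge i => exact (h.map_merge i).trans (h'.map_merge i).symm
  | split i => exact (h.map_split i).trans (h'.map_split i).symm
  | cross i j hij => exact (h.map_cross i j hij).trans (h'.map_cross i j hij).symm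
  | six i j hij =>
    rcases hij with hij' | hij'
    · exact (h.map_six i j (.inl hij') hij').trans (h'.map_six i j (.inl hij') hij').symm
    · exact (h.map_six' i j (.inr hij') hij').trans (h'.map_six' i j (.inr hij') hij').symm

theorem IsLowering.unique {z z' : Operator n} (h : IsLowering z) (h' : IsLowering z') :
    z = z' := by
  refine h.toIsDerivation.ext_of h'.toIsDerivation fun g => ?_
  cases g with
  | box j => exact (h.map_x j).trans (h'.map_x j).symm
  | _ => refine (h.map_gen _ ?_).trans (h'.map_gen _ ?_).symm <;> exact not_false

theorem IsDegreeOperator.unique {z z' : Operator n} (h : IsDegreeOperator z)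
    (h' : IsDegreeOperator z') : z = z' :=
  h.toIsDerivation.ext_of h'.toIsDerivation fun g =>
    (h.map_homogeneous _ _ (.of g)).trans (h'.map_homogeneous _ _ (.of g)).symm

theorem IsLowering.map_isPolynomialFree {z : Operator n} (h : IsLowering z) {a b : Word n}
    {f : Hom a b} (hf : IsPolynomialFree f) : z a b f = 0 := by
  induction hf with
  | of g hg => exact h.map_gen g hg
  | id a => exact h.toIsDerivation.map_id a
  | comp _ _ hf hg => rw [h.map_comp, hf, hg, Hom.zero_comp, Hom.comp_zero, add_zero]
  | tens _ _ hf hg => rw [h.map_tens, hf, hg, Hom.zero_tens, Hom.tens_zero, add_zero]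

/-! ### The values of the raising operator -/

/-- Two formal expressions represent the same morphism if they act in the same way on the category
of power series. -/
theorem Hom.mk_eq_of_isValue {a b : Word n} {X Y : SeriesCat n} {f g : Term n a b} {φ ψ : X ⟶ Y}
    (h : φ = ψ) (hX : X = a ++ []) (hY : Y = b ++ []) (hf : IsValue constVal f [] φ hX hY)
    (hg : IsValue constVal g [] ψ hX hY) : Hom.mk f = Hom.mk g := by
  have := eval_eq_of_isValue h hX hY hf hg
  rw [eval_constVal, eval_constVal] at this
  -- The coefficient of t^0 recovers a morphism from its constant series.
  have h0 := congrFun this 0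
  rwa [HomSeries.const_apply_zero, HomSeries.const_apply_zero] at h0

theorem IsValue.neg {val : ∀ a b : Word n, Gen n a b → HomSeries a b} {a b q : Word n}
    {X Y : SeriesCat n} {f : Term n a b} {φ : X ⟶ Y} {hX : X = a ++ q} {hY : Y = b ++ q}
    (hf : IsValue val f q φ hX hY) : IsValue val f.neg q (-φ) hX hY :=
  ⟨(congrArg Neg.neg hf.eq).trans (HomSeries.neg_tensor _ _ _ _).symm⟩

namespace DiagAction.IsModel

variable {R : Type*} [CommRing R] {C : Type*} [Category C] [Preadditive C] [Linear R C]
  {F : Color n → C ⥤ C} [∀ i, (F i).Additive] {D : DiagAction R F} (hD : D.IsModel)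
include hD

/-- Forcing x_hi leftwards out of the space between the strands turns it into x_lo minus a broken
strand. The x_lo terms cancel, and the broken strand at the merge yields two dots. -/
theorem cap_variation (i : Color n) (X : C) :
    (D.me i X ≫ D.en i X) ≫ (D.x (lo i) • 𝟙 X)
        - ((F i).map (D.x (hi i) • 𝟙 ((F i).obj X)) ≫ D.me i X) ≫ D.en i X
      = D.en i ((F i).obj X) ≫ D.en i X := by
  rw [hD.force_hi]
  simp [Preadditive.sub_comp, br, reassoc_of% (hD.unit_left i X)]

theorem cup_variation (i : Color n) (X : C) :
    ((D.x (hi i) • 𝟙 X) ≫ D.st i X) ≫ D.sp i X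
        - D.st i X ≫ D.sp i X ≫ (F i).map (D.x (lo i) • 𝟙 ((F i).obj X))
      = -(D.st i X ≫ D.st i ((F i).obj X)) := by
  rw [hD.force_lo]
  simp [Preadditive.comp_add, br, reassoc_of% (hD.counit_left i X)]

/-- In the bottom region x_{i+1} is forced across j, giving x_{i+2} plus a broken j strand; in the
top region it is forced across i, giving x_i minus a broken i strand. All polynomial terms cancel.
-/
theorem six_variation {i j : Color n} (h : Adjacent i j) (hij : i.val + 1 = j.val) (X : C) :
    (D.x (lo i) • 𝟙 _) ≫ D.si i j h X + (D.x (hi j) • 𝟙 _) ≫ D.si i j h X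
        - (F i).map ((F j).map (D.x (hi i) • 𝟙 ((F i).obj X))) ≫ D.si i j h X
        - D.si i j h X ≫ (F j).map ((F i).map (D.x (hi i) • 𝟙 ((F j).obj X)))
      = D.si i j h X ≫ (F j).map (D.br i ((F j).obj X))
        - (F i).map (D.br j ((F i).obj X)) ≫ D.si i j h X := by
  have e : hi i = lo j := Fin.ext hij
  have h1 : ∀ X : C, (F i).map ((F j).map (D.x (hi i) • 𝟙 X))
      = D.x (hi j) • 𝟙 _ + (F i).map (D.br j X) := fun X => by
    rw [e, hD.force_lo, Functor.map_add, hD.force_other] <;>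
    · simp only [ne_eq, Fin.ext_iff, lo, hi]
      omega
  have h2 : ∀ X : C, (F j).map ((F i).map (D.x (hi i) • 𝟙 X))
      = D.x (lo i) • 𝟙 _ - (F j).map (D.br i X) := fun X => by
    rw [hD.force_hi, Functor.map_sub, hD.force_other] <;>
    · simp only [ne_eq, Fin.ext_iff, lo, hi]
      omega
  rw [h1, h2]
  simp only [Preadditive.add_comp, Preadditive.comp_sub, Linear.smul_comp, Linear.comp_smul,
    Category.id_comp, Category.comp_id]
  abel

end DiagAction.IsModel

namespace Term

local infixl:70 " ⬝ " => Term.comp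
local notation:80 f:81 " ⊠ " g:80 => Term.tensor f g rfl rfl

theorem mk_cap_variation (i : Color n) :
    Hom.mk (add (merge i ⬝ enddot i ⬝ box (lo i))
        (neg ((str [i] ⊠ box (hi i) ⊠ str [i]) ⬝ merge i ⬝ enddot i)))
      = Hom.mk ((enddot i ⊠ str [i]) ⬝ enddot i) := by
  refine Hom.mk_eq_of_isValue (baseAction_isModel.cap_variation i []) rfl rfl ?_ ?_
  all_goals
    repeat' first
      | refine IsValue.comp ?_ ?_ ?_
      | refine IsValue.left ?_ ?_ ?_
      | refine IsValue.right ?_ ?_ ?_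
      | refine IsValue.sub ?_ ?_
      | exact IsValue.box
      | exact ⟨rfl⟩
      | rfl

theorem mk_cup_variation (i : Color n) :
    Hom.mk (add (box (hi i) ⬝ startdot i ⬝ split i)
        (neg (startdot i ⬝ (split i ⬝ (str [i] ⊠ box (lo i) ⊠ str [i])))))
      = Hom.mk (neg (startdot i ⬝ (startdot i ⊠ str [i]))) := by
  refine Hom.mk_eq_of_isValue (baseAction_isModel.cup_variation i []) rfl rfl ?_ ?_
  all_goals
    repeat' first
      | refine IsValue.comp ?_ ?_ ?_
      | refine IsValue.left ?_ ?_ ?_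
      | refine IsValue.right ?_ ?_ ?_
      | refine IsValue.sub ?_ ?_
      | refine IsValue.neg ?_
      | exact IsValue.box
      | exact ⟨rfl⟩
      | rfl

theorem mk_six_variation {i j : Color n} (h : Adjacent i j) (hij : i.val + 1 = j.val) :
    Hom.mk (add (add (add ((box (lo i) ⊠ str [i, j, i]) ⬝ six i j h)
          ((box (hi j) ⊠ str [i, j, i]) ⬝ six i j h))
          (neg ((str [i, j] ⊠ box (hi i) ⊠ str [i]) ⬝ six i j h)))
        (neg (six i j h ⬝ (str [j, i] ⊠ box (hi i) ⊠ str [j]))))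
      = Hom.mk (add (six i j h ⬝ (str [j] ⊠ broken i ⊠ str [j]))
        (neg ((str [i] ⊠ broken j ⊠ str [i]) ⬝ six i j h))) := by
  refine Hom.mk_eq_of_isValue (baseAction_isModel.six_variation h hij []) rfl rfl ?_ ?_
  all_goals
    repeat' first
      | refine IsValue.comp ?_ ?_ ?_
      | refine IsValue.left_cons ?_ ?_ ?_
      | refine IsValue.left ?_ ?_ ?_
      | refine IsValue.right ?_ ?_ ?_
      | refine IsValue.sub ?_ ?_
      | refine IsValue.add ?_ ?_
      | exact IsValue.box
      | exact ⟨rfl⟩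
      | rfl

end Term

end HeckeDiag


/-! ### The coefficients of t and the sl_2 triple. -/

namespace HeckeDiag

variable {n : ℕ}

open PolySeries (pow)

namespace Hom

theorem tens_eq_comp_left {a b : Word n} (f : Hom (n := n) [] []) (g : Hom a b) :
    f.tens g = (f.tens (id a)).comp g := by
  have h := interchange f (id []) (id a) g (s := a) (m := a) (t := b) rfl rfl rfl
  rw [comp_id, id_comp, unit_tensor] at h
  exact h

theorem tens_eq_comp_of_target {a : Word n} (f : Hom (n := n) [] []) (g : Hom a []) :
    f.tens g = g.comp f := by
  have h := interchange (id []) f g (id []) (s := a) (m := []) (t := []) rfl rfl rfl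
  rw [comp_id, id_comp, unit_tensor, tensor_unit] at h
  exact h

theorem tens_eq_comp_of_source {b : Word n} (f : Hom (n := n) [] []) (g : Hom [] b) :
    f.tens g = f.comp g := by
  have h := interchange f (id []) (id []) g (s := []) (m := []) (t := b) rfl rfl rfl
  rw [comp_id, id_comp, unit_tensor, tensor_unit] at h
  exact h

theorem enddot_tens_enddot (i : Color n) :
    (enddot i).tens (enddot i) = ((enddot i).tens (id [i])).comp (enddot i) := by
  have h := interchange (enddot i) (id []) (id [i]) (enddot i) (s := [i, i]) (m := [i]) (t := [])
    rfl rfl rfl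
  rw [comp_id, id_comp, unit_tensor] at h
  exact h

theorem startdot_tens_startdot (i : Color n) :
    (startdot i).tens (startdot i) = (startdot i).comp ((startdot i).tens (id [i])) := by
  have h := interchange (id []) (startdot i) (startdot i) (id [i]) (s := []) (m := [i])
    (t := [i, i]) rfl rfl rfl
  rw [comp_id, id_comp, unit_tensor] at h
  exact h

end Hom

theorem raise_one_x (j : Fin n) : raise 1 [] [] (Hom.x j) = (Hom.x j).comp (Hom.x j) :=
  (raise_x 1 j).trans ((congrArg (Hom.tens (Hom.x j)) (PolySeries.pow_one (Hom.x j))).trans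
    (Hom.tens_eq_comp_of_source _ _))

theorem raise_one_enddot (i : Color n) :
    raise 1 [i] [] (Hom.enddot i) = (Hom.x (lo i)).tens (Hom.enddot i) := by
  rw [raise_enddot, PolySeries.pow_one]

theorem raise_one_startdot (i : Color n) :
    raise 1 [] [i] (Hom.startdot i) = (Hom.x (hi i)).tens (Hom.startdot i) := by
  rw [raise_startdot, PolySeries.pow_one]

theorem raise_one_isDerivation : IsDerivation (raise (n := n) 1) :=
  raise_isHigherDerivation.isDerivation raise_zero

theorem raise_one_cap (i : Color n) :
    raise 1 [i, i] [] (Hom.cap i) = (Hom.enddot i).tens (Hom.enddot i) := by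
  rw [Hom.cap, raise_one_isDerivation.map_comp, raise_one_merge, raise_one_enddot,
    Hom.tens_eq_comp_of_target, Hom.enddot_tens_enddot, add_comm, ← Hom.comp_assoc, Hom.neg_comp]
  exact Term.mk_cap_variation i

theorem raise_one_cup (i : Color n) :
    raise 1 [] [i, i] (Hom.cup i) = -(Hom.startdot i).tens (Hom.startdot i) := by
  rw [Hom.cup, raise_one_isDerivation.map_comp, raise_one_split, raise_one_startdot,
    Hom.tens_eq_comp_of_source, Hom.startdot_tens_startdot, Hom.comp_neg]
  exact Term.mk_cup_variation i

theorem PolySeries.smul_apply_zero {a b : Word n} (p : PolySeries n) (f : HomSeries a b)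
    (hp : p 0 = Hom.id []) : (p • f) 0 = f 0 := by
  refine (HomSeries.tensor_apply_zero p f rfl rfl).trans ?_
  rw [hp]
  exact Hom.unit_tensor _ rfl rfl

theorem PolySeries.smul_apply_one {a b : Word n} (p : PolySeries n) (f : HomSeries a b)
    (hp : p 0 = Hom.id []) : (p • f) 1 = f 1 + (p 1).tensor (s := a) (t := b) (f 0) rfl rfl := by
  refine (HomSeries.tensor_apply_one p f rfl rfl).trans ?_
  rw [hp]
  exact congrArg (· + _) (Hom.unit_tensor _ rfl rfl)

theorem HomSeries.id_tensor_one_sub (a b : Word n) (f : Hom (n := n) [] []) :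
    ((id a).tensor ((1 - PolySeries.t n * PolySeries.C f) • id b) rfl rfl) 0 = Hom.id (a ++ b)
    ∧ ((id a).tensor ((1 - PolySeries.t n * PolySeries.C f) • id b) rfl rfl) 1
      = -(Hom.id a).tens (f.tens (Hom.id b)) := by
  constructor
  · refine (const_tensor_apply _ _ _ _ _).trans ?_
    rw [one_sub_t_mul_C_smul_id_zero]
    exact Hom.tensor_id rfl
  · refine (const_tensor_apply _ _ _ _ _).trans ?_
    rw [one_sub_t_mul_C_smul_id_one]
    exact Hom.tens_neg _ _

/-- The linear coefficient of the product of four factors around the vertex is the sum of their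
linear coefficients, which `mk_six_variation` rewrites with broken strands. -/
theorem raise_one_six_up {i j : Color n} (h : Adjacent i j) (hij : i.val + 1 = j.val) :
    raise 1 [i, j, i] [j, i, j] (Hom.six i j h)
      = Hom.sixBrokenTop i j h - Hom.sixBrokenBottom i j h := by
  obtain ⟨hU, hU'⟩ := HomSeries.id_tensor_one_sub [i, j] [i] (Hom.x (hi i))
  obtain ⟨hV, hV'⟩ := HomSeries.id_tensor_one_sub [j, i] [j] (Hom.x (hi i))
  have hS := HomSeries.const_apply_zero (Hom.six i j h)
  have hS' := HomSeries.const_apply_succ (Hom.six i j h) 0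
  let y : Fin n → Hom [i, j, i] [i, j, i] := fun k => (Hom.x k).tens (Hom.id [i, j, i])
  have key : ∀ (U : HomSeries [i, j, i] [i, j, i]) (S : HomSeries [i, j, i] [j, i, j])
      (V : HomSeries [j, i, j] [j, i, j]), U 0 = Hom.id _ → V 0 = Hom.id _ →
      S 0 = Hom.six i j h → S 1 = 0 →
      ((PolySeries.geom (Hom.x (lo i)) * PolySeries.geom (Hom.x (hi j))) • U.comp (S.comp V)) 1
        = (y (lo i)).comp (Hom.six i j h)
          + (y (hi j)).comp (Hom.six i j h)
          + (U 1).comp (Hom.six i j h) + (Hom.six i j h).comp (V 1) := by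
    intro U S V hU hV hS hS'
    have h0 : (U.comp (S.comp V)) 0 = Hom.six i j h := by
      rw [HomSeries.comp_apply_zero, HomSeries.comp_apply_zero, hU, hV, hS, Hom.id_comp,
        Hom.comp_id]
    have h1 : (U.comp (S.comp V)) 1
        = (Hom.six i j h).comp (V 1) + (U 1).comp (Hom.six i j h) := by
      rw [HomSeries.comp_apply_one, HomSeries.comp_apply_one, HomSeries.comp_apply_zero, hU, hV,
        hS, hS', Hom.id_comp, Hom.comp_id, add_zero, Hom.comp_id]
    rw [mul_smul, PolySeries.smul_apply_one _ _ rfl, PolySeries.smul_apply_one _ _ rfl,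
      PolySeries.smul_apply_zero _ _ rfl, h0, h1]
    have h2 : ∀ k : Fin n, (PolySeries.geom (Hom.x k) 1).tensor
        (s := [i, j, i]) (t := [j, i, j]) (Hom.six i j h) rfl rfl
        = (y k).comp (Hom.six i j h) := fun k =>
      (congrArg (Hom.tens · (Hom.six i j h)) (PolySeries.pow_one (Hom.x k))).trans
        (Hom.tens_eq_comp_left _ _)
    rw [h2, h2]
    abel
  refine (congrFun (raiseVal_six_up h hij) 1).trans ((key _ _ _ hU hV hS hS').trans ?_)
  rw [sub_eq_add_neg]
  refine Eq.trans ?_ (Term.mk_six_variation h hij)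
  have e1 := (congrArg (Hom.comp · (Hom.six i j h)) hU').trans (Hom.neg_comp _ _)
  have e2 := (congrArg (Hom.comp (Hom.six i j h) ·) hV').trans (Hom.comp_neg _ _)
  exact congrArg₂ (fun p q : Hom [i, j, i] [j, i, j] =>
    (y (lo i)).comp (Hom.six i j h) + (y (hi j)).comp (Hom.six i j h) + p + q) e1 e2

theorem raise_one_isRaising : IsRaising (raise (n := n) 1) where
  toIsDerivation := raise_one_isDerivation
  map_x := raise_one_x
  map_enddot := raise_one_enddot
  map_startdot := raise_one_startdot
  map_split := raise_one_split
  map_merge := raise_one_merge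
  map_cross := raise_succ_cross 0
  map_six _ _ h hij := raise_one_six_up h hij
  map_six' := raise_succ_six 0

theorem lower_one_isLowering : IsLowering (lower (n := n) 1) where
  toIsDerivation := lower_isHigherDerivation.isDerivation lower_zero
  map_x := lower_one_x
  map_gen := lower_succ_of 0

/-! ### The `sl_2` triple -/

/-- Kostant's relation with r = s = 1 reads d z f = z d f - m f. This proves the first bracket
relation and at the same time the existence of h. -/
theorem lie_isDegreeOperator : IsDegreeOperator ⁅raise (n := n) 1, -lower (n := n) 1⁆ where
  toIsDerivation := raise_one_isDerivation.lie lower_one_isLowering.toIsDerivation.neg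
  map_homogeneous {a b} f m hf := by
    have h := hf.commutationLaw 1 1
    rw [IsDerivation.lie_apply]
    change raise 1 a b (-lower 1 a b f) - -lower 1 a b (raise 1 a b f) = _
    rw [map_neg, h]
    simp [Finset.sum_range_succ, raise_zero, lower_zero]

/-- Both sides are derivations, so it suffices to compare them on a generator of degree m, where the
bracket contributes the factor (m + c) - m. -/
theorem IsDegreeOperator.lie_eq {h D : Operator n} (hh : IsDegreeOperator h) (hD : IsDerivation D)
    (c : ℤ) (hc : ∀ {a b : Word n} (f : Hom a b) (m : ℤ), IsHomogeneous f m →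
      IsHomogeneous (D a b f) (m + c)) {E : Operator n} (hE : IsDerivation E)
    (hDE : ∀ (a b : Word n) (f : Hom a b), E a b f = c • D a b f) : ⁅h, D⁆ = E := by
  refine (hh.toIsDerivation.lie hD).ext_of hE fun g => ?_
  rw [IsDerivation.lie_apply, hDE, hh.map_homogeneous _ _ (.of g),
    hh.map_homogeneous _ _ (hc _ _ (.of g)), map_zsmul, add_smul, add_sub_cancel_left]

theorem lie_raise {h : Operator n} (hh : IsDegreeOperator h) : ⁅h, raise (n := n) 1⁆ = 2 • raise 1 := by
  refine hh.lie_eq raise_one_isDerivation 2 (fun f m hf => raise_isHomogeneous 1 hf)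
    (by rw [two_nsmul]; exact raise_one_isDerivation.add raise_one_isDerivation) fun a b f => ?_
  exact (natCast_zsmul (raise 1 a b f) 2).symm

theorem lie_neg_lower {h : Operator n} (hh : IsDegreeOperator h) :
    ⁅h, -lower (n := n) 1⁆ = -(2 • -lower 1) := by
  have hz := (lower_one_isLowering (n := n)).toIsDerivation.neg
  refine hh.lie_eq hz (-2) (fun f m hf => (lower_isHomogeneous 1 hf).neg)
    (by rw [two_nsmul]; exact (hz.add hz).neg) fun a b f => ?_
  change -(2 • -lower 1 a b f) = (-2 : ℤ) • -lower 1 a b f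
  rw [neg_smul]
  exact congrArg Neg.neg (natCast_zsmul (-lower 1 a b f) 2).symm

end HeckeDiag

theorem mainTheorem2 (n : ℕ) :
    -- the derivations `d`, `z` and the degree operator `h` are well defined
    (∃! d : HeckeDiag.Operator n, HeckeDiag.IsRaising d) ∧
    (∃! z : HeckeDiag.Operator n, HeckeDiag.IsLowering z) ∧
    (∃! h : HeckeDiag.Operator n, HeckeDiag.IsDegreeOperator h) ∧
    ∀ d z h : HeckeDiag.Operator n,
      HeckeDiag.IsRaising d → HeckeDiag.IsLowering z → HeckeDiag.IsDegreeOperator h →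
      -- the remaining prescribed values
      (∀ i : HeckeDiag.Color n,
        d [i, i] [] (HeckeDiag.Hom.cap i)
          = (HeckeDiag.Hom.enddot i).tens (HeckeDiag.Hom.enddot i)) ∧
      (∀ i : HeckeDiag.Color n,
        d [] [i, i] (HeckeDiag.Hom.cup i)
          = -(HeckeDiag.Hom.startdot i).tens (HeckeDiag.Hom.startdot i)) ∧
      (∀ (a b : HeckeDiag.Word n) (f : HeckeDiag.Hom a b),
        HeckeDiag.IsPolynomialFree f → z a b f = 0) ∧
      -- `(d, h, -z)` is an `sl_2` triple
      ⁅d, -z⁆ = h ∧ ⁅h, d⁆ = 2 • d ∧ ⁅h, -z⁆ = -(2 • -z) ∧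
      -- the divided powers exist integrally and form a divided powers `sl_2`-algebra
      ∃ dd zz : ℕ → HeckeDiag.Operator n,
        (∀ k : ℕ, k.factorial • dd k = d ^ k) ∧
        (∀ k : ℕ, k.factorial • zz k = z ^ k) ∧
        HeckeDiag.IsDividedPowersSl2Algebra dd zz := by
  refine ⟨⟨_, HeckeDiag.raise_one_isRaising, fun d hd => hd.unique HeckeDiag.raise_one_isRaising⟩,
    ⟨_, HeckeDiag.lower_one_isLowering, fun z hz => hz.unique HeckeDiag.lower_one_isLowering⟩,
    ⟨_, HeckeDiag.lie_isDegreeOperator, fun h hh => hh.unique HeckeDiag.lie_isDegreeOperator⟩,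
    fun d z h hd hz hh => ?_⟩
  -- By uniqueness, arbitrary d and z are the linear coefficients of the two exponentials, whose
  -- remaining coefficients provide the divided powers.
  obtain rfl := hd.unique HeckeDiag.raise_one_isRaising
  obtain rfl := hz.unique HeckeDiag.lower_one_isLowering
  exact ⟨HeckeDiag.raise_one_cap, HeckeDiag.raise_one_cup,
    fun a b f hf => hz.map_isPolynomialFree hf, HeckeDiag.lie_isDegreeOperator.unique hh,
    HeckeDiag.lie_raise hh, HeckeDiag.lie_neg_lower hh, HeckeDiag.raise, HeckeDiag.lower,
    HeckeDiag.factorial_smul_of_mul HeckeDiag.raise_zero HeckeDiag.raise_isDividedPowerSystem.mul,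
    HeckeDiag.factorial_smul_of_mul HeckeDiag.lower_zero HeckeDiag.lower_isDividedPowerSystem.mul,
    HeckeDiag.isDividedPowersSl2Algebra⟩
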